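/- **Setting.** Let $\mathcal X,\mathcal Y$ be separable reflexive real Banach spaces with duals $\mathcal X',\mathcal Y'$, let $A_0,A_1,A_2,\dots\in\mathcal L(\mathcal X,\mathcal Y')$, $U=[-\frac12,\frac12]^{\mathbb N}$, and $A(y)=A_0+\sum_{j\ge1}y_jA_j$ for $y\in U$. Assume: 1. $A_0$ is boundedly invertible: for some $\mu_0>0$, $$\inf_{0\ne v\in\mathcal X}\sup_{0\ne w\in\mathcal Y}\frac{\langle w,A_0v\rangle}{\|v\|_{\mathcal X}\|w\|_{\mathcal Y}}\ge\mu_0,\qquad \inf_{0\ne w\in\mathcal Y}\sup_{0\ne v\in\mathcal X}\frac{\langle w,A_0v\rangle}{\|v\|_{\mathcal X}\|w\|_{\mathcal Y}}\ge\mu_0 .$$ 2. With $\beta_j:=\|A_0^{-1}A_j\|_{\mathcal L(\mathcal X,\mathcal X)}$, $j\ge1$: $\sum_j\beta_j\le\kappa<2$ for some $\kappa>0$, and $\beta_1\ge\beta_2\ge\cdots$. 3. $\sum_{j\ge1}\|A_j\|_{\mathcal L(\mathcal X,\mathcal Y')}^p<\infty$ for a given $p\in(0,1]$. 4. $\{\mathcal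 X_t\}_{t\ge0}$, $\{\mathcal Y_t\}_{t\ge0}$, $\{\mathcal X'_t\}_{t\ge0}$, $\{\mathcal Y'_t\}_{t\ge0}$ are scales of normed spaces, decreasing in $t$ with continuous embeddings, with $\mathcal X_0=\mathcal X$, $\mathcal Y_0=\mathcal Y$, $\mathcal X'_0=\mathcal X'$, $\mathcal Y'_0=\mathcal Y'$. 5. $\mathcal X^h\subset\mathcal X$ and $\mathcal Y^h\subset\mathcal Y$, $h>0$, are finite-dimensional subspaces, and for some $h_0,\bar\mu>0$ the discrete inf-sup conditions hold: for all $0<h\le h_0$ and $y\in U$, both inequalities of 1. hold with $A(y),\mathcal X^h,\mathcal Y^h,\bar\mu$ in place of $A_0,\mathcal X,\mathcal Y,\mu_0$. 6. (Approximation) For all $0<t\le\bar t$ there is $C_t$ such that $\inf_{v^h\in\mathcal X^h}\|v-v^h\|_{\mathcal X}\le C_th^t\|v\|_{\mathcal X_t}$ for $v\in\mathcal X_t$ and $0<h\le h_0$, and for all $0<t'\le\bar t'$ there is $C_{t'}$ such that $\inf_{w^h\in\mathcal Y^h}\|w-w^h\|_{\mathcal Y}\le C_{t'}h^{t'}\|w\|_{\mathcal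 Y_{t'}}$ for $w\in\mathcal Y_{t'}$ and $0<h\le h_0$. 7. (Regularity) For every $0\le t\le\bar t$: $\sup_{y\in U}\|A(y)^{-1}\|_{\mathcal L(\mathcal Y'_t,\mathcal X_t)}<\infty$. For $f\in\mathcal Y'$, $G\in\mathcal X'$ let $u(y)=A(y)^{-1}f$, and let $u^h(y)\in\mathcal X^h$ satisfy $\langle w^h,A(y)u^h(y)\rangle=\langle w^h,f\rangle$ for all $w^h\in\mathcal Y^h$. Let $u^h_s(y_1,\dots,y_s)=u^h(y_1,\dots,y_s,0,0,\dots)$ and $I(G(u))=\int_UG(u(y))\,dy$, where $dy$ is the product of the uniform probability measures. For a prime $b$, $m\ge1$ and $\alpha=\lfloor1/p\rfloor+1$, an *interlaced polynomial lattice rule* of order $\alpha$ with $N=b^m$ points in $s$ dimensions is given by an irreducible $P\in\mathbb Z_b[x]$ of degree $m$ and nonzero $q_1,\dots,q_{\alpha s}\in\mathbb Z_b[x]$ of degree less than $m$. The $j$-th coordinate of its $n$-th point, $0\le n<N$, is obtained by interlacing the base-$b$ digits (all first digits, then all second digits, and so on) of the $\alpha$ numbers $v_m(n(x)q_i(x)/P(x))$,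 $(j-1)\alpha<i\le j\alpha$. Here $n(x)$ has the base-$b$ digits of $n$ as coefficients and $v_m(\sum_\ell t_\ell x^{-\ell})=\sum_{\ell=1}^mt_\ell b^{-\ell}$. For the points $y_0,\dots,y_{N-1}$ put $$Q_{N,s}(G(u^h_s))=\frac1N\sum_{n=0}^{N-1}G\big(u^h_s(y_n-\tfrac12)\big).$$ **Theorem.** Under these assumptions, $A(y)$ is boundedly invertible and $u^h(y)$ exists and is unique for all $y\in U$, $0<h\le h_0$ and $f\in\mathcal Y'$, and $G(u(\cdot))$ is integrable over $U$ for all $f\in\mathcal Y'$, $G\in\mathcal X'$. Let $0<t\le\bar t$, $0<t'\le\bar t'$, let $K$ be a real number and let $b$ be prime. Then there is $C>0$, independent of $s$, $h$, $N$, $f$ and $G$, such that for all $s,m\ge1$, $N=b^m$, and every irreducible modulus $P$ of degree $m$ there is a generating vector $(q_1,\dots,q_{\alpha s})$, independent of $h$, $f$ and $G$, whose interlaced polynomial lattice rule of order $\alpha=\lfloor1/p\rfloor+1$ satisfies $$|I(G(u))-Q_{N,s}(G(u_s^h))|\le C\big(\kappa(s,N)\,\|f\|_{\mathcal Y'}\|G\|_{\mathcal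 X'}+h^{t+t'}\|f\|_{\mathcal Y'_t}\|G\|_{\mathcal X'_{t'}}\big)$$ for all $0<h\le h_0$, all $f\in\mathcal Y'_t$ and all $G\in\mathcal X'_{t'}$ with the adjoint regularity: for every $y\in U$, the $w(y)\in\mathcal Y$ with $\langle w(y),A(y)v\rangle=G(v)$ for all $v\in\mathcal X$ lies in $\mathcal Y_{t'}$ and $\|w(y)\|_{\mathcal Y_{t'}}\le K\|G\|_{\mathcal X'_{t'}}$. Here $$\kappa(s,N)=\begin{cases}s^{-2(1/p-1)}+N^{-1/p}&\text{if }p\in(0,1),\\ \big(\sum_{j>s}\beta_j\big)^2+N^{-1}&\text{if }p=1.\end{cases}$$ -/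

import Mathlib

open MeasureTheory Set
open scoped NNReal Polynomial

noncomputable section

namespace QMCPetrovGalerkin

section Operators

variable {X Y : Type*} [NormedAddCommGroup X] [NormedSpace ℝ X]
  [NormedAddCommGroup Y] [NormedSpace ℝ Y]

/-- Reflexivity: the canonical map into the double dual is onto. -/
def IsReflexive (E : Type*) [NormedAddCommGroup E] [NormedSpace ℝ E] : Prop :=
  Function.Surjective (NormedSpace.inclusionInDoubleDual ℝ E)

/-- For an operator `B : X → Y'` with bilinear form `(v, w) ↦ ⟨w, B v⟩ = B v w`, the two inf-sup
conditions with constant `μ` on the pair of subspaces `V ⊆ X`, `W ⊆ Y`. -/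
def InfSup (B : X →L[ℝ] StrongDual ℝ Y) (V : Submodule ℝ X) (W : Submodule ℝ Y) (μ : ℝ) : Prop :=
  (∀ v ∈ V, v ≠ 0 → μ ≤ ⨆ w : {w : Y // w ∈ W ∧ w ≠ 0}, B v w / (‖v‖ * ‖(w : Y)‖)) ∧
  (∀ w ∈ W, w ≠ 0 → μ ≤ ⨆ v : {v : X // v ∈ V ∧ v ≠ 0}, B v w / (‖(v : X)‖ * ‖w‖))

/-- `β_j = ‖A₀⁻¹ A_j‖`, the norm of a bounded operator on `X`.  Sequences that the literature
indexes by `j ≥ 1` are indexed here from `0`: `A j` is the `(j + 1)`-st fluctuation operator. -/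
def beta (A₀ : X →L[ℝ] StrongDual ℝ Y) (A : ℕ → X →L[ℝ] StrongDual ℝ Y) (j : ℕ) : ℝ :=
  ‖A₀.inverse.comp (A j)‖

/-- The affine-parametric operator `A(y) = A₀ + ∑ j, y_j A_j`. -/
def affineOp (A₀ : X →L[ℝ] StrongDual ℝ Y) (A : ℕ → X →L[ℝ] StrongDual ℝ Y) (y : ℕ → ℝ) :
    X →L[ℝ] StrongDual ℝ Y :=
  A₀ + ∑' j, y j • A j

/-- The exact solution `u(y) = A(y)⁻¹ f`. -/
def solution (A₀ : X →L[ℝ] StrongDual ℝ Y) (A : ℕ → X →L[ℝ] StrongDual ℝ Y)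
    (f : StrongDual ℝ Y) (y : ℕ → ℝ) : X :=
  (affineOp A₀ A y).inverse f

/-- `u` solves the Petrov-Galerkin problem for `B u = f` with trial space `V` and test space
`W`. -/
def IsPGSolution (B : X →L[ℝ] StrongDual ℝ Y) (V : Submodule ℝ X) (W : Submodule ℝ Y)
    (f : StrongDual ℝ Y) (u : X) : Prop :=
  u ∈ V ∧ ∀ w ∈ W, B u w = f w

/-- The Petrov-Galerkin solution for the parameter `y`. -/
def pgSolution (A₀ : X →L[ℝ] StrongDual ℝ Y) (A : ℕ → X →L[ℝ] StrongDual ℝ Y)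
    (V : Submodule ℝ X) (W : Submodule ℝ Y) (f : StrongDual ℝ Y) (y : ℕ → ℝ) : X :=
  Classical.epsilon (IsPGSolution (affineOp A₀ A y) V W f)

end Operators

section Parameters

/-- The parameter domain `U = [-1/2, 1/2]^ℕ`. -/
def paramDomain : Set (ℕ → ℝ) := {y | ∀ j, y j ∈ Icc (-1 / 2 : ℝ) (1 / 2)}

/-- The uniform distribution on `[-1/2, 1/2]`. -/
def uniformMeasure : Measure ℝ := volume.restrict (Icc (-1 / 2 : ℝ) (1 / 2))

instance uniformMeasure_isProbabilityMeasure : IsProbabilityMeasure uniformMeasure := by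
  constructor
  rw [uniformMeasure, Measure.restrict_apply_univ, Real.volume_Icc]
  norm_num

/-- The measure `dy` on `U`: the countable product of the uniform distributions. -/
def paramMeasure : Measure (ℕ → ℝ) := Measure.infinitePi fun _ => uniformMeasure

/-- A vector of `s` parameters, extended by `y_j = 0` for the remaining indices. -/
def extendZero {s : ℕ} (y : Fin s → ℝ) (j : ℕ) : ℝ := if h : j < s then y ⟨j, h⟩ else 0

end Parameters

section Scales

/-- A scale `E = E_0 ⊇ E_t ⊇ E_{t'}` (`0 ≤ t ≤ t'`) of normed spaces with continuous embeddings.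
`nrm t` is the norm of `E_t`; it is definite since `E_t` embeds continuously into `E`. -/
structure SmoothnessScale (E : Type*) [NormedAddCommGroup E] [NormedSpace ℝ E] where
  space : ℝ≥0 → Submodule ℝ E
  nrm : ∀ t, Seminorm ℝ (space t)
  space_zero : space 0 = ⊤
  nrm_zero : ∀ v : space 0, nrm 0 v = ‖(v : E)‖
  anti : Antitone space
  embed : ∀ ⦃t t' : ℝ≥0⦄ (h : t ≤ t'), ∃ c : ℝ, ∀ v : space t',
    nrm t ⟨v, anti h v.2⟩ ≤ c * nrm t' v

/-- The approximation property of the family `V h`, `0 < h ≤ h₀`, in the scale `S` up to the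
order `tmax`. -/
def ApproximationProperty {E : Type*} [NormedAddCommGroup E] [NormedSpace ℝ E]
    (S : SmoothnessScale E) (V : ℝ → Submodule ℝ E) (h₀ : ℝ) (tmax : ℝ≥0) : Prop :=
  ∀ t : ℝ≥0, 0 < t → t ≤ tmax → ∃ C : ℝ, ∀ h : ℝ, 0 < h → h ≤ h₀ → ∀ v : S.space t,
    ⨅ vh : V h, ‖(v : E) - (vh : E)‖ ≤ C * h ^ (t : ℝ) * S.nrm t v

variable {X Y : Type*} [NormedAddCommGroup X] [NormedSpace ℝ X]
  [NormedAddCommGroup Y] [NormedSpace ℝ Y]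

/-- `sup_{y ∈ U} ‖A(y)⁻¹‖_{L(Y'_t, X_t)} < ∞` for all `0 ≤ t ≤ tmax`; in particular
`A(y)⁻¹ f ∈ X_t` for `f ∈ Y'_t`. -/
def SolutionRegularity (A₀ : X →L[ℝ] StrongDual ℝ Y) (A : ℕ → X →L[ℝ] StrongDual ℝ Y)
    (SX : SmoothnessScale X) (SYd : SmoothnessScale (StrongDual ℝ Y)) (tmax : ℝ≥0) : Prop :=
  ∀ t : ℝ≥0, t ≤ tmax → ∃ M : ℝ, ∀ y ∈ paramDomain, ∀ f : SYd.space t,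
    ∃ hu : solution A₀ A f y ∈ SX.space t, SX.nrm t ⟨solution A₀ A f y, hu⟩ ≤ M * SYd.nrm t f

/-- Adjoint regularity for the functional `G ∈ X'_{t'}` with constant `K`: for every `y ∈ U` the
solution `w(y) ∈ Y` of the adjoint problem `⟨w(y), A(y) v⟩ = G v` for all `v ∈ X` lies in `Y_{t'}`,
and `‖w(y)‖_{Y_{t'}} ≤ K ‖G‖_{X'_{t'}}`. -/
def AdjointRegularity (A₀ : X →L[ℝ] StrongDual ℝ Y) (A : ℕ → X →L[ℝ] StrongDual ℝ Y)
    (SY : SmoothnessScale Y) (SXd : SmoothnessScale (StrongDual ℝ X)) (t' : ℝ≥0) (K : ℝ)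
    (G : SXd.space t') : Prop :=
  ∀ y ∈ paramDomain, ∀ w : Y, (∀ v : X, affineOp A₀ A y v w = (G : StrongDual ℝ X) v) →
    ∃ hw : w ∈ SY.space t', SY.nrm t' ⟨w, hw⟩ ≤ K * SXd.nrm t' G

end Scales

section Points

variable (b : ℕ) [Fact b.Prime]

/-- `G_{b,m}`: the nonzero polynomials of degree less than `m` over the field with `b`
elements. -/
def genPolys (m : ℕ) : Set (ZMod b)[X] := {q | q ≠ 0 ∧ q.natDegree < m}

/-- The polynomial `n(x)` whose coefficients are the first `m` base-`b` digits of `n`. -/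
def digitPoly (m n : ℕ) : (ZMod b)[X] :=
  ∑ r ∈ Finset.range m, Polynomial.C ((n / b ^ r % b : ℕ) : ZMod b) * Polynomial.X ^ r

/-- The embedding of polynomials in `x` into the formal Laurent series `∑ t_ℓ x^{-ℓ}`, realised as
Laurent series in the variable `x⁻¹`: `x` is the monomial of exponent `-1`. -/
def toLaurent (g : (ZMod b)[X]) : LaurentSeries (ZMod b) :=
  Polynomial.aeval (HahnSeries.single (-1 : ℤ) (1 : ZMod b)) g

/-- `v_m (∑ t_ℓ x^{-ℓ}) = ∑_{1 ≤ ℓ ≤ m} t_ℓ b^{-ℓ}`. -/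
def laurentValue (m : ℕ) (L : LaurentSeries (ZMod b)) : ℝ :=
  ∑ l ∈ Finset.Icc 1 m, ((L.coeff (l : ℤ)).val : ℝ) / (b : ℝ) ^ l

/-- One coordinate `v_m (n(x) q(x) / P(x))` of the `n`-th point of the polynomial lattice rule with
modulus `P` of degree `m`. -/
def polyLatticeCoord (m : ℕ) (P q : (ZMod b)[X]) (n : ℕ) : ℝ :=
  laurentValue b m (toLaurent b (digitPoly b m n * q) / toLaurent b P)

/-- Digit interlacing of `x_0, …, x_{α-1} ∈ [0, 1)`: the digits of order `1` of all the numbers,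
then those of order `2`, and so on.  `Real.digits x b a` is the digit of `x` at `b^{-(a+1)}`. -/
def interlace (α : ℕ) (x : Fin α → ℝ) : ℝ :=
  ∑' a : ℕ, ∑ j : Fin α, ((Real.digits (x j) b a : ℕ) : ℝ) / (b : ℝ) ^ ((j : ℕ) + 1 + a * α)

/-- The `n`-th point of the interlaced polynomial lattice rule of order `α` in `s` dimensions; the
generating vector of length `α s` is given in blocks `q j 0, …, q j (α - 1)`, one for each
dimension `j`. -/
def interlacedPoint (α m s : ℕ) (P : (ZMod b)[X]) (q : Fin s → Fin α → (ZMod b)[X]) (n : ℕ) :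
    Fin s → ℝ :=
  fun j => interlace b α fun k => polyLatticeCoord b m P (q j k) n

/-- The equal-weight quadrature rule with the `b ^ m` points of an interlaced polynomial lattice
rule, shifted from `[0,1]^s` to `[-1/2,1/2]^s`; the integrand sees the parameters beyond the first
`s` as zero. -/
def qmcRule (α m s : ℕ) (P : (ZMod b)[X]) (q : Fin s → Fin α → (ZMod b)[X])
    (F : (ℕ → ℝ) → ℝ) : ℝ :=
  (1 / (b : ℝ) ^ m) * ∑ n ∈ Finset.range (b ^ m),
    F (extendZero fun j => interlacedPoint b α m s P q n j - 1 / 2)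

end Points

/-- The interlacing order `α = ⌊1/p⌋ + 1`. -/
def order (p : ℝ) : ℕ := ⌊1 / p⌋₊ + 1

/-- The rate `κ(s, N)`; with indices from `0`, the tail `∑_{j > s} β_j` is `∑_j β (s + j)`. -/
def rate (p : ℝ) (β : ℕ → ℝ) (s : ℕ) (N : ℝ) : ℝ :=
  if p < 1 then (s : ℝ) ^ (-2 * (1 / p - 1)) + N ^ (-(1 / p))
  else (∑' j, β (s + j)) ^ 2 + N⁻¹

end QMCPetrovGalerkin

end

/-! Write A(y) = A₀(1 + T(y)) with T(y) = ∑ y_j B_j and B_j = A₀⁻¹A_j. On U one has ‖T(y)‖ ≤ κ/2 <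
1, so u(y) = (1 + T(y))⁻¹A₀⁻¹f is a Neumann series. The error splits into dimension truncation of
the exact solution, quadrature of the truncated exact solution, and the Galerkin error at the
quadrature nodes. The rule therefore only meets the B_j and can be fixed before h, f and G.

Truncation (`abs_integral_sub_integral_truncParam_le`): reflecting the parameters beyond s preserves
dy, so the first-order term in the tail cancels and the square of ∑_{j>s} β_j remains; Stechkin's
estimate turns it into a power of s. Galerkin (`exists_galerkin_bound`): Aubin-Nitsche duality,
uniformly in y.

Quadrature (`exists_interlaced_rule`) works without derivatives in y. The integral is replaced by a
midpoint rule with b^(mα) cells per direction; its error O(b^(-mα)) does not depend on s and is at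
most a multiple of N^(-1/p), because α > 1/p. At the midpoints T is affine in finitely many base-b
digits. In the Fourier coefficient at k of such a resolvent, only those words of the Neumann series
survive that contain every letter at which k is nonzero (`norm_sum_prod_mul_pow_le`). This bounds
the coefficients by product weights whose p-th powers are summable uniformly in s and m
(`exists_sum_dualWeight_rpow_le`). Each nonzero k lies in the dual of at most a fraction 2/N of the
generating vectors, so averaging the p-th powers and embedding ℓ^p into ℓ^1 yields N^(-1/p)
(`exists_sum_dual_le`). -/

namespace QMCPetrovGalerkin

/-! ### Inf-sup theory: invertibility, Galerkin stability, duality. -/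

section InfSup

variable {X Y : Type*} [NormedAddCommGroup X] [NormedSpace ℝ X]
  [NormedAddCommGroup Y] [NormedSpace ℝ Y]
  {B : X →L[ℝ] StrongDual ℝ Y} {V : Submodule ℝ X} {W : Submodule ℝ Y} {μ : ℝ}

/-- The sign of `c` matters: `Real.iSup_le` needs a nonnegative bound, which covers a trivial `W`,
where the supremum over an empty type is 0. -/
theorem InfSup.mul_norm_le (hB : InfSup B V W μ) {v : X} (hv : v ∈ V) {c : ℝ} (hc : 0 ≤ c)
    (h : ∀ w ∈ W, B v w ≤ c * ‖w‖) : μ * ‖v‖ ≤ c := by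
  rcases eq_or_ne v 0 with rfl | hv0
  · simpa using hc
  have hvn : 0 < ‖v‖ := norm_pos_iff.2 hv0
  rw [← le_div_iff₀ hvn]
  refine (hB.1 v hv hv0).trans (Real.iSup_le (fun w => ?_) (by positivity))
  have hw : 0 < ‖(w : Y)‖ := norm_pos_iff.2 w.2.2
  rw [div_le_div_iff₀ (by positivity) hvn]
  nlinarith [h w w.2.1]

theorem InfSup.eq_zero_of_forall (hB : InfSup B V W μ) (hμ : 0 < μ) {w : Y} (hw : w ∈ W)
    (h : ∀ v ∈ V, B v w = 0) : w = 0 := by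
  by_contra hw0
  refine absurd (hB.2 w hw hw0) (not_le.2 (lt_of_le_of_lt (Real.iSup_le (fun v => ?_) le_rfl) hμ))
  rw [h v v.2.1, zero_div]

/-- The first condition bounds `B` from below, so its range is closed. A functional vanishing on the
range is evaluation at some `w`, by reflexivity, and the second condition forces `w = 0`. -/
theorem InfSup.isInvertible [CompleteSpace X] (hY : IsReflexive Y) (hμ : 0 < μ)
    (hB : InfSup B ⊤ ⊤ μ) : B.IsInvertible := by
  have hbound : ∀ v, μ * ‖v‖ ≤ ‖B v‖ := fun v =>
    hB.mul_norm_le (by trivial) (norm_nonneg _)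
      fun w _ => (le_abs_self _).trans ((B v).le_opNorm w)
  have hanti : AntilipschitzWith (Real.toNNReal μ⁻¹) B := by
    refine B.antilipschitz_of_bound fun v => ?_
    rw [Real.coe_toNNReal _ (by positivity), inv_mul_eq_div, le_div_iff₀ hμ, mul_comm]
    exact hbound v
  have hclosed : IsClosed (LinearMap.range (B : X →ₗ[ℝ] StrongDual ℝ Y) : Set (StrongDual ℝ Y)) :=
    hanti.isClosed_range B.uniformContinuous
  have hrange : LinearMap.range (B : X →ₗ[ℝ] StrongDual ℝ Y) = ⊤ := by
    by_contra hne
    obtain ⟨φ, hφ⟩ : ∃ φ, φ ∉ LinearMap.range (B : X →ₗ[ℝ] StrongDual ℝ Y) := by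
      by_contra! hall
      exact hne (eq_top_iff.2 fun x _ => hall x)
    obtain ⟨g, u, hg, hu⟩ := geometric_hahn_banach_closed_point
      (LinearMap.range (B : X →ₗ[ℝ] StrongDual ℝ Y)).convex hclosed hφ
    -- A functional bounded above on a subspace vanishes there: otherwise scaling `v` makes it
    -- attain the strict bound `u`.
    have hzero : ∀ v, g (B v) = 0 := by
      intro v
      by_contra hgv
      have h1 := hg (B ((u / g (B v)) • v)) ⟨_, rfl⟩
      rw [map_smul, map_smul, smul_eq_mul, div_mul_cancel₀ _ hgv] at h1
      exact lt_irrefl _ h1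
    obtain ⟨w, rfl⟩ := hY g
    have hw : w = 0 := hB.eq_zero_of_forall hμ (by trivial) fun v _ => by
      simpa using hzero v
    have h0 := hg 0 (Submodule.zero_mem _)
    subst hw
    simp at h0 hu
    linarith
  refine ⟨ContinuousLinearEquiv.ofBijective B (LinearMap.ker_eq_bot.2 hanti.injective) hrange, ?_⟩
  ext; simp

/-- Uniform stability of the Petrov-Galerkin problem. -/
theorem InfSup.existsUnique [FiniteDimensional ℝ V] [FiniteDimensional ℝ W] (hμ : 0 < μ)
    (hB : InfSup B V W μ) (f : StrongDual ℝ Y) : ∃! u : X, IsPGSolution B V W f u := by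
  let Φ : V →ₗ[ℝ] Module.Dual ℝ W :=
    LinearMap.mk₂ ℝ (fun (v : V) (w : W) => B v w) (by intros; simp) (by intros; simp)
      (by intros; simp) (by intros; simp)
  have hΦ : Function.Injective Φ := by
    refine (injective_iff_map_eq_zero Φ).2 fun v hv => ?_
    have h0 : μ * ‖(v : X)‖ ≤ 0 := hB.mul_norm_le v.2 le_rfl fun w hw => by
      have : Φ v ⟨w, hw⟩ = 0 := by rw [hv]; rfl
      have h' : B v w = 0 := this
      simp [h']
    have : ‖(v : X)‖ ≤ 0 := by
      by_contra! h
      nlinarith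
    exact Subtype.ext (norm_le_zero_iff.1 this)
  have hΨ : Function.Injective Φ.flip := by
    refine (injective_iff_map_eq_zero Φ.flip).2 fun w hw => ?_
    refine Subtype.ext (hB.eq_zero_of_forall hμ w.2 fun v hv => ?_)
    have : Φ.flip w ⟨v, hv⟩ = 0 := by rw [hw]; rfl
    exact this
  -- Injectivity of `Φ` and of its transpose gives dim V ≤ dim W and dim W ≤ dim V, so the injective
  -- `Φ` is onto.
  have hdim : Module.finrank ℝ V = Module.finrank ℝ (Module.Dual ℝ W) := by
    have h1 := LinearMap.finrank_le_finrank_of_injective hΦ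
    have h2 := LinearMap.finrank_le_finrank_of_injective hΨ
    rw [Subspace.dual_finrank_eq] at *
    exact le_antisymm h1 h2
  obtain ⟨u, hu⟩ := (LinearMap.injective_iff_surjective_of_finrank_eq_finrank hdim).1 hΦ
    ((f : Y →ₗ[ℝ] ℝ).comp W.subtype)
  refine ⟨u, ⟨u.2, fun w hw => ?_⟩, fun u' hu' => ?_⟩
  · exact LinearMap.congr_fun hu ⟨w, hw⟩
  · have : (⟨u', hu'.1⟩ : V) = u := hΦ (by
      ext w
      exact (hu'.2 w w.2).trans (LinearMap.congr_fun hu w).symm)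
    exact congrArg Subtype.val this

/-- Quasi-optimality of Petrov-Galerkin solutions. -/
theorem InfSup.norm_sub_le (hμ : 0 < μ) (hB : InfSup B V W μ) {f : StrongDual ℝ Y} {u uh v : X}
    (hu : B u = f) (huh : IsPGSolution B V W f uh) (hv : v ∈ V) :
    ‖u - uh‖ ≤ (1 + ‖B‖ / μ) * ‖u - v‖ := by
  have h1 : μ * ‖uh - v‖ ≤ ‖B‖ * ‖u - v‖ := by
    refine hB.mul_norm_le (V.sub_mem huh.1 hv) (by positivity) fun w hw => ?_
    have : B (uh - v) w = B (u - v) w := by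
      simp only [map_sub, _root_.sub_apply, huh.2 w hw, hu]
    rw [this]
    exact (le_abs_self _).trans (((B (u - v)).le_opNorm w).trans (by
      gcongr; exact B.le_opNorm _))
  have h2 : ‖uh - v‖ ≤ ‖B‖ / μ * ‖u - v‖ := by
    rw [div_mul_eq_mul_div, le_div_iff₀ hμ, mul_comm]; exact h1
  calc ‖u - uh‖ = ‖(u - v) - (uh - v)‖ := by congr 1; abel
    _ ≤ ‖u - v‖ + ‖uh - v‖ := _root_.norm_sub_le _ _
    _ ≤ _ := by linarith

/-- The Aubin-Nitsche estimate for a functional of the error. -/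
theorem InfSup.abs_functional_sub_le (hμ : 0 < μ) (hB : InfSup B V W μ) {f : StrongDual ℝ Y}
    {G : StrongDual ℝ X} {u uh v : X} {w wh : Y}
    (hu : B u = f) (huh : IsPGSolution B V W f uh) (hw : ∀ x, B x w = G x) (hv : v ∈ V)
    (hwh : wh ∈ W) :
    |G u - G uh| ≤ ‖B‖ * (1 + ‖B‖ / μ) * ‖u - v‖ * ‖w - wh‖ := by
  -- Galerkin orthogonality: the error pairs to zero with `wh`, which may thus be subtracted from
  -- the adjoint solution.
  have h1 : G u - G uh = B (u - uh) (w - wh) := by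
    have : B (u - uh) wh = 0 := by
      simp only [map_sub, _root_.sub_apply, huh.2 wh hwh, hu, sub_self]
    rw [map_sub (B (u - uh)), this, sub_zero, hw, map_sub]
  rw [h1]
  calc |B (u - uh) (w - wh)| ≤ ‖B (u - uh)‖ * ‖w - wh‖ := (B (u - uh)).le_opNorm _
    _ ≤ ‖B‖ * ‖u - uh‖ * ‖w - wh‖ := by gcongr; exact B.le_opNorm _
    _ ≤ ‖B‖ * ((1 + ‖B‖ / μ) * ‖u - v‖) * ‖w - wh‖ := by
        gcongr; exact hB.norm_sub_le hμ hu huh hv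
    _ = _ := by ring

/-- The functional G ∘ B⁻¹ on Y' lies in the bidual of Y, and reflexivity turns it into a vector. -/
theorem exists_adjoint_solution (hY : IsReflexive Y) (hB : B.IsInvertible) (G : StrongDual ℝ X) :
    ∃ w : Y, ∀ v, B v w = G v := by
  obtain ⟨w, hw⟩ := hY (G.comp B.inverse)
  refine ⟨w, fun v => ?_⟩
  have := congrArg (fun Φ : StrongDual ℝ (StrongDual ℝ Y) => Φ (B v)) hw
  simpa [hB.inverse_apply_self v] using this

end InfSup

/-- The approximation property bounds infima, which need not be attained; trial and test functions
vary independently, so the product bound passes to both infima. -/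
theorem exists_mul_mul_le_of_iInf_le {ι κ : Type*} [Nonempty ι] [Nonempty κ] {f : ι → ℝ}
    {g : κ → ℝ} (hf : ∀ i, 0 ≤ f i) (hg : ∀ i, 0 ≤ g i) {a b c e : ℝ} (hc : 0 ≤ c)
    (h : ∀ i j, e ≤ c * f i * g j) (ha : ⨅ i, f i ≤ a) (hb : ⨅ j, g j ≤ b) :
    e ≤ c * a * b := by
  have key : e ≤ c * (⨅ i, f i) * (⨅ j, g j) := by
    rw [Real.mul_iInf_of_nonneg hc, Real.iInf_mul_of_nonneg (Real.iInf_nonneg hg)]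
    refine le_ciInf fun i => ?_
    rw [Real.mul_iInf_of_nonneg (mul_nonneg hc (hf i))]
    exact le_ciInf fun j => h i j
  refine key.trans ?_
  have hf0 := Real.iInf_nonneg hf
  have hg0 := Real.iInf_nonneg hg
  have ha0 := hf0.trans ha
  gcongr

/-! ### The resolvent of the preconditioned fluctuation. -/

section Resolvent

variable {X : Type*} [NormedAddCommGroup X] [NormedSpace ℝ X]

/-- The fluctuation `T(y) = ∑ j, y_j B_j`. -/
noncomputable def fluctuation (B : ℕ → X →L[ℝ] X) (y : ℕ → ℝ) : X →L[ℝ] X := ∑' j, y j • B j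

/-- The resolvent `(1 + T(y))⁻¹`. -/
noncomputable def resolvent (B : ℕ → X →L[ℝ] X) (y : ℕ → ℝ) : X →L[ℝ] X :=
  Ring.inverse (1 + fluctuation B y)

theorem abs_le_half {y : ℕ → ℝ} (hy : y ∈ paramDomain) (j : ℕ) : |y j| ≤ 1 / 2 :=
  abs_le.2 ⟨by linarith [(hy j).1], (hy j).2⟩

/-- The majorant `x` is left free for three uses: the constant 1/2 on U, a constant ε for Lipschitz
bounds, and 1/2 beyond index `s` for tails. -/
theorem norm_fluctuation_le {B : ℕ → X →L[ℝ] X} {y x : ℕ → ℝ}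
    (hx : Summable fun j => x j * ‖B j‖) (h : ∀ j, |y j| ≤ x j) :
    ‖fluctuation B y‖ ≤ ∑' j, x j * ‖B j‖ :=
  tsum_of_norm_bounded hx.hasSum fun j => by
    rw [norm_smul, Real.norm_eq_abs]; gcongr; exact h j

theorem norm_fluctuation_le_half {B : ℕ → X →L[ℝ] X} (hB : Summable fun j => ‖B j‖) {y : ℕ → ℝ}
    (hy : y ∈ paramDomain) : ‖fluctuation B y‖ ≤ (∑' j, ‖B j‖) / 2 := by
  refine (norm_fluctuation_le (hB.mul_left (1 / 2)) (abs_le_half hy)).trans ?_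
  rw [tsum_mul_left]
  linarith

variable [CompleteSpace X]

theorem isUnit_one_add {T : X →L[ℝ] X} (hT : ‖T‖ < 1) : IsUnit (1 + T) := by
  have h := isUnit_one_sub_of_norm_lt_one (x := -T) (by rwa [norm_neg])
  rwa [sub_neg_eq_add] at h

theorem norm_inverse_one_add_le {T : X →L[ℝ] X} {ρ : ℝ} (hT : ‖T‖ ≤ ρ) (hρ : ρ < 1) :
    ‖Ring.inverse (1 + T)‖ ≤ (1 - ρ)⁻¹ := by
  have hu := isUnit_one_add (hT.trans_lt hρ)
  have h1ρ : 0 < 1 - ρ := by linarith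
  refine ContinuousLinearMap.opNorm_le_bound _ (by positivity) fun x => ?_
  have h1 : (1 + T) (Ring.inverse (1 + T) x) = x := by
    exact congrArg (fun S : X →L[ℝ] X => S x) (Ring.mul_inverse_cancel _ hu)
  set z := Ring.inverse (1 + T) x
  have h2 : z = x - T z := by
    rw [eq_sub_iff_add_eq, ← h1]; rfl
  have h3 : ‖z‖ ≤ ‖x‖ + ρ * ‖z‖ :=
    calc ‖z‖ = ‖x - T z‖ := by rw [← h2]
      _ ≤ ‖x‖ + ‖T z‖ := norm_sub_le _ _
      _ ≤ _ := by gcongr; exact T.le_of_opNorm_le hT z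
  rw [inv_mul_eq_div, le_div_iff₀ h1ρ]
  linarith

theorem norm_inverse_sub_inverse_le {T T' : X →L[ℝ] X} {ρ : ℝ} (hT : ‖T‖ ≤ ρ) (hT' : ‖T'‖ ≤ ρ)
    (hρ : ρ < 1) :
    ‖Ring.inverse (1 + T) - Ring.inverse (1 + T')‖ ≤ ((1 - ρ)⁻¹) ^ 2 * ‖T - T'‖ := by
  have hu := isUnit_one_add (hT.trans_lt hρ)
  have hu' := isUnit_one_add (hT'.trans_lt hρ)
  have h1ρ : 0 < 1 - ρ := by linarith
  have key : Ring.inverse (1 + T) - Ring.inverse (1 + T') =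
      Ring.inverse (1 + T) * (T' - T) * Ring.inverse (1 + T') := by
    have : T' - T = (1 + T') - (1 + T) := by abel
    rw [this, mul_sub, sub_mul, Ring.inverse_mul_cancel _ hu, mul_assoc,
      Ring.mul_inverse_cancel _ hu', mul_one, one_mul]
  rw [key]
  calc _ ≤ ‖Ring.inverse (1 + T)‖ * ‖T' - T‖ * ‖Ring.inverse (1 + T')‖ :=
        (norm_mul_le _ _).trans (by gcongr; exact norm_mul_le _ _)
    _ ≤ (1 - ρ)⁻¹ * ‖T' - T‖ * (1 - ρ)⁻¹ := by
        gcongr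
        · exact norm_inverse_one_add_le hT hρ
        · exact norm_inverse_one_add_le hT' hρ
    _ = _ := by rw [norm_sub_rev]; ring

/-- The symmetric second difference of the resolvent is of second order. -/
theorem norm_second_difference_le {T S : X →L[ℝ] X} {ρ : ℝ} (hT : ‖T‖ ≤ ρ)
    (hp : ‖T + S‖ ≤ ρ) (hm : ‖T - S‖ ≤ ρ) (hρ : ρ < 1) :
    ‖Ring.inverse (1 + (T + S)) + Ring.inverse (1 + (T - S)) - (2 : ℝ) • Ring.inverse (1 + T)‖ ≤
      2 * ((1 - ρ)⁻¹) ^ 3 * ‖S‖ ^ 2 := by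
  have hu := isUnit_one_add (hT.trans_lt hρ)
  have hup := isUnit_one_add (hp.trans_lt hρ)
  have hum := isUnit_one_add (hm.trans_lt hρ)
  have h1ρ : 0 < 1 - ρ := by linarith
  have hR := norm_inverse_one_add_le hT hρ
  have hRp := norm_inverse_one_add_le hp hρ
  have hRm := norm_inverse_one_add_le hm hρ
  set R := Ring.inverse (1 + T) with hRdef
  set P := Ring.inverse (1 + (T + S)) with hPdef
  set M := Ring.inverse (1 + (T - S)) with hMdef
  have e0 : R * (1 + T) = 1 := Ring.inverse_mul_cancel _ hu
  have e1 : (1 + (T + S)) * P = 1 := Ring.mul_inverse_cancel _ hup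
  have e2 : (1 + (T - S)) * M = 1 := Ring.mul_inverse_cancel _ hum
  have hP : P = R - R * S * P := by
    have : R * ((1 + (T + S)) * P) = (R * (1 + T)) * P + R * S * P := by noncomm_ring
    rw [e0, e1, mul_one, one_mul] at this
    exact eq_sub_of_add_eq this.symm
  have hM : M = R + R * S * M := by
    have : R * ((1 + (T - S)) * M) = (R * (1 + T)) * M - R * S * M := by noncomm_ring
    rw [e0, e2, mul_one, one_mul] at this
    exact (sub_eq_iff_eq_add.1 this.symm)
  -- The resolvent identity is used twice: P = R - RSP and M = R + RSM cancel the first-order terms,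
  -- and M - P again carries a factor S.
  have key : P + M - (2 : ℝ) • R = R * S * (R * S * (P + M)) := by
    have h1 : P + M - (2 : ℝ) • R = R * S * (M - P) := by
      rw [two_smul]
      nth_rewrite 1 [hP]
      nth_rewrite 1 [hM]
      noncomm_ring
    have h2 : M - P = R * S * (P + M) := by
      nth_rewrite 1 [hP]
      nth_rewrite 1 [hM]
      noncomm_ring
    rw [h1, h2]
  rw [key]
  calc _ ≤ ‖R‖ * ‖S‖ * (‖R‖ * ‖S‖ * (‖P‖ + ‖M‖)) := by
        refine (norm_mul_le _ _).trans ?_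
        gcongr
        · exact norm_mul_le _ _
        · refine (norm_mul_le _ _).trans ?_
          gcongr
          · exact norm_mul_le _ _
          · exact norm_add_le _ _
    _ ≤ (1 - ρ)⁻¹ * ‖S‖ * ((1 - ρ)⁻¹ * ‖S‖ * ((1 - ρ)⁻¹ + (1 - ρ)⁻¹)) := by gcongr
    _ = _ := by ring

variable {B : ℕ → X →L[ℝ] X}

theorem summable_smul (hB : Summable fun j => ‖B j‖) {y : ℕ → ℝ} {M : ℝ} (hy : ∀ j, |y j| ≤ M) :
    Summable fun j => y j • B j :=
  Summable.of_norm_bounded (hB.mul_left M) fun j => by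
    rw [norm_smul, Real.norm_eq_abs]; gcongr; exact hy j

theorem fluctuation_add (hB : Summable fun j => ‖B j‖) {y z : ℕ → ℝ} {M : ℝ}
    (hy : ∀ j, |y j| ≤ M) (hz : ∀ j, |z j| ≤ M) :
    fluctuation B (y + z) = fluctuation B y + fluctuation B z := by
  unfold fluctuation
  rw [← (summable_smul hB hy).tsum_add (summable_smul hB hz)]
  simp [add_smul]

theorem fluctuation_sub (hB : Summable fun j => ‖B j‖) {y z : ℕ → ℝ} {M : ℝ}
    (hy : ∀ j, |y j| ≤ M) (hz : ∀ j, |z j| ≤ M) :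
    fluctuation B (y - z) = fluctuation B y - fluctuation B z := by
  unfold fluctuation
  rw [← (summable_smul hB hy).tsum_sub (summable_smul hB hz)]
  simp [sub_smul]

variable {ρ : ℝ}

theorem norm_resolvent_le (hB : Summable fun j => ‖B j‖) (hρ : (∑' j, ‖B j‖) / 2 ≤ ρ)
    (hρ1 : ρ < 1) {y : ℕ → ℝ} (hy : y ∈ paramDomain) : ‖resolvent B y‖ ≤ (1 - ρ)⁻¹ :=
  norm_inverse_one_add_le ((norm_fluctuation_le_half hB hy).trans hρ) hρ1

theorem abs_functional_le (hB : Summable fun j => ‖B j‖) (hρ : (∑' j, ‖B j‖) / 2 ≤ ρ)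
    (hρ1 : ρ < 1) (G : StrongDual ℝ X) (v : X) {y : ℕ → ℝ} (hy : y ∈ paramDomain) :
    ‖G (resolvent B y v)‖ ≤ ‖G‖ * ((1 - ρ)⁻¹ * ‖v‖) :=
  G.le_opNorm_of_le ((resolvent B y).le_of_opNorm_le (norm_resolvent_le hB hρ hρ1 hy) v)

theorem abs_functional_sub_le (hB : Summable fun j => ‖B j‖) (hρ : (∑' j, ‖B j‖) / 2 ≤ ρ)
    (hρ1 : ρ < 1) (G : StrongDual ℝ X) (v : X) {y z : ℕ → ℝ} (hy : y ∈ paramDomain)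
    (hz : z ∈ paramDomain) {ε : ℝ} (h : ∀ j, |y j - z j| ≤ ε) :
    |G (resolvent B y v) - G (resolvent B z v)| ≤
      ‖G‖ * ‖v‖ * (((1 - ρ)⁻¹) ^ 2 * (2 * ρ * ε)) := by
  have hε : 0 ≤ ε := (abs_nonneg _).trans (h 0)
  have h1 : ‖resolvent B y - resolvent B z‖ ≤ ((1 - ρ)⁻¹) ^ 2 * (2 * ρ * ε) := by
    refine (norm_inverse_sub_inverse_le ((norm_fluctuation_le_half hB hy).trans hρ)
      ((norm_fluctuation_le_half hB hz).trans hρ) hρ1).trans ?_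
    gcongr
    rw [← fluctuation_sub hB (abs_le_half hy) (abs_le_half hz)]
    refine (norm_fluctuation_le (hB.mul_left ε) h).trans ?_
    rw [tsum_mul_left]
    nlinarith
  rw [← map_sub, ← _root_.sub_apply]
  refine (G.le_opNorm_of_le ((resolvent B y - resolvent B z).le_of_opNorm_le h1 v)).trans (le_of_eq ?_)
  ring

/-- The coordinatewise projection onto the parameter domain. -/
noncomputable def clampParam (y : ℕ → ℝ) (j : ℕ) : ℝ := max (-1 / 2) (min (1 / 2) (y j))

theorem clampParam_mem (y : ℕ → ℝ) : clampParam y ∈ paramDomain := fun j =>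
  ⟨le_max_left _ _, max_le (by norm_num) (min_le_left _ _)⟩

theorem clampParam_eq {y : ℕ → ℝ} (hy : y ∈ paramDomain) : clampParam y = y := by
  ext j
  rw [clampParam, min_eq_right (hy j).2, max_eq_right (hy j).1]

/-- Off U the operator 1 + T(y) may fail to be invertible. After clamping, the resolvent is
continuous on all sequences, which supplies the measurability, and nothing changes on U, a set of
full measure. -/
theorem continuous_resolvent_clampParam (hB : Summable fun j => ‖B j‖)
    (hρ : (∑' j, ‖B j‖) / 2 ≤ ρ) (hρ1 : ρ < 1) :
    Continuous fun y => resolvent B (clampParam y) := by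
  have h1 : Continuous fun y => fluctuation B (clampParam y) := by
    refine continuous_tsum (u := fun j => 1 / 2 * ‖B j‖) (fun j => ?_) (hB.mul_left _) fun j y => ?_
    · unfold clampParam
      fun_prop
    · rw [norm_smul, Real.norm_eq_abs]
      gcongr
      exact abs_le_half (clampParam_mem y) j
  refine continuous_iff_continuousAt.2 fun y => ?_
  obtain ⟨u, hu⟩ := isUnit_one_add
    (((norm_fluctuation_le_half hB (clampParam_mem y)).trans hρ).trans_lt hρ1)
  have h2 := NormedRing.inverse_continuousAt u
  rw [hu] at h2
  exact ContinuousAt.comp (f := fun y => 1 + fluctuation B (clampParam y)) h2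
    (continuous_const.add h1).continuousAt

/-! ### Integrability and dimension truncation. -/

theorem ae_mem_paramDomain : ∀ᵐ y ∂paramMeasure, y ∈ paramDomain := by
  refine ae_all_iff.2 fun j => ?_
  have h := (measurePreserving_eval_infinitePi (fun _ : ℕ => uniformMeasure) j).quasiMeasurePreserving
  exact h.ae (ae_restrict_mem measurableSet_Icc)

instance : IsProbabilityMeasure paramMeasure := by
  unfold paramMeasure; infer_instance

theorem integrable_functional_resolvent (hB : Summable fun j => ‖B j‖)
    (hρ : (∑' j, ‖B j‖) / 2 ≤ ρ) (hρ1 : ρ < 1) (G : StrongDual ℝ X) (v : X) :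
    Integrable (fun y => G (resolvent B y v)) paramMeasure := by
  have hcont : Continuous fun y => G (resolvent B (clampParam y) v) :=
    G.continuous.comp ((continuous_resolvent_clampParam hB hρ hρ1).clm_apply continuous_const)
  have hint : Integrable (fun y => G (resolvent B (clampParam y) v)) paramMeasure :=
    Integrable.of_bound hcont.measurable.aestronglyMeasurable _ (ae_of_all _ fun y =>
      abs_functional_le hB hρ hρ1 G v (clampParam_mem y))
  refine hint.congr ?_
  filter_upwards [ae_mem_paramDomain] with y hy
  rw [clampParam_eq hy]

/-- The sign change of the parameters beyond the first `s`. -/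
noncomputable def flipTail (s : ℕ) (y : ℕ → ℝ) (j : ℕ) : ℝ := if j < s then y j else -y j

/-- The truncation of a parameter sequence to its first `s` components. -/
noncomputable def truncParam (s : ℕ) (y : ℕ → ℝ) (j : ℕ) : ℝ := if j < s then y j else 0

theorem uniformMeasure_map_neg : uniformMeasure.map (fun x => -x) = uniformMeasure := by
  have h := (Measure.measurePreserving_neg (volume : Measure ℝ)).restrict_preimage
    (s := Icc (-1 / 2 : ℝ) (1 / 2)) measurableSet_Icc
  have hs : (Neg.neg ⁻¹' Icc (-1 / 2 : ℝ) (1 / 2)) = Icc (-1 / 2 : ℝ) (1 / 2) := by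
    ext x
    simp only [mem_preimage, mem_Icc]
    constructor <;> rintro ⟨h1, h2⟩ <;> constructor <;> linarith
  rw [hs] at h
  exact h.map_eq

theorem measurePreserving_flipTail (s : ℕ) :
    MeasurePreserving (flipTail s) paramMeasure paramMeasure := by
  have hf : flipTail s = fun (y : ℕ → ℝ) j => (if j < s then id else fun x => -x) (y j) := by
    ext y j
    unfold flipTail
    split_ifs <;> rfl
  have hm : ∀ j : ℕ, Measurable (if j < s then id else fun x : ℝ => -x) := fun j => by
    split_ifs
    · exact measurable_id
    · exact measurable_neg
  refine ⟨?_, ?_⟩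
  · rw [hf]
    exact measurable_pi_lambda _ fun j => (hm j).comp (measurable_pi_apply j)
  · rw [hf, paramMeasure, Measure.infinitePi_map_pi _ hm]
    congr 1
    ext1 j
    split_ifs
    · exact Measure.map_id
    · exact uniformMeasure_map_neg

theorem flipTail_mem (s : ℕ) {y : ℕ → ℝ} (hy : y ∈ paramDomain) : flipTail s y ∈ paramDomain := by
  intro j
  unfold flipTail
  split_ifs
  · exact hy j
  · exact ⟨by linarith [(hy j).2], by linarith [(hy j).1]⟩

theorem truncParam_mem (s : ℕ) {y : ℕ → ℝ} (hy : y ∈ paramDomain) :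
    truncParam s y ∈ paramDomain := by
  intro j
  unfold truncParam
  split_ifs
  · exact hy j
  · norm_num

/-- The truncated parameter is the midpoint of `y` and its reflection, so the second difference of
the resolvent applies with increment the tail fluctuation, whose norm is at most half the tail sum.
-/
theorem abs_second_difference_functional_le (hB : Summable fun j => ‖B j‖)
    (hρ : (∑' j, ‖B j‖) / 2 ≤ ρ) (hρ1 : ρ < 1) (G : StrongDual ℝ X) (v : X) (s : ℕ) {y : ℕ → ℝ}
    (hy : y ∈ paramDomain) :
    |G (resolvent B y v) + G (resolvent B (flipTail s y) v) -
      2 * G (resolvent B (truncParam s y) v)| ≤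
      ‖G‖ * ‖v‖ * (((1 - ρ)⁻¹) ^ 3 * (∑' j, ‖B (s + j)‖) ^ 2) := by
  have h1ρ : 0 < 1 - ρ := by linarith
  set z : ℕ → ℝ := fun j => if j < s then 0 else y j with hz
  have hzb : ∀ j, |z j| ≤ 1 / 2 := fun j => by
    simp only [hz]
    split_ifs
    · norm_num
    · exact abs_le_half hy j
  have htm := truncParam_mem s hy
  have e1 : y = truncParam s y + z := by
    ext j; simp only [hz, truncParam, Pi.add_apply]; split_ifs <;> simp
  have e2 : flipTail s y = truncParam s y - z := by
    ext j; simp only [hz, truncParam, flipTail, Pi.sub_apply]; split_ifs <;> simp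
  have t1 : fluctuation B y = fluctuation B (truncParam s y) + fluctuation B z := by
    rw [← fluctuation_add hB (abs_le_half htm) hzb, ← e1]
  have t2 : fluctuation B (flipTail s y) = fluctuation B (truncParam s y) - fluctuation B z := by
    rw [← fluctuation_sub hB (abs_le_half htm) hzb, ← e2]
  have hS : ‖fluctuation B z‖ ≤ (∑' j, ‖B (s + j)‖) / 2 := by
    have hsum : Summable fun j => (if j < s then (0 : ℝ) else 1 / 2) * ‖B j‖ :=
      Summable.of_nonneg_of_le (fun j => by split_ifs <;> positivity) (fun j => by
        split_ifs
        · simp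
        · exact mul_le_of_le_one_left (norm_nonneg _) (by norm_num)) hB
    refine (norm_fluctuation_le (x := fun j => if j < s then 0 else 1 / 2) hsum
      (fun j => ?_)).trans (le_of_eq ?_)
    · simp only [hz]
      split_ifs
      · simp
      · exact abs_le_half hy j
    · rw [← hsum.sum_add_tsum_nat_add s, Finset.sum_eq_zero, zero_add, ← tsum_div_const]
      · refine tsum_congr fun j => ?_
        rw [if_neg (by omega), add_comm j s]
        ring
      · intro j hj
        rw [if_pos (Finset.mem_range.1 hj), zero_mul]
  have hn1 := (norm_fluctuation_le_half hB hy).trans hρ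
  have hn2 := (norm_fluctuation_le_half hB (flipTail_mem s hy)).trans hρ
  have hn0 := (norm_fluctuation_le_half hB htm).trans hρ
  have key : ‖resolvent B y + resolvent B (flipTail s y) - (2 : ℝ) • resolvent B (truncParam s y)‖
      ≤ ((1 - ρ)⁻¹) ^ 3 * (∑' j, ‖B (s + j)‖) ^ 2 := by
    unfold resolvent
    rw [t1] at hn1 ⊢
    rw [t2] at hn2 ⊢
    refine (norm_second_difference_le hn0 hn1 hn2 hρ1).trans ?_
    calc 2 * ((1 - ρ)⁻¹) ^ 3 * ‖fluctuation B z‖ ^ 2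
        ≤ 2 * ((1 - ρ)⁻¹) ^ 3 * ((∑' j, ‖B (s + j)‖) / 2) ^ 2 := by gcongr
      _ = ((1 - ρ)⁻¹) ^ 3 * (∑' j, ‖B (s + j)‖) ^ 2 / 2 := by ring
      _ ≤ _ := half_le_self (by positivity)
  have e3 : G (resolvent B y v) + G (resolvent B (flipTail s y) v) -
      2 * G (resolvent B (truncParam s y) v) =
      G ((resolvent B y + resolvent B (flipTail s y) - (2 : ℝ) • resolvent B (truncParam s y)) v) := by
    simp
  rw [e3]
  refine (G.le_opNorm_of_le (ContinuousLinearMap.le_of_opNorm_le _ key v)).trans (le_of_eq ?_)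
  ring

theorem measurable_truncParam (s : ℕ) : Measurable (truncParam s) := by
  refine measurable_pi_lambda _ fun j => ?_
  unfold truncParam
  split_ifs
  · exact measurable_pi_apply j
  · exact measurable_const

theorem integrable_functional_resolvent_truncParam (hB : Summable fun j => ‖B j‖)
    (hρ : (∑' j, ‖B j‖) / 2 ≤ ρ) (hρ1 : ρ < 1) (G : StrongDual ℝ X) (v : X) (s : ℕ) :
    Integrable (fun y => G (resolvent B (truncParam s y) v)) paramMeasure := by
  have hcont : Continuous fun y => G (resolvent B (clampParam y) v) :=
    G.continuous.comp ((continuous_resolvent_clampParam hB hρ hρ1).clm_apply continuous_const)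
  have hint : Integrable (fun y => G (resolvent B (clampParam (truncParam s y)) v)) paramMeasure :=
    Integrable.of_bound (hcont.measurable.comp (measurable_truncParam s)).aestronglyMeasurable _
      (ae_of_all _ fun y => abs_functional_le hB hρ hρ1 G v (clampParam_mem _))
  refine hint.congr ?_
  filter_upwards [ae_mem_paramDomain] with y hy
  rw [clampParam_eq (truncParam_mem s hy)]

/-- The dimension truncation error is of second order in the tail of the fluctuations. -/
theorem abs_integral_sub_integral_truncParam_le (hB : Summable fun j => ‖B j‖)
    (hρ : (∑' j, ‖B j‖) / 2 ≤ ρ) (hρ1 : ρ < 1) (G : StrongDual ℝ X) (v : X) (s : ℕ) :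
    |∫ y, G (resolvent B y v) ∂paramMeasure -
      ∫ y, G (resolvent B (truncParam s y) v) ∂paramMeasure| ≤
      ‖G‖ * ‖v‖ * (((1 - ρ)⁻¹) ^ 3 * (∑' j, ‖B (s + j)‖) ^ 2) := by
  have h1ρ : 0 < 1 - ρ := by linarith
  have hint := integrable_functional_resolvent hB hρ hρ1 G v
  have hint' := integrable_functional_resolvent_truncParam hB hρ hρ1 G v s
  have hflip := measurePreserving_flipTail s
  have hintf : Integrable (fun y => G (resolvent B (flipTail s y) v)) paramMeasure :=
    hflip.integrable_comp_of_integrable hint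
  have e1 : ∫ y, G (resolvent B (flipTail s y) v) ∂paramMeasure =
      ∫ y, G (resolvent B y v) ∂paramMeasure := by
    have h := integral_map hflip.measurable.aemeasurable
      (f := fun y => G (resolvent B y v)) (by rw [hflip.map_eq]; exact hint.aestronglyMeasurable)
    rw [hflip.map_eq] at h
    exact h.symm
  -- Since the reflection preserves the measure, the second difference integrates to twice the
  -- truncation error.
  have e2 : ∫ y, (G (resolvent B y v) + G (resolvent B (flipTail s y) v) -
      2 * G (resolvent B (truncParam s y) v)) ∂paramMeasure =
      2 * (∫ y, G (resolvent B y v) ∂paramMeasure -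
        ∫ y, G (resolvent B (truncParam s y) v) ∂paramMeasure) := by
    rw [integral_sub (f := fun y => G (resolvent B y v) + G (resolvent B (flipTail s y) v))
      (hint.add hintf) (hint'.const_mul 2), integral_add hint hintf, e1, integral_const_mul]
    ring
  have h := norm_integral_le_of_norm_le_const (μ := paramMeasure)
    (f := fun y => G (resolvent B y v) + G (resolvent B (flipTail s y) v) -
      2 * G (resolvent B (truncParam s y) v)) (by
    filter_upwards [ae_mem_paramDomain] with y hy
    exact abs_second_difference_functional_le hB hρ hρ1 G v s hy)
  rw [e2, probReal_univ, mul_one, Real.norm_eq_abs, abs_mul, abs_two] at h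
  linarith [abs_nonneg (∫ y, G (resolvent B y v) ∂paramMeasure -
        ∫ y, G (resolvent B (truncParam s y) v) ∂paramMeasure)]

end Resolvent

/-- Stechkin's estimate for the tails of a nonincreasing `p`-summable sequence. -/
theorem tsum_tail_le_of_antitone {β : ℕ → ℝ} (hβ0 : ∀ j, 0 ≤ β j) (hβ : Antitone β) {p : ℝ}
    (hp0 : 0 < p) (hp1 : p ≤ 1) (hsum : Summable fun j => β j ^ p) {s : ℕ} (hs : 1 ≤ s) :
    ∑' j, β (s + j) ≤ (∑' j, β j ^ p) ^ (1 / p) * (s : ℝ) ^ (-(1 / p - 1)) := by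
  set σ := ∑' j, β j ^ p with hσ
  have hσ0 : 0 ≤ σ := tsum_nonneg fun j => Real.rpow_nonneg (hβ0 j) p
  have hs0 : (0 : ℝ) < s := by exact_mod_cast hs
  have h1 : (s : ℝ) * β s ^ p ≤ σ := by
    calc (s : ℝ) * β s ^ p = ∑ _j ∈ Finset.range s, β s ^ p := by simp
      _ ≤ ∑ j ∈ Finset.range s, β j ^ p := by
        refine Finset.sum_le_sum fun j hj => Real.rpow_le_rpow (hβ0 s) (hβ ?_) hp0.le
        exact (Finset.mem_range.1 hj).le
      _ ≤ _ := hsum.sum_le_tsum _ fun j _ => Real.rpow_nonneg (hβ0 j) p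
  have h2 : β s ≤ (σ / s) ^ (1 / p) := by
    have h3 : β s ^ p ≤ σ / s := by rw [le_div_iff₀ hs0]; linarith
    calc β s = (β s ^ p) ^ (1 / p) := by
          rw [← Real.rpow_mul (hβ0 s), mul_one_div_cancel hp0.ne', Real.rpow_one]
      _ ≤ _ := Real.rpow_le_rpow (Real.rpow_nonneg (hβ0 s) p) h3 (by positivity)
  have htail : Summable fun j => β (s + j) ^ p := by
    simpa only [add_comm s] using (summable_nat_add_iff s).2 hsum
  -- Interpolation between ℓ^p and ℓ^∞: split off the power 1 - p and bound it by monotonicity.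
  -- Together with s β_s^p ≤ σ this gives the decay in s.
  have hle : ∀ j, β (s + j) ≤ β s ^ (1 - p) * β (s + j) ^ p := fun j => by
    rcases (hβ0 (s + j)).eq_or_lt with h0 | h0
    · rw [← h0, Real.zero_rpow hp0.ne', mul_zero]
    calc β (s + j) = β (s + j) ^ (1 - p) * β (s + j) ^ p := by
          rw [← Real.rpow_add h0]; simp
      _ ≤ _ := by
          gcongr
          exact hβ (Nat.le_add_right s j)
  have hσ' : ∑' j, β (s + j) ^ p ≤ σ := by
    rw [hσ, ← hsum.sum_add_tsum_nat_add s]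
    simp only [add_comm s]
    exact le_add_of_nonneg_left (Finset.sum_nonneg fun j _ => Real.rpow_nonneg (hβ0 j) p)
  calc ∑' j, β (s + j) ≤ ∑' j, β s ^ (1 - p) * β (s + j) ^ p :=
        (htail.mul_left _).of_nonneg_of_le (fun j => hβ0 _) hle |>.tsum_le_tsum hle
          (htail.mul_left _)
    _ = β s ^ (1 - p) * ∑' j, β (s + j) ^ p := tsum_mul_left
    _ ≤ ((σ / s) ^ (1 / p)) ^ (1 - p) * σ := by
        gcongr
        · exact tsum_nonneg fun j => Real.rpow_nonneg (hβ0 _) p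
        · exact hβ0 s
    _ = σ ^ (1 / p) * (s : ℝ) ^ (-(1 / p - 1)) := by
        rcases hσ0.eq_or_lt with h0 | h0
        · rw [← h0, Real.zero_rpow (by positivity)]; simp
        rw [← Real.rpow_mul (by positivity), Real.div_rpow hσ0 hs0.le, Real.rpow_neg hs0.le]
        have e : 1 / p * (1 - p) = 1 / p - 1 := by field_simp
        have e2 : σ ^ (1 / p) = σ ^ (1 / p - 1) * σ := by
          rw [Real.rpow_sub_one h0.ne']; field_simp
        rw [e, e2]
        ring

/-! ### Neumann series of operators that are affine in digits. -/

section DigitExpansion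

variable {X : Type*} [NormedAddCommGroup X] [NormedSpace ℝ X]
  {Λ D : Type*} [Fintype Λ] [DecidableEq Λ] [Fintype D]

/-- An operator depending affinely on finitely many digits `ξ l ∈ D`. -/
noncomputable def digitSum (θ : Λ → D → ℝ) (B : Λ → X →L[ℝ] X) (ξ : Λ → D) : X →L[ℝ] X :=
  ∑ l, θ l (ξ l) • B l

/-- Removing a letter `l` of `S` from the product is paid for by z_l, since a_l = (a_l / z_l) z_l;
all letters together cost at most `x`. The z_l play the role of radii in a Cauchy estimate, which
avoids counting words. -/
theorem sum_mul_prod_erase_le {a z : Λ → ℝ} (ha : ∀ l, 0 ≤ a l) (hz : ∀ l, 0 < z l) (S : Finset Λ)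
    {x : ℝ} (hx : ∑ l, a l + ∑ l ∈ S, z l ≤ x) :
    ∑ l, a l * ∏ i ∈ S.erase l, (a i / z i) ≤ (∏ i ∈ S, (a i / z i)) * x := by
  have hP : 0 ≤ ∏ i ∈ S, (a i / z i) := Finset.prod_nonneg fun i _ => div_nonneg (ha i) (hz i).le
  calc ∑ l, a l * ∏ i ∈ S.erase l, (a i / z i)
      ≤ ∑ l, (∏ i ∈ S, (a i / z i)) * (a l + if l ∈ S then z l else 0) := by
        refine Finset.sum_le_sum fun l _ => ?_
        by_cases hl : l ∈ S
        · rw [if_pos hl, ← Finset.mul_prod_erase S _ hl]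
          have h0 : 0 ≤ ∏ i ∈ S.erase l, (a i / z i) :=
            Finset.prod_nonneg fun i _ => div_nonneg (ha i) (hz i).le
          have h1 : a l * ∏ i ∈ S.erase l, (a i / z i) =
              (a l / z l * ∏ i ∈ S.erase l, (a i / z i)) * z l := by
            field_simp [(hz l).ne']
          have h2 := mul_nonneg (mul_nonneg (div_nonneg (ha l) (hz l).le) h0) (ha l)
          rw [h1, mul_add]
          linarith
        · rw [if_neg hl, add_zero, Finset.erase_eq_of_notMem hl, mul_comm]
    _ = (∏ i ∈ S, (a i / z i)) * (∑ l, a l + ∑ l ∈ S, z l) := by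
        rw [← Finset.mul_sum, Finset.sum_add_distrib, Finset.sum_ite_mem, Finset.univ_inter]
    _ ≤ _ := by gcongr

/-- Pairing a power of a digit-affine operator with a product of functions of the digits, those
with index in `S` being of mean zero: only words containing all letters of `S` contribute. -/
theorem norm_sum_prod_mul_pow_le {θ : Λ → D → ℝ} (hθ : ∀ l c, |θ l c| ≤ 1)
    {B : Λ → X →L[ℝ] X} {a z : Λ → ℝ} (hB : ∀ l, ‖B l‖ ≤ a l) (hz : ∀ l, 0 < z l)
    (G : StrongDual ℝ X) {x : ℝ} (n : ℕ) : ∀ (S : Finset Λ) (g : Λ → D → ℂ) (v : X),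
    (∀ l c, ‖g l c‖ ≤ 1) → (∀ l ∈ S, ∑ c, g l c = 0) → ∑ l, a l + ∑ l ∈ S, z l ≤ x →
    ‖∑ ξ : Λ → D, (∏ l, g l (ξ l)) * ((G ((digitSum θ B ξ ^ n) v) : ℝ) : ℂ)‖ ≤
      Fintype.card (Λ → D) * (‖G‖ * ‖v‖ * ((∏ i ∈ S, (a i / z i)) * x ^ n)) := by
  have ha : ∀ l, 0 ≤ a l := fun l => (norm_nonneg _).trans (hB l)
  induction n with
  -- For the empty word the sum over the digits factorises, and a single mean-zero factor
  -- annihilates it unless `S` is empty.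
  | zero =>
    intro S g v hg hS hx
    have h1 : ∀ ξ, (digitSum θ B ξ ^ 0) v = v := fun ξ => by rw [pow_zero]; rfl
    simp only [h1]
    simp only [pow_zero, mul_one]
    rcases S.eq_empty_or_nonempty with rfl | ⟨l, hl⟩
    · refine (norm_sum_le _ _).trans ?_
      rw [← nsmul_eq_mul, ← Finset.card_univ]
      refine Finset.sum_le_card_nsmul _ _ _ fun ξ _ => ?_
      rw [norm_mul, norm_prod, Complex.norm_real, Finset.prod_empty, mul_one]
      calc _ ≤ 1 * (‖G‖ * ‖v‖) := by
            gcongr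
            · exact Finset.prod_le_one (fun _ _ => norm_nonneg _) fun l _ => hg l _
            · exact G.le_opNorm v
        _ = _ := one_mul _
    · have h0 : ∑ ξ : Λ → D, (∏ l, g l (ξ l)) * ((G v : ℝ) : ℂ) = 0 := by
        rw [← Finset.sum_mul]
        have : ∑ ξ : Λ → D, ∏ l, g l (ξ l) = ∏ l, ∑ c, g l c := by
          rw [Finset.prod_univ_sum, Fintype.piFinset_univ]
        rw [this, Finset.prod_eq_zero (Finset.mem_univ l) (hS l hl), zero_mul]
      rw [h0, norm_zero]
      have : 0 ≤ ∏ i ∈ S, (a i / z i) := Finset.prod_nonneg fun i _ => div_nonneg (ha i) (hz i).le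
      positivity
  -- Peel off the letter l₀ applied first to `v`. Its digit factor is absorbed into g at l₀, which
  -- may lose mean zero, so l₀ leaves `S`, and `v` becomes B_{l₀} v. This is why `S`, `g` and `v`
  -- vary in the induction.
  | succ n ih =>
    intro S g v hg hS hx
    have hx0 : 0 ≤ x := le_trans (add_nonneg (Finset.sum_nonneg fun l _ => ha l)
      (Finset.sum_nonneg fun l _ => (hz l).le)) hx
    have expand : ∑ ξ : Λ → D, (∏ l, g l (ξ l)) * ((G ((digitSum θ B ξ ^ (n + 1)) v) : ℝ) : ℂ) =
        ∑ l₀, ∑ ξ : Λ → D, (∏ l, ((if l = l₀ then (θ l (ξ l) : ℂ) else 1) * g l (ξ l))) *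
          ((G ((digitSum θ B ξ ^ n) (B l₀ v)) : ℝ) : ℂ) := by
      rw [Finset.sum_comm]
      refine Finset.sum_congr rfl fun ξ _ => ?_
      have h1 : (digitSum θ B ξ ^ (n + 1)) v =
          ∑ l₀, θ l₀ (ξ l₀) • (digitSum θ B ξ ^ n) (B l₀ v) := by
        rw [pow_succ]
        change (digitSum θ B ξ ^ n) (digitSum θ B ξ v) = _
        conv_lhs => enter [2]; rw [digitSum]
        rw [_root_.sum_apply, map_sum]
        simp
      rw [h1, map_sum, Complex.ofReal_sum, Finset.mul_sum]
      refine Finset.sum_congr rfl fun l₀ _ => ?_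
      rw [Finset.prod_mul_distrib, Finset.prod_ite_eq' Finset.univ l₀, if_pos (Finset.mem_univ _),
        map_smul, smul_eq_mul, Complex.ofReal_mul]
      ring
    rw [expand]
    calc _ ≤ ∑ l₀, ‖∑ ξ : Λ → D,
          (∏ l, ((if l = l₀ then (θ l (ξ l) : ℂ) else 1) * g l (ξ l))) *
          ((G ((digitSum θ B ξ ^ n) (B l₀ v)) : ℝ) : ℂ)‖ := norm_sum_le _ _
      _ ≤ ∑ l₀, Fintype.card (Λ → D) * (‖G‖ * (a l₀ * ‖v‖) *
          ((∏ i ∈ S.erase l₀, (a i / z i)) * x ^ n)) := by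
        refine Finset.sum_le_sum fun l₀ _ => ?_
        refine (ih (S.erase l₀) (fun l c => (if l = l₀ then (θ l c : ℂ) else 1) * g l c) (B l₀ v)
          (fun l c => ?_) (fun l hl => ?_) ?_).trans ?_
        · rw [norm_mul]
          refine mul_le_one₀ ?_ (norm_nonneg _) (hg l c)
          split_ifs
          · rw [Complex.norm_real]; exact hθ l c
          · simp
        · simp only [if_neg (Finset.ne_of_mem_erase hl), one_mul]
          exact hS l (Finset.mem_of_mem_erase hl)
        · refine le_trans ?_ hx
          gcongr
          · exact fun i _ _ => (hz i).le
          · exact Finset.erase_subset _ _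
        · have : 0 ≤ ∏ i ∈ S.erase l₀, (a i / z i) :=
            Finset.prod_nonneg fun i _ => div_nonneg (ha i) (hz i).le
          gcongr
          exact (B l₀).le_of_opNorm_le (hB l₀) v
      _ = Fintype.card (Λ → D) * (‖G‖ * ‖v‖ * x ^ n) *
          ∑ l, a l * ∏ i ∈ S.erase l, (a i / z i) := by
        rw [Finset.mul_sum]
        exact Finset.sum_congr rfl fun _ _ => by ring
      _ ≤ Fintype.card (Λ → D) * (‖G‖ * ‖v‖ * x ^ n) * ((∏ i ∈ S, (a i / z i)) * x) := by
        gcongr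
        exact sum_mul_prod_erase_le ha hz S hx
      _ = _ := by ring

variable [CompleteSpace X]

/-- Sum the bounds for the powers over the Neumann series, a geometric series in `x`; the sign of
the resolvent is moved into the operators. -/
theorem norm_sum_prod_mul_inverse_le {θ : Λ → D → ℝ} (hθ : ∀ l c, |θ l c| ≤ 1)
    {B : Λ → X →L[ℝ] X} {a z : Λ → ℝ} (hB : ∀ l, ‖B l‖ ≤ a l) (hz : ∀ l, 0 < z l)
    (G : StrongDual ℝ X) {x : ℝ} (hx1 : x < 1) (S : Finset Λ) (g : Λ → D → ℂ) (v : X)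
    (hg : ∀ l c, ‖g l c‖ ≤ 1) (hS : ∀ l ∈ S, ∑ c, g l c = 0)
    (hx : ∑ l, a l + ∑ l ∈ S, z l ≤ x) :
    ‖∑ ξ : Λ → D, (∏ l, g l (ξ l)) *
      ((G (Ring.inverse (1 + digitSum θ B ξ) v) : ℝ) : ℂ)‖ ≤
      Fintype.card (Λ → D) * (‖G‖ * ‖v‖ * ((∏ i ∈ S, (a i / z i)) * (1 - x)⁻¹)) := by
  have ha : ∀ l, 0 ≤ a l := fun l => (norm_nonneg _).trans (hB l)
  have hx0 : 0 ≤ x := le_trans (add_nonneg (Finset.sum_nonneg fun l _ => ha l)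
      (Finset.sum_nonneg fun l _ => (hz l).le)) hx
  have hneg : ∀ ξ, -digitSum θ B ξ = digitSum θ (fun l => -B l) ξ := fun ξ => by
    simp [digitSum]
  have hnorm : ∀ ξ, ‖digitSum θ (fun l => -B l) ξ‖ < 1 := fun ξ => by
    refine lt_of_le_of_lt ((norm_sum_le _ _).trans ?_) hx1
    refine le_trans (Finset.sum_le_sum fun l _ => ?_)
      (le_trans (le_add_of_nonneg_right (Finset.sum_nonneg fun l _ => (hz l).le)) hx)
    rw [norm_smul, norm_neg, Real.norm_eq_abs]
    exact (mul_le_of_le_one_left (norm_nonneg _) (hθ l _)).trans (hB l)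
  have hsum : ∀ ξ : Λ → D, HasSum (fun n : ℕ => (∏ l, g l (ξ l)) *
      ((G ((digitSum θ (fun l => -B l) ξ ^ n) v) : ℝ) : ℂ))
      ((∏ l, g l (ξ l)) * ((G (Ring.inverse (1 + digitSum θ B ξ) v) : ℝ) : ℂ)) := fun ξ => by
    refine HasSum.mul_left _ ?_
    have h1 := hasSum_geom_series_inverse _ (hnorm ξ)
    rw [← hneg, sub_neg_eq_add] at h1
    have h2 := h1.mapL (G.comp (ContinuousLinearMap.apply ℝ X v))
    rw [← hneg]
    exact Complex.hasSum_ofReal.2 h2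
  have htot := hasSum_sum fun ξ (_ : ξ ∈ (Finset.univ : Finset (Λ → D))) => hsum ξ
  refine htot.norm_le_of_bounded
    (g := fun n => Fintype.card (Λ → D) * (‖G‖ * ‖v‖ * ((∏ i ∈ S, (a i / z i)) * x ^ n)))
    (((hasSum_geometric_of_lt_one hx0 hx1).mul_left _).mul_left _ |>.mul_left _) fun n => ?_
  exact norm_sum_prod_mul_pow_le hθ (fun l => by rw [norm_neg]; exact hB l) hz G n S g v hg hS hx

end DigitExpansion

/-! ### Fourier analysis on the group of digit vectors. -/

section Characters

variable {b : ℕ} [Fact b.Prime] {Λ : Type*} [Fintype Λ]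

/-- The additive characters of the finite vector space of digit vectors. -/
noncomputable def digitChar (k ξ : Λ → ZMod b) : ℂ := ∏ l, ZMod.stdAddChar (k l * ξ l)

theorem norm_digitChar (k ξ : Λ → ZMod b) : ‖digitChar k ξ‖ = 1 := by
  rw [digitChar, norm_prod]
  exact Finset.prod_eq_one fun l _ => by simp

theorem digitChar_add_right (k ξ ξ' : Λ → ZMod b) :
    digitChar k (ξ + ξ') = digitChar k ξ * digitChar k ξ' := by
  simp only [digitChar, ← Finset.prod_mul_distrib, Pi.add_apply, mul_add, AddChar.map_add_eq_mul]

theorem digitChar_neg_mul (k ξ ξ' : Λ → ZMod b) :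
    digitChar (-k) ξ * digitChar k ξ' = digitChar k (ξ' - ξ) := by
  rw [sub_eq_add_neg, digitChar_add_right, mul_comm]
  congr 1
  simp [digitChar]

variable [DecidableEq Λ]

/-- The Fourier coefficients of a function of the digits. -/
noncomputable def digitCoeff (F : (Λ → ZMod b) → ℂ) (k : Λ → ZMod b) : ℂ :=
  (Fintype.card (Λ → ZMod b) : ℂ)⁻¹ * ∑ ξ, digitChar (-k) ξ * F ξ

theorem sum_digitChar (ξ : Λ → ZMod b) :
    ∑ k, digitChar k ξ = if ξ = 0 then (Fintype.card (Λ → ZMod b) : ℂ) else 0 := by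
  have h : ∑ k, digitChar k ξ = ∏ l, ∑ c : ZMod b, ZMod.stdAddChar (c * ξ l) := by
    rw [Finset.prod_univ_sum, Fintype.piFinset_univ]; rfl
  rw [h]
  simp only [AddChar.sum_mulShift _ (ZMod.isPrimitive_stdAddChar b)]
  split_ifs with h0
  · simp [h0]
  · obtain ⟨l, hl⟩ := Function.ne_iff.1 h0
    exact Finset.prod_eq_zero (Finset.mem_univ l) (by rw [if_neg (by exact hl), Nat.cast_zero])

theorem sum_digitCoeff_mul_digitChar (F : (Λ → ZMod b) → ℂ) (ξ : Λ → ZMod b) :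
    ∑ k, digitCoeff F k * digitChar k ξ = F ξ := by
  have hcard : (Fintype.card (Λ → ZMod b) : ℂ) ≠ 0 := Nat.cast_ne_zero.2 Fintype.card_ne_zero
  calc ∑ k, digitCoeff F k * digitChar k ξ
      = (Fintype.card (Λ → ZMod b) : ℂ)⁻¹ * ∑ ξ', F ξ' * ∑ k, digitChar k (ξ - ξ') := by
        simp only [digitCoeff, Finset.mul_sum, Finset.sum_mul]
        rw [Finset.sum_comm]
        refine Finset.sum_congr rfl fun ξ' _ => Finset.sum_congr rfl fun k _ => ?_
        rw [← digitChar_neg_mul]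
        ring
    _ = F ξ := by
        simp only [sum_digitChar, sub_eq_zero, mul_ite, mul_zero, Finset.sum_ite_eq,
          Finset.mem_univ, if_true]
        field_simp

/-- The quadrature error as a sum over the dual of the point set. -/
theorem norm_average_sub_average_le {ι : Type*} (I : Finset ι) (hI : I.Nonempty)
    (ξ : ι → Λ → ZMod b) (F : (Λ → ZMod b) → ℂ) :
    ‖(I.card : ℂ)⁻¹ * ∑ n ∈ I, F (ξ n) - (Fintype.card (Λ → ZMod b) : ℂ)⁻¹ * ∑ η, F η‖ ≤
      ∑ k ∈ Finset.univ.erase (0 : Λ → ZMod b),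
        ‖digitCoeff F k‖ * ‖(I.card : ℂ)⁻¹ * ∑ n ∈ I, digitChar k (ξ n)‖ := by
  have hcard : (I.card : ℂ) ≠ 0 := Nat.cast_ne_zero.2 hI.card_ne_zero
  have h0 : (Fintype.card (Λ → ZMod b) : ℂ)⁻¹ * ∑ η, F η = digitCoeff F 0 := by
    simp [digitCoeff, digitChar]
  have h1 : (I.card : ℂ)⁻¹ * ∑ n ∈ I, F (ξ n) =
      ∑ k, digitCoeff F k * ((I.card : ℂ)⁻¹ * ∑ n ∈ I, digitChar k (ξ n)) := by
    simp only [Finset.mul_sum]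
    rw [Finset.sum_comm]
    refine Finset.sum_congr rfl fun n _ => ?_
    rw [← sum_digitCoeff_mul_digitChar F (ξ n), Finset.mul_sum]
    exact Finset.sum_congr rfl fun k _ => by ring
  have h2 : digitCoeff F 0 * ((I.card : ℂ)⁻¹ * ∑ n ∈ I, digitChar 0 (ξ n)) = digitCoeff F 0 := by
    simp [digitChar, hcard]
  rw [h0, h1, ← Finset.add_sum_erase _ _ (Finset.mem_univ 0), h2, add_sub_cancel_left]
  refine (norm_sum_le _ _).trans (le_of_eq ?_)
  simp only [norm_mul]

variable {X : Type*} [NormedAddCommGroup X] [NormedSpace ℝ X] [CompleteSpace X]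

/-- A character has mean zero in every digit where `k` is nonzero. Equal radii δ / (|S| + 1) add up
to at most δ, the +1 allowing `S` to be empty. `S` may be any part of the support, so that later one
letter per row suffices. -/
theorem norm_digitCoeff_inverse_le {θ : Λ → ZMod b → ℝ}
    (hθ : ∀ l c, |θ l c| ≤ 1) {B : Λ → X →L[ℝ] X} {a : Λ → ℝ} (hB : ∀ l, ‖B l‖ ≤ a l)
    {δ x : ℝ} (hδ : 0 < δ) (hx : ∑ l, a l + δ ≤ x) (hx1 : x < 1) (G : StrongDual ℝ X) (v : X)
    (k : Λ → ZMod b) (S : Finset Λ) (hS : ∀ l ∈ S, k l ≠ 0) :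
    ‖digitCoeff (fun ξ => ((G (Ring.inverse (1 + digitSum θ B ξ) v) : ℝ) : ℂ)) k‖ ≤
      ‖G‖ * ‖v‖ * (1 - x)⁻¹ * ∏ i ∈ S, (a i * ((S.card + 1) / δ)) := by
  have hcard : (0 : ℝ) < Fintype.card (Λ → ZMod b) := Nat.cast_pos.2 Fintype.card_pos
  rw [digitCoeff, norm_mul, norm_inv, Complex.norm_natCast, inv_mul_le_iff₀ hcard]
  have h := norm_sum_prod_mul_inverse_le hθ hB (z := fun _ => δ / (S.card + 1))
    (fun _ => by positivity) G hx1 S (fun l c => ZMod.stdAddChar ((-k) l * c)) v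
    (fun l c => by simp) (fun l hl => ?_) ?_
  · refine h.trans (le_of_eq ?_)
    have e : ∀ i, a i / (δ / ((S.card : ℝ) + 1)) = a i * ((S.card + 1) / δ) := fun i => by
      field_simp
    simp only [e]
    ring
  · have h1 := AddChar.sum_mulShift ((-k) l) (ZMod.isPrimitive_stdAddChar b)
    rw [if_neg (by simpa using hS l hl), Nat.cast_zero] at h1
    simpa only [mul_comm] using h1
  · refine le_trans ?_ hx
    gcongr
    rw [Finset.sum_const, nsmul_eq_mul, mul_div_assoc']
    rw [div_le_iff₀ (by positivity)]
    nlinarith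

end Characters

/-! ### Laurent series in x⁻¹ and residues modulo P. -/

section Laurent

variable {b : ℕ} [Fact b.Prime]

theorem toLaurent_add (g h : (ZMod b)[X]) : toLaurent b (g + h) = toLaurent b g + toLaurent b h :=
  map_add _ _ _

theorem toLaurent_mul (g h : (ZMod b)[X]) : toLaurent b (g * h) = toLaurent b g * toLaurent b h :=
  map_mul _ _ _

theorem toLaurent_C (a : ZMod b) : toLaurent b (Polynomial.C a) = HahnSeries.C a := by
  rw [toLaurent, Polynomial.aeval_C]
  exact RingHom.congr_fun (Subsingleton.elim _ _) a

theorem toLaurent_X_pow (n : ℕ) :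
    toLaurent b (Polynomial.X ^ n) = HahnSeries.single (-(n : ℤ)) 1 := by
  rw [toLaurent, map_pow, Polynomial.aeval_X, HahnSeries.single_pow]
  simp

theorem toLaurent_monomial (n : ℕ) (a : ZMod b) :
    toLaurent b (Polynomial.monomial n a) = HahnSeries.single (-(n : ℤ)) a := by
  rw [← Polynomial.C_mul_X_pow_eq_monomial, toLaurent_mul, toLaurent_C, toLaurent_X_pow,
    HahnSeries.C_apply, HahnSeries.single_mul_single]
  simp

theorem coeff_toLaurent_neg (h : (ZMod b)[X]) (n : ℕ) :
    (toLaurent b h).coeff (-(n : ℤ)) = h.coeff n := by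
  induction h using Polynomial.induction_on' with
  | add p q hp hq => rw [toLaurent_add, HahnSeries.coeff_add, hp, hq, Polynomial.coeff_add]
  | monomial k a =>
    rw [toLaurent_monomial, Polynomial.coeff_monomial]
    split_ifs with hk
    · rw [hk, HahnSeries.coeff_single_same]
    · rw [HahnSeries.coeff_single_of_ne]
      simpa using fun h => hk h.symm

theorem coeff_toLaurent_of_pos (h : (ZMod b)[X]) {j : ℤ} (hj : 0 < j) :
    (toLaurent b h).coeff j = 0 := by
  induction h using Polynomial.induction_on' with
  | add p q hp hq => rw [toLaurent_add, HahnSeries.coeff_add, hp, hq, add_zero]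
  | monomial k a =>
    rw [toLaurent_monomial, HahnSeries.coeff_single_of_ne]
    omega

theorem toLaurent_ne_zero {h : (ZMod b)[X]} (hh : h ≠ 0) : toLaurent b h ≠ 0 := fun h0 => by
  have := coeff_toLaurent_neg h h.natDegree
  rw [h0, HahnSeries.coeff_zero, eq_comm, Polynomial.coeff_natDegree,
    Polynomial.leadingCoeff_eq_zero] at this
  exact hh this

theorem order_toLaurent {h : (ZMod b)[X]} (hh : h ≠ 0) :
    (toLaurent b h).order = -(h.natDegree : ℤ) := by
  refine le_antisymm (HahnSeries.order_le_of_coeff_ne_zero ?_)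
    ((HahnSeries.le_order_iff_forall (toLaurent_ne_zero hh)).2 fun j hj => ?_)
  · rw [coeff_toLaurent_neg]
    simpa using hh
  · obtain ⟨n, rfl⟩ : ∃ n : ℕ, j = -(n : ℤ) := ⟨(-j).toNat, by omega⟩
    rw [coeff_toLaurent_neg]
    exact Polynomial.coeff_eq_zero_of_natDegree_lt (by omega)

/-- The coefficient of `x⁻¹` in `h / P`. -/
noncomputable def residue (P h : (ZMod b)[X]) : ZMod b :=
  (toLaurent b h / toLaurent b P).coeff 1

theorem residue_add (P g h : (ZMod b)[X]) : residue P (g + h) = residue P g + residue P h := by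
  rw [residue, toLaurent_add, add_div, HahnSeries.coeff_add]; rfl

/-- The residue as an additive map. -/
noncomputable def residueHom (P : (ZMod b)[X]) : (ZMod b)[X] →+ ZMod b :=
  AddMonoidHom.mk' (residue P) (residue_add P)

theorem residue_sum (P : (ZMod b)[X]) {ι : Type*} (I : Finset ι) (g : ι → (ZMod b)[X]) :
    residue P (∑ i ∈ I, g i) = ∑ i ∈ I, residue P (g i) :=
  map_sum (residueHom P) g I

theorem residue_C_mul (P : (ZMod b)[X]) (c : ZMod b) (h : (ZMod b)[X]) :
    residue P (Polynomial.C c * h) = c * residue P h := by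
  rw [residue, toLaurent_mul, toLaurent_C, mul_div_assoc, HahnSeries.C_apply,
    HahnSeries.coeff_single_mul, sub_zero]; rfl

theorem residue_X_pow_mul (P : (ZMod b)[X]) (n : ℕ) (h : (ZMod b)[X]) :
    residue P (Polynomial.X ^ n * h) = (toLaurent b h / toLaurent b P).coeff ((n : ℤ) + 1) := by
  rw [residue, toLaurent_mul, toLaurent_X_pow, mul_div_assoc, HahnSeries.coeff_single_mul, one_mul]
  congr 1
  ring

theorem residue_self_mul {P : (ZMod b)[X]} (hP : P ≠ 0) (h : (ZMod b)[X]) :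
    residue P (P * h) = 0 := by
  rw [residue, toLaurent_mul, mul_div_cancel_left₀ _ (toLaurent_ne_zero hP)]
  exact coeff_toLaurent_of_pos h one_pos

/-- Replace `g` by its nonzero remainder modulo `P` and shift it to degree deg P - 1: its quotient
by `P` then starts exactly at x⁻¹. -/
theorem exists_residue_ne_zero {P g : (ZMod b)[X]} (hP : P ≠ 0) (hg : ¬ P ∣ g) :
    ∃ r < P.natDegree, residue P (Polynomial.X ^ r * g) ≠ 0 := by
  set r₀ := g % P with hr₀
  have hr0 : r₀ ≠ 0 := fun h => hg (EuclideanDomain.mod_eq_zero.1 h)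
  have hdeg : r₀.natDegree < P.natDegree :=
    Polynomial.natDegree_lt_natDegree hr0 (Polynomial.degree_mod_lt g hP)
  refine ⟨P.natDegree - 1 - r₀.natDegree, by omega, ?_⟩
  have e1 : ∀ r, residue P (Polynomial.X ^ r * g) = residue P (Polynomial.X ^ r * r₀) := fun r => by
    conv_lhs => rw [← EuclideanDomain.mod_add_div g P, mul_add, mul_left_comm _ P, residue_add,
      residue_self_mul hP, add_zero]
  rw [e1]
  set h := Polynomial.X ^ (P.natDegree - 1 - r₀.natDegree) * r₀ with hh
  have hh0 : h ≠ 0 := mul_ne_zero (pow_ne_zero _ Polynomial.X_ne_zero) hr0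
  have hhdeg : h.natDegree = P.natDegree - 1 := by
    rw [hh, Polynomial.natDegree_X_pow_mul _ hr0]
    omega
  have hL0 : toLaurent b h / toLaurent b P ≠ 0 :=
    div_ne_zero (toLaurent_ne_zero hh0) (toLaurent_ne_zero hP)
  have hord : (toLaurent b h / toLaurent b P).order = 1 := by
    have h1 := HahnSeries.order_mul hL0 (toLaurent_ne_zero hP)
    rw [div_mul_cancel₀ _ (toLaurent_ne_zero hP), order_toLaurent hh0, order_toLaurent hP, hhdeg] at h1
    omega
  intro h0
  rw [residue, ← hord] at h0
  exact HahnSeries.coeff_order_eq_zero.not.2 hL0 h0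

end Laurent

/-! ### The dual of a polynomial lattice and its frequency. -/

section Dual

variable {b : ℕ} [Fact b.Prime]

theorem natCast_fin_bijective : Function.Bijective fun d : Fin b => ((d : ℕ) : ZMod b) := by
  refine (Fintype.bijective_iff_injective_and_card _).2 ⟨fun d d' h => ?_, by simp [ZMod.card]⟩
  have h' := (ZMod.natCast_eq_natCast_iff' _ _ _).1 h
  rw [Nat.mod_eq_of_lt d.2, Nat.mod_eq_of_lt d'.2] at h'
  exact Fin.ext h'

theorem sum_fin_stdAddChar_mul {c : ZMod b} (hc : c ≠ 0) :
    ∑ d : Fin b, ZMod.stdAddChar (((d : ℕ) : ZMod b) * c) = 0 := by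
  have h1 := natCast_fin_bijective.sum_comp fun e : ZMod b => ZMod.stdAddChar (e * c)
  rw [h1, AddChar.sum_mulShift c (ZMod.isPrimitive_stdAddChar b), if_neg hc, Nat.cast_zero]

theorem stdAddChar_sum {ι : Type*} (I : Finset ι) (f : ι → ZMod b) :
    ZMod.stdAddChar (∑ i ∈ I, f i) = ∏ i ∈ I, ZMod.stdAddChar (f i) := by
  classical
  induction I using Finset.induction_on with
  | empty => simp
  | insert i I hi ih => rw [Finset.sum_insert hi, Finset.prod_insert hi, AddChar.map_add_eq_mul, ih]

theorem residue_digitPoly_mul (P g : (ZMod b)[X]) (m n : ℕ) :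
    residue P (digitPoly b m n * g) =
      ∑ r ∈ Finset.range m, ((n / b ^ r % b : ℕ) : ZMod b) * residue P (Polynomial.X ^ r * g) := by
  rw [digitPoly, Finset.sum_mul, residue_sum]
  refine Finset.sum_congr rfl fun r _ => ?_
  rw [mul_assoc, residue_C_mul]

/-- The m digits of n run independently through all values, so the sum is a product of complete
character sums, and one of them is nontrivial. -/
theorem sum_stdAddChar_residue {P g : (ZMod b)[X]} (hP : P ≠ 0) (hg : ¬ P ∣ g) :
    ∑ n ∈ Finset.range (b ^ P.natDegree),
      ZMod.stdAddChar (residue P (digitPoly b P.natDegree n * g)) = 0 := by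
  set m := P.natDegree
  have h1 : ∀ n : Fin (b ^ m), ZMod.stdAddChar (residue P (digitPoly b m n * g)) =
      ∏ r : Fin m, ZMod.stdAddChar (((finFunctionFinEquiv.symm n r : ℕ) : ZMod b) *
        residue P (Polynomial.X ^ (r : ℕ) * g)) := fun n => by
    rw [residue_digitPoly_mul, Finset.sum_range, stdAddChar_sum]
    simp only [finFunctionFinEquiv_symm_apply_val]
  rw [Finset.sum_range, Finset.sum_congr rfl fun n _ => h1 n]
  rw [Equiv.sum_comp finFunctionFinEquiv.symm fun d : Fin m → Fin b =>
    ∏ r : Fin m, ZMod.stdAddChar (((d r : ℕ) : ZMod b) * residue P (Polynomial.X ^ (r : ℕ) * g))]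
  have h2 : ∑ d : Fin m → Fin b, ∏ r : Fin m,
      ZMod.stdAddChar (((d r : ℕ) : ZMod b) * residue P (Polynomial.X ^ (r : ℕ) * g)) =
      ∏ r : Fin m, ∑ e : Fin b,
        ZMod.stdAddChar (((e : ℕ) : ZMod b) * residue P (Polynomial.X ^ (r : ℕ) * g)) := by
    rw [Finset.prod_univ_sum, Fintype.piFinset_univ]
  rw [h2]
  obtain ⟨r, hr, hne⟩ := exists_residue_ne_zero hP hg
  exact Finset.prod_eq_zero (Finset.mem_univ (⟨r, hr⟩ : Fin m)) (sum_fin_stdAddChar_mul hne)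

/-- The polynomial with the given coefficients. -/
noncomputable def rowPoly {m : ℕ} (κ : Fin m → ZMod b) : (ZMod b)[X] :=
  ∑ a : Fin m, Polynomial.C (κ a) * Polynomial.X ^ (a : ℕ)

theorem coeff_rowPoly {m : ℕ} (κ : Fin m → ZMod b) (a : Fin m) :
    (rowPoly κ).coeff a = κ a := by
  rw [rowPoly, Polynomial.finsetSum_coeff, Finset.sum_eq_single a]
  · simp
  · intro c _ hc
    rw [Polynomial.coeff_C_mul_X_pow, if_neg]
    exact fun h => hc (Fin.ext h.symm)
  · simp

theorem rowPoly_injective {m : ℕ} : Function.Injective (rowPoly (b := b) (m := m)) :=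
  fun κ κ' h => funext fun a => by rw [← coeff_rowPoly κ a, h, coeff_rowPoly]

theorem rowPoly_sub {m : ℕ} (κ κ' : Fin m → ZMod b) :
    rowPoly (κ - κ') = rowPoly κ - rowPoly κ' := by
  simp [rowPoly, sub_mul]

theorem rowPoly_ne_zero {m : ℕ} {κ : Fin m → ZMod b} (hκ : κ ≠ 0) : rowPoly κ ≠ 0 := fun h =>
  hκ (rowPoly_injective (h.trans (by simp [rowPoly])))

theorem natDegree_rowPoly_lt {m : ℕ} (hm : 1 ≤ m) (κ : Fin m → ZMod b) :
    (rowPoly κ).natDegree < m := by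
  have h : (rowPoly κ).natDegree ≤ m - 1 :=
    Polynomial.natDegree_sum_le_of_forall_le _ _ fun a _ =>
      (Polynomial.natDegree_C_mul_X_pow_le _ _).trans (by omega)
  omega

theorem rowPoly_mem_genPolys {m : ℕ} (hm : 1 ≤ m) {κ : Fin m → ZMod b} (hκ : κ ≠ 0) :
    rowPoly κ ∈ genPolys b m :=
  ⟨rowPoly_ne_zero hκ, natDegree_rowPoly_lt hm κ⟩

/-- The first `m` digits of the coordinates of the `n`-th polynomial lattice point. -/
noncomputable def latticeDigits {R : Type*} (m : ℕ) (P : (ZMod b)[X]) (q : R → (ZMod b)[X]) (n : ℕ)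
    (l : R × Fin m) : ZMod b :=
  (toLaurent b (digitPoly b m n * q l.1) / toLaurent b P).coeff (((l.2 : ℕ) : ℤ) + 1)

variable {R : Type*} [Fintype R]

/-- Multiplication by x^a moves the digit with index `a` into the residue position, so pairing
digits with `k` is multiplication by the row polynomials of `k`. This identifies the dual as a
divisibility condition. -/
theorem digitChar_latticeDigits (m : ℕ) (P : (ZMod b)[X]) (q : R → (ZMod b)[X]) (n : ℕ)
    (k : R × Fin m → ZMod b) :
    digitChar k (latticeDigits m P q n) =
      ZMod.stdAddChar (residue P (digitPoly b m n *
        ∑ r, rowPoly (fun a => k (r, a)) * q r)) := by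
  rw [digitChar, ← stdAddChar_sum, Fintype.sum_prod_type]
  congr 1
  rw [Finset.mul_sum, residue_sum]
  refine Finset.sum_congr rfl fun r _ => ?_
  rw [rowPoly, Finset.sum_mul, Finset.mul_sum, residue_sum]
  refine Finset.sum_congr rfl fun a _ => ?_
  rw [latticeDigits, ← residue_X_pow_mul, ← residue_C_mul]
  congr 1
  ring

theorem dvd_of_sum_digitChar_ne_zero {m : ℕ} {P : (ZMod b)[X]} (hP : P ≠ 0)
    (hm : P.natDegree = m) (q : R → (ZMod b)[X]) (k : R × Fin m → ZMod b)
    (h : ∑ n ∈ Finset.range (b ^ m), digitChar k (latticeDigits m P q n) ≠ 0) :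
    P ∣ ∑ r, rowPoly (fun a => k (r, a)) * q r := by
  by_contra hdvd
  refine h ?_
  subst hm
  simp only [digitChar_latticeDigits]
  exact sum_stdAddChar_residue hP hdvd

/-- Nonzero generating polynomials of degree less than `m`, given by their coefficients. -/
abbrev GenRow (b m : ℕ) : Type := {κ : Fin m → ZMod b // κ ≠ 0}

theorem card_genRow (m : ℕ) : Fintype.card (GenRow b m) = b ^ m - 1 := by
  rw [Fintype.card_subtype_compl, Fintype.card_subtype_eq]
  simp [ZMod.card]

/-- The proportion of generating vectors that have a given nonzero vector in their dual. -/
theorem card_dvd_mul_le [DecidableEq R] {m : ℕ} (hm : 1 ≤ m) {P : (ZMod b)[X]} (hP : Irreducible P)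
    (hdeg : P.natDegree = m) {k : R × Fin m → ZMod b} (hk : k ≠ 0) (T : Finset (R → GenRow b m))
    (hT : ∀ κ ∈ T, P ∣ ∑ r, rowPoly (fun a => k (r, a)) * rowPoly (κ r).1) :
    T.card * (b ^ m - 1) ≤ Fintype.card (R → GenRow b m) := by
  obtain ⟨⟨r₀, a₀⟩, hr⟩ := Function.ne_iff.1 hk
  have hk0 : (fun a => k (r₀, a)) ≠ 0 := fun h => hr (congrFun h a₀)
  rw [← card_genRow m, ← Finset.card_univ, ← Finset.card_product]
  rw [← Finset.card_univ]
  -- Overwrite the entry at r₀, where the row of `k` is nonzero. No information is lost: `P` is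
  -- prime and divides no nonzero polynomial of degree below m, so within `T` the old entry is
  -- determined by the others.
  refine Finset.card_le_card_of_injOn (fun x => Function.update x.1 r₀ x.2)
    (fun _ _ => Finset.mem_coe.2 (Finset.mem_univ _)) ?_
  rintro ⟨κ, w⟩ hx ⟨κ', w'⟩ hx' heq
  have hκ := hT κ (Finset.mem_product.1 (Finset.mem_coe.1 hx)).1
  have hκ' := hT κ' (Finset.mem_product.1 (Finset.mem_coe.1 hx')).1
  have hw : w = w' := by simpa using congrFun heq r₀
  have hoff : ∀ r ≠ r₀, κ r = κ' r := fun r hr => by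
    simpa [Function.update_of_ne hr] using congrFun heq r
  have hdvd := dvd_sub hκ hκ'
  rw [← Finset.sum_sub_distrib, Finset.sum_eq_single r₀ (fun r _ hr => by rw [hoff r hr, sub_self])
    (by simp), ← mul_sub, ← rowPoly_sub] at hdvd
  have hnot : ∀ κ : Fin m → ZMod b, κ ≠ 0 → ¬ P ∣ rowPoly κ := fun κ hκ h => by
    have := Polynomial.natDegree_le_of_dvd h (rowPoly_ne_zero hκ)
    have := natDegree_rowPoly_lt hm κ
    omega
  have h0 : κ r₀ = κ' r₀ := by
    rcases hP.prime.dvd_or_dvd hdvd with h | h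
    · exact absurd h (hnot _ hk0)
    · by_contra hne
      exact hnot _ (sub_ne_zero.2 fun h => hne (Subtype.ext h)) h
  refine Prod.ext (funext fun r => ?_) hw
  by_cases hr : r = r₀
  · rw [hr]; exact h0
  · exact hoff r hr

end Dual

/-! ### Base-b digits and interlacing. -/

section Interlacing

variable {b : ℕ} [Fact b.Prime]

theorem sum_digits_mem_Ico (n : ℕ) : ∀ c : ℕ → ℕ, (∀ i, c i < b) →
    ∑ i ∈ Finset.range n, (c i : ℝ) / (b : ℝ) ^ (i + 1) ∈ Ico (0 : ℝ) 1 := by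
  have hb : (0 : ℝ) < b := by exact_mod_cast (Fact.out : b.Prime).pos
  induction n with
  | zero => intro c _; simp
  | succ n ih =>
    intro c hc
    have h := ih (fun i => c (i + 1)) fun i => hc _
    have e : ∑ i ∈ Finset.range (n + 1), (c i : ℝ) / (b : ℝ) ^ (i + 1) =
        (c 0 + ∑ i ∈ Finset.range n, (c (i + 1) : ℝ) / (b : ℝ) ^ (i + 1)) / b := by
      rw [Finset.sum_range_succ', add_div, Finset.sum_div, add_comm]
      congr 1
      · simp
      · refine Finset.sum_congr rfl fun i _ => ?_
        rw [pow_succ (b : ℝ) (i + 1)]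
        field_simp
    have hc0 : (c 0 : ℝ) + 1 ≤ b := by exact_mod_cast hc 0
    rw [e]
    refine ⟨div_nonneg (add_nonneg (Nat.cast_nonneg _) h.1) hb.le, ?_⟩
    rw [div_lt_one hb]
    linarith [h.2]

/-- Peel off the leading digit; the rest lies in [0, 1), so floors separate it. Beyond position `n`
the digits vanish, which makes the interlacing series finite for lattice points. -/
theorem digits_sum (n : ℕ) : ∀ (c : ℕ → ℕ), (∀ i, c i < b) → ∀ a,
    ((Real.digits (∑ i ∈ Finset.range n, (c i : ℝ) / (b : ℝ) ^ (i + 1)) b a : Fin b) : ℕ) =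
      if a < n then c a else 0 := by
  have hb : (0 : ℝ) < b := by exact_mod_cast (Fact.out : b.Prime).pos
  induction n with
  | zero => intro c _ a; simp [Real.digits]
  | succ n ih =>
    intro c hc a
    have h := sum_digits_mem_Ico (b := b) n (fun i => c (i + 1)) fun i => hc _
    have e : ∑ i ∈ Finset.range (n + 1), (c i : ℝ) / (b : ℝ) ^ (i + 1) =
        (c 0 + ∑ i ∈ Finset.range n, (c (i + 1) : ℝ) / (b : ℝ) ^ (i + 1)) / b := by
      rw [Finset.sum_range_succ', add_div, Finset.sum_div, add_comm]
      congr 1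
      · simp
      · refine Finset.sum_congr rfl fun i _ => ?_
        rw [pow_succ (b : ℝ) (i + 1)]
        field_simp
    rw [e]
    set x := ∑ i ∈ Finset.range n, (c (i + 1) : ℝ) / (b : ℝ) ^ (i + 1) with hx
    cases a with
    | zero =>
      rw [Real.digits, Fin.val_ofNat, if_pos (Nat.succ_pos n), zero_add, pow_one,
        div_mul_cancel₀ _ hb.ne', add_comm, Nat.floor_add_natCast h.1, Nat.floor_eq_zero.2 h.2,
        zero_add, Nat.mod_eq_of_lt (hc 0)]
    | succ a =>
      have e2 : (c 0 + x) / b * (b : ℝ) ^ (a + 1 + 1) =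
          x * (b : ℝ) ^ (a + 1) + ((c 0 * b ^ (a + 1) : ℕ) : ℝ) := by
        rw [pow_succ (b : ℝ) (a + 1)]
        push_cast
        field_simp
        ring
      have h2 := ih (fun i => c (i + 1)) (fun i => hc _) a
      rw [Real.digits, Fin.val_ofNat] at h2 ⊢
      rw [e2, Nat.floor_add_natCast (mul_nonneg h.1 (by positivity)), pow_succ b a, ← mul_assoc,
        Nat.add_mul_mod_self_right, h2]
      simp

theorem laurentValue_eq (m : ℕ) (L : LaurentSeries (ZMod b)) :
    laurentValue b m L =
      ∑ i ∈ Finset.range m, (((L.coeff ((i : ℤ) + 1)).val : ℕ) : ℝ) / (b : ℝ) ^ (i + 1) := by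
  have h : Finset.Icc 1 m = Finset.Ico (0 + 1) (m + 1) := by
    ext; simp only [Finset.mem_Icc, Finset.mem_Ico]; omega
  rw [laurentValue, h, Finset.range_eq_Ico, ← Finset.sum_Ico_add']
  push_cast
  rfl

theorem interlacedPoint_eq {α m s : ℕ} (P : (ZMod b)[X]) (q : Fin s → Fin α → (ZMod b)[X]) (n : ℕ)
    (j : Fin s) :
    interlacedPoint b α m s P q n j = ∑ c : Fin α, ∑ a : Fin m,
      ((latticeDigits m P (fun r : Fin s × Fin α => q r.1 r.2) n ((j, c), a)).val : ℝ) /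
        (b : ℝ) ^ ((c : ℕ) + 1 + (a : ℕ) * α) := by
  have hd : ∀ (c : Fin α) (a : ℕ),
      ((Real.digits (polyLatticeCoord b m P (q j c) n) b a : Fin b) : ℕ) = if a < m then
        ((toLaurent b (digitPoly b m n * q j c) / toLaurent b P).coeff ((a : ℤ) + 1)).val else 0 := by
    intro c a
    rw [polyLatticeCoord, laurentValue_eq]
    exact digits_sum m (fun i =>
      ((toLaurent b (digitPoly b m n * q j c) / toLaurent b P).coeff ((i : ℤ) + 1)).val)
      (fun i => ZMod.val_lt _) a
  rw [interlacedPoint, interlace, tsum_eq_sum (s := Finset.range m), Finset.sum_range,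
    Finset.sum_comm]
  · refine Finset.sum_congr rfl fun c _ => Finset.sum_congr rfl fun a _ => ?_
    rw [hd, if_pos a.2]
    rfl
  · intro a ha
    refine Finset.sum_eq_zero fun c _ => ?_
    rw [hd, if_neg (by simpa using ha)]
    simp

end Interlacing

/-! ### Weights of dual vectors. -/

section Weights

variable {b : ℕ} [Fact b.Prime] {m : ℕ}

/-- The position of the last nonzero entry. -/
noncomputable def rowTop (κ : Fin m → ZMod b) : ℕ :=
  (Finset.univ.filter fun a => κ a ≠ 0).sup fun a => (a : ℕ)

theorem exists_rowTop {κ : Fin m → ZMod b} (hκ : κ ≠ 0) :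
    ∃ a : Fin m, κ a ≠ 0 ∧ (a : ℕ) = rowTop κ := by
  obtain ⟨a₀, h0⟩ := Function.ne_iff.1 hκ
  obtain ⟨a, ha, h⟩ := Finset.exists_mem_eq_sup (Finset.univ.filter fun a => κ a ≠ 0)
    ⟨a₀, Finset.mem_filter.2 ⟨Finset.mem_univ _, h0⟩⟩ fun a => (a : ℕ)
  exact ⟨a, (Finset.mem_filter.1 ha).2, h.symm⟩

theorem eq_zero_of_rowTop_lt {κ : Fin m → ZMod b} {a : Fin m} (h : rowTop κ < a) : κ a = 0 := by
  by_contra h0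
  exact absurd (Finset.le_sup (f := fun a : Fin m => (a : ℕ))
    (Finset.mem_filter.2 ⟨Finset.mem_univ a, h0⟩)) (not_le.2 h)

theorem card_eq_zero_beyond (a : Fin m) :
    (Finset.univ.filter fun κ : Fin m → ZMod b => ∀ i, a < i → κ i = 0).card ≤
      b ^ ((a : ℕ) + 1) := by
  have h : (Finset.univ.filter fun κ : Fin m → ZMod b => ∀ i, a < i → κ i = 0) =
      Fintype.piFinset fun i => if a < i then {0} else Finset.univ := by
    ext κ
    simp only [Finset.mem_filter, Finset.mem_univ, true_and, Fintype.mem_piFinset]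
    refine forall_congr' fun i => ?_
    split_ifs with hi <;> simp [hi]
  rw [h, Fintype.card_piFinset]
  have e : ∀ i : Fin m, (if a < i then ({0} : Finset (ZMod b)) else Finset.univ).card =
      if i ≤ a then b else 1 := fun i => by
    by_cases hi : a < i
    · rw [if_pos hi, if_neg (not_le.2 hi), Finset.card_singleton]
    · rw [if_neg hi, if_pos (not_lt.1 hi), Finset.card_univ, ZMod.card]
  simp only [e]
  rw [Finset.prod_ite, Finset.prod_const, Finset.prod_const_one, mul_one]
  have : (Finset.univ.filter fun i : Fin m => i ≤ a).card = (a : ℕ) + 1 := by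
    rw [← Fin.card_Iic]
    congr 1
    ext
    simp
  rw [this]

/-- At most b^(a+1) rows end at position `a`, which leaves a geometric series in bτ. -/
theorem sum_pow_rowTop_le {τ : ℝ} (hτ0 : 0 ≤ τ) (hτ : b * τ < 1) :
    ∑ κ ∈ Finset.univ.erase (0 : Fin m → ZMod b), τ ^ rowTop κ ≤ b * (1 - b * τ)⁻¹ := by
  calc ∑ κ ∈ Finset.univ.erase (0 : Fin m → ZMod b), τ ^ rowTop κ
      ≤ ∑ κ : Fin m → ZMod b, ∑ a : Fin m, if ∀ i, a < i → κ i = 0 then τ ^ (a : ℕ) else 0 := by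
        refine (Finset.sum_le_sum fun κ hκ => ?_).trans
          (Finset.sum_le_sum_of_subset_of_nonneg (Finset.erase_subset _ _) fun κ _ _ =>
            Finset.sum_nonneg fun a _ => by split_ifs <;> positivity)
        obtain ⟨a, -, ha⟩ := exists_rowTop (Finset.ne_of_mem_erase hκ)
        refine le_trans (le_of_eq ?_) (Finset.single_le_sum (f := fun a : Fin m =>
          if ∀ i, a < i → κ i = 0 then τ ^ (a : ℕ) else 0)
          (fun a _ => by split_ifs <;> positivity) (Finset.mem_univ a))
        rw [if_pos, ha]
        intro i hi
        exact eq_zero_of_rowTop_lt (by rw [← ha]; exact hi)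
    _ = ∑ a : Fin m, ((Finset.univ.filter fun κ : Fin m → ZMod b =>
          ∀ i, a < i → κ i = 0).card : ℝ) * τ ^ (a : ℕ) := by
        rw [Finset.sum_comm]
        refine Finset.sum_congr rfl fun a _ => ?_
        rw [← Finset.sum_filter, Finset.sum_const, nsmul_eq_mul]
    _ ≤ ∑ a : Fin m, (b : ℝ) * (b * τ) ^ (a : ℕ) := by
        refine Finset.sum_le_sum fun a _ => ?_
        calc _ ≤ ((b ^ ((a : ℕ) + 1) : ℕ) : ℝ) * τ ^ (a : ℕ) := by
              gcongr; exact card_eq_zero_beyond a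
          _ = _ := by push_cast; rw [mul_pow]; ring
    _ = b * ∑ a ∈ Finset.range m, (b * τ) ^ a := by
        rw [← Finset.mul_sum, Finset.sum_range]
    _ ≤ _ := by
        gcongr
        have h := hasSum_geometric_of_lt_one (by positivity : 0 ≤ b * τ) hτ
        rw [← h.tsum_eq]
        exact h.summable.sum_le_tsum _ fun _ _ => by positivity

variable {R : Type*} [Fintype R]

/-- The rows on which a digit vector does not vanish. -/
noncomputable def rowSupport (k : R × Fin m → ZMod b) : Finset R :=
  Finset.univ.filter fun r => (fun a => k (r, a)) ≠ 0

/-- The weight of a vector of the dual net. -/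
noncomputable def dualWeight (A : R → ℝ) (τ : ℝ) (k : R × Fin m → ZMod b) : ℝ :=
  ∏ r ∈ rowSupport k, (A r * τ ^ rowTop (fun a => k (r, a)) * ((rowSupport k).card + 1))

theorem dualWeight_nonneg {A : R → ℝ} (hA : ∀ r, 0 ≤ A r) {τ : ℝ} (hτ : 0 ≤ τ)
    (k : R × Fin m → ZMod b) : 0 ≤ dualWeight A τ k :=
  Finset.prod_nonneg fun r _ => by have := hA r; positivity

/-- The rows of `k` vary independently, and a zero row contributes the summand 1. -/
theorem sum_prod_rowSupport [DecidableEq R] (x : R → ℝ) (φ : (Fin m → ZMod b) → ℝ) :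
    ∑ k : R × Fin m → ZMod b, ∏ r ∈ rowSupport k, (x r * φ fun a => k (r, a)) =
      ∏ r, (1 + x r * ∑ κ ∈ Finset.univ.erase (0 : Fin m → ZMod b), φ κ) := by
  have h1 : ∀ k : R × Fin m → ZMod b, ∏ r ∈ rowSupport k, (x r * φ fun a => k (r, a)) =
      ∏ r, (fun r κ => if κ ≠ 0 then x r * φ κ else 1) r (Equiv.curry R (Fin m) (ZMod b) k r) :=
    fun k => Finset.prod_filter _ _
  have h2 : ∑ K : R → Fin m → ZMod b, ∏ r, (fun r κ => if κ ≠ 0 then x r * φ κ else 1) r (K r) =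
      ∏ r, ∑ κ : Fin m → ZMod b, (if κ ≠ 0 then x r * φ κ else 1) := by
    rw [Finset.prod_univ_sum, Fintype.piFinset_univ]
  rw [Finset.sum_congr rfl fun k _ => h1 k,
    (Equiv.curry R (Fin m) (ZMod b)).sum_comp fun K =>
      ∏ r, (fun r κ => if κ ≠ 0 then x r * φ κ else 1) r (K r), h2]
  refine Finset.prod_congr rfl fun r _ => ?_
  rw [← Finset.add_sum_erase _ _ (Finset.mem_univ 0), if_neg (by simp), Finset.mul_sum]
  congr 1
  refine Finset.sum_congr rfl fun κ hκ => ?_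
  rw [if_pos (Finset.ne_of_mem_erase hκ)]

/-- The factor (|supp| + 1)^|supp| is at least 1, so its p-th power may be replaced by itself, the
form that the exponential series absorbs later. -/
theorem dualWeight_rpow_le {A : R → ℝ} (hA : ∀ r, 0 ≤ A r) {τ : ℝ} (hτ : 0 ≤ τ) {p : ℝ}
    (hp1 : p ≤ 1) (k : R × Fin m → ZMod b) :
    dualWeight A τ k ^ p ≤ ((rowSupport k).card + 1 : ℝ) ^ (rowSupport k).card *
      ∏ r ∈ rowSupport k, (A r ^ p * (τ ^ p) ^ rowTop (fun a => k (r, a))) := by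
  have h0 : ∀ r ∈ rowSupport k, 0 ≤ A r * τ ^ rowTop (fun a => k (r, a)) := fun r _ => by
    have := hA r; positivity
  rw [dualWeight, Finset.prod_mul_distrib, Finset.prod_const,
    Real.mul_rpow (Finset.prod_nonneg h0) (by positivity), mul_comm]
  have h1 : (1 : ℝ) ≤ ((rowSupport k).card + 1 : ℝ) ^ (rowSupport k).card :=
    one_le_pow₀ (by linarith [Nat.cast_nonneg (α := ℝ) (rowSupport k).card])
  gcongr
  · exact Real.rpow_nonneg (Finset.prod_nonneg h0) _
  · calc _ ≤ (((rowSupport k).card + 1 : ℝ) ^ (rowSupport k).card) ^ (1 : ℝ) :=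
          Real.rpow_le_rpow_of_exponent_le h1 hp1
      _ = _ := Real.rpow_one _
  · rw [← Real.finsetProd_rpow _ _ h0]
    refine le_of_eq (Finset.prod_congr rfl fun r _ => ?_)
    rw [Real.mul_rpow (hA r) (by positivity), ← Real.rpow_natCast_mul hτ, mul_comm (_ : ℝ) p,
      Real.rpow_mul_natCast hτ]

end Weights

/-! ### Generating series for factorial-type weights. -/

section Series

theorem summable_exp_mul_pow (H : ℕ) {Y : ℝ} (hY : 0 ≤ Y) :
    Summable fun i : ℕ => Real.exp (1 - i) * ((1 + i * Y) ^ H * Real.exp (i / 2)) := by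
  have hr : ‖Real.exp (-(1 / 2))‖ < 1 := by
    rw [Real.norm_eq_abs, Real.abs_exp, Real.exp_lt_one_iff]; norm_num
  have h1 := summable_pow_mul_geometric_of_norm_lt_one H hr
  have h2 := ((summable_nat_add_iff 1).2 h1).mul_left (Real.exp (3 / 2) * (1 + Y) ^ H)
  refine Summable.of_nonneg_of_le (fun i => by positivity) (fun i => ?_) h2
  have e1 : Real.exp (1 - i) * Real.exp (i / 2) =
      Real.exp (3 / 2) * Real.exp (-(1 / 2)) ^ (i + 1) := by
    rw [← Real.exp_nat_mul, ← Real.exp_add, ← Real.exp_add]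
    congr 1
    push_cast
    ring
  have e2 : (1 + i * Y) ^ H ≤ ((1 + Y) * ((i : ℝ) + 1)) ^ H := by
    gcongr
    nlinarith [Nat.cast_nonneg (α := ℝ) i]
  calc _ = (Real.exp (1 - i) * Real.exp (i / 2)) * (1 + i * Y) ^ H := by ring
    _ ≤ (Real.exp (3 / 2) * Real.exp (-(1 / 2)) ^ (i + 1)) * ((1 + Y) * ((i : ℝ) + 1)) ^ H := by
        rw [e1]; gcongr
    _ = _ := by rw [mul_pow]; push_cast; ring

/-- Finitely many factors give only polynomial growth in `t`; all others together grow exponentially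
at the small rate ε, uniformly in `s`. -/
theorem prod_one_add_le {y : ℕ → ℝ} (hy0 : ∀ j, 0 ≤ y j) {Y : ℝ} (hyY : ∀ j, y j ≤ Y) (J : ℕ)
    {ε : ℝ} (hs : Summable y) (hε : ∑' j, y (j + J) ≤ ε) {t : ℝ} (ht : 0 ≤ t) (s : ℕ) :
    ∏ j ∈ Finset.range s, (1 + t * y j) ≤ (1 + t * Y) ^ J * Real.exp (t * ε) := by
  have hY : 0 ≤ Y := (hy0 0).trans (hyY 0)
  have hone : ∀ j, 1 ≤ 1 + t * y j := fun j => le_add_of_nonneg_right (mul_nonneg ht (hy0 j))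
  have h1 : ∏ j ∈ Finset.range s, (1 + t * y j) ≤ ∏ j ∈ Finset.range (J + s), (1 + t * y j) := by
    rw [add_comm J s, Finset.prod_range_add]
    exact le_mul_of_one_le_right (Finset.prod_nonneg fun j _ => zero_le_one.trans (hone j))
      (Finset.prod_const_one.symm.trans_le
        (Finset.prod_le_prod (fun _ _ => zero_le_one) fun j _ => hone (s + j)))
  refine h1.trans ?_
  rw [Finset.prod_range_add]
  have h2 : ∏ j ∈ Finset.range J, (1 + t * y j) ≤ (1 + t * Y) ^ J := by
    calc _ ≤ ∏ _j ∈ Finset.range J, (1 + t * Y) := by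
          refine Finset.prod_le_prod (fun j _ => ?_) fun j _ => ?_
          · have := hy0 j; positivity
          · have := hyY j; gcongr
      _ = _ := by simp
  have h3 : ∏ j ∈ Finset.range s, (1 + t * y (J + j)) ≤ Real.exp (t * ε) := by
    calc _ ≤ ∏ j ∈ Finset.range s, Real.exp (t * y (J + j)) := by
          refine Finset.prod_le_prod (fun j _ => ?_) fun j _ => ?_
          · have := hy0 (J + j); positivity
          · rw [add_comm]; exact Real.add_one_le_exp _
      _ = Real.exp (t * ∑ j ∈ Finset.range s, y (j + J)) := by
          rw [← Real.exp_sum, Finset.mul_sum]; simp only [add_comm J]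
      _ ≤ _ := by
          gcongr
          exact (((summable_nat_add_iff J).2 hs).sum_le_tsum _ fun j _ => hy0 _).trans hε
  exact mul_le_mul h2 h3 (Finset.prod_nonneg fun j _ => by have := hy0 (J + j); positivity)
    (by positivity)

/-- The generating series of the factorial-type weights. -/
theorem exists_tsum_prod_le {y : ℕ → ℝ} (hy0 : ∀ j, 0 ≤ y j) (hs : Summable y) (α : ℕ) :
    ∃ C : ℝ, 0 < C ∧ ∀ s : ℕ,
      (Summable fun i : ℕ => Real.exp (1 - i) * ∏ r : Fin s × Fin α, (1 + i * y r.1)) ∧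
      ∑' i : ℕ, Real.exp (1 - i) * ∏ r : Fin s × Fin α, (1 + i * y r.1) ≤ C := by
  -- The tail is chosen so that after the α-th power, one factor per row of each coordinate, the
  -- rate is still below 1/2 and loses against exp(-i).
  obtain ⟨J, hJ⟩ : ∃ J, ∑' j, y (j + J) ≤ 1 / (2 * (α + 1)) := by
    have h := (tendsto_sum_nat_add y).eventually (gt_mem_nhds (show (0 : ℝ) < 1 / (2 * (α + 1)) by
      positivity))
    obtain ⟨J, hJ⟩ := h.exists
    exact ⟨J, hJ.le⟩
  have hyY : ∀ j, y j ≤ ∑' j, y j := fun j => hs.le_tsum j fun i _ => hy0 i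
  have hY : 0 ≤ ∑' j, y j := tsum_nonneg hy0
  have hsum := summable_exp_mul_pow (J * α) hY
  have hle : ∀ (s i : ℕ), Real.exp (1 - i) * ∏ r : Fin s × Fin α, (1 + i * y r.1) ≤
      Real.exp (1 - i) * ((1 + i * ∑' j, y j) ^ (J * α) * Real.exp (i / 2)) := fun s i => by
    gcongr
    have h1 := prod_one_add_le hy0 hyY J hs hJ (Nat.cast_nonneg (α := ℝ) i) s
    have e1 : ∏ r : Fin s × Fin α, (1 + i * y r.1) =
        (∏ j ∈ Finset.range s, (1 + i * y j)) ^ α := by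
      rw [Fintype.prod_prod_type, Finset.prod_range]
      simp [Finset.prod_pow]
    rw [e1]
    calc _ ≤ ((1 + i * ∑' j, y j) ^ J * Real.exp (i * (1 / (2 * (α + 1))))) ^ α := by
          gcongr
          exact Finset.prod_nonneg fun j _ => by have := hy0 j; positivity
      _ = (1 + i * ∑' j, y j) ^ (J * α) * Real.exp (α * (i * (1 / (2 * (α + 1))))) := by
          rw [mul_pow, ← pow_mul, ← Real.exp_nat_mul]
      _ ≤ _ := by
          gcongr
          have : (α : ℝ) * (i * (1 / (2 * (α + 1)))) = (i / 2) * (α / (α + 1)) := by field_simp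
          rw [this]
          refine mul_le_of_le_one_right (by positivity) ?_
          rw [div_le_one (by positivity)]
          linarith
  have h0 : ∀ (s i : ℕ), 0 ≤ Real.exp (1 - i) * ∏ r : Fin s × Fin α, (1 + i * y r.1) :=
    fun s i => mul_nonneg (Real.exp_pos _).le
      (Finset.prod_nonneg fun r _ => by have := hy0 r.1; positivity)
  refine ⟨∑' i : ℕ, Real.exp (1 - i) * ((1 + i * ∑' j, y j) ^ (J * α) * Real.exp (i / 2)) + 1,
    ?_, fun s => ?_⟩
  · have : 0 ≤ ∑' i : ℕ, Real.exp (1 - i) * ((1 + i * ∑' j, y j) ^ (J * α) * Real.exp (i / 2)) :=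
      tsum_nonneg fun i => by positivity
    linarith
  · have hS := Summable.of_nonneg_of_le (h0 s) (hle s) hsum
    exact ⟨hS, (hS.tsum_le_tsum (hle s) hsum).trans (by linarith)⟩

/-- The embedding of ℓ^p into ℓ^1, which converts an average of order 1/N into an error of order
N^(-1/p). -/
theorem rpow_sum_le {ι : Type*} (I : Finset ι) {w : ι → ℝ} (hw : ∀ i, 0 ≤ w i) {p : ℝ}
    (hp0 : 0 < p) (hp1 : p ≤ 1) : (∑ i ∈ I, w i) ^ p ≤ ∑ i ∈ I, w i ^ p := by
  classical
  induction I using Finset.induction_on with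
  | empty => simp [Real.zero_rpow hp0.ne']
  | insert i I hi ih =>
    rw [Finset.sum_insert hi, Finset.sum_insert hi]
    exact (Real.rpow_add_le_add_rpow (hw i) (Finset.sum_nonneg fun i _ => hw i) hp0.le hp1).trans
      (by gcongr)

end Series

/-! ### Summability of the weights and averaging over generating vectors. -/

section Existence

variable {b : ℕ} [Fact b.Prime]

/-- The `p`-th powers of the weights are summable over the dual space, uniformly in the
dimension. -/
theorem exists_sum_dualWeight_rpow_le {β : ℕ → ℝ} (hβ0 : ∀ j, 0 ≤ β j) {p : ℝ}
    (hp1 : p ≤ 1) (hs : Summable fun j => β j ^ p) {τ : ℝ} (hτ0 : 0 ≤ τ)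
    (hτ : b * τ ^ p < 1) (α : ℕ) :
    ∃ C : ℝ, 0 < C ∧ ∀ s m : ℕ,
      ∑ k : (Fin s × Fin α) × Fin m → ZMod b, dualWeight (fun r => β r.1) τ k ^ p ≤ C := by
  set M : ℝ := b * (1 - b * τ ^ p)⁻¹ with hM
  have hM0 : 0 ≤ M := mul_nonneg (Nat.cast_nonneg _) (inv_nonneg.2 (by linarith))
  have hτp : 0 ≤ τ ^ p := Real.rpow_nonneg hτ0 p
  have hβp : ∀ j, 0 ≤ β j ^ p := fun j => Real.rpow_nonneg (hβ0 j) p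
  obtain ⟨C, hC, hCs⟩ := exists_tsum_prod_le (y := fun j => Real.exp 1 * β j ^ p * M)
    (fun j => by have := hβp j; positivity) ((hs.mul_left _).mul_right _) α
  refine ⟨C, hC, fun s m => ?_⟩
  obtain ⟨hS, hle⟩ := hCs s
  have hterm : ∀ i : ℕ, ∑ k : (Fin s × Fin α) × Fin m → ZMod b, Real.exp (1 - i) *
      ∏ r ∈ rowSupport k, (i * Real.exp 1 * β r.1 ^ p * (τ ^ p) ^ rowTop (fun a => k (r, a))) ≤
      Real.exp (1 - i) * ∏ r : Fin s × Fin α, (1 + i * (Real.exp 1 * β r.1 ^ p * M)) := fun i => by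
    rw [← Finset.mul_sum, sum_prod_rowSupport (fun r : Fin s × Fin α => i * Real.exp 1 * β r.1 ^ p)
      fun κ => (τ ^ p) ^ rowTop κ]
    have hnn : 0 ≤ ∑ κ ∈ Finset.univ.erase (0 : Fin m → ZMod b), (τ ^ p) ^ rowTop κ :=
      Finset.sum_nonneg fun κ _ => by positivity
    refine mul_le_mul_of_nonneg_left (Finset.prod_le_prod (fun r _ => ?_) fun r _ => ?_)
      (Real.exp_pos _).le
    · have := hβp r.1
      positivity
    · have h1 := hβp r.1
      rw [← mul_assoc (i : ℝ), ← mul_assoc (i : ℝ)]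
      gcongr
      exact sum_pow_rowTop_le hτp hτ
  have hnonneg : ∀ (i : ℕ) (k : (Fin s × Fin α) × Fin m → ZMod b), 0 ≤ Real.exp (1 - i) *
      ∏ r ∈ rowSupport k, (i * Real.exp 1 * β r.1 ^ p * (τ ^ p) ^ rowTop (fun a => k (r, a))) :=
    fun i k => mul_nonneg (Real.exp_pos _).le
      (Finset.prod_nonneg fun r _ => by have := hβp r.1; positivity)
  have hsummable : ∀ k : (Fin s × Fin α) × Fin m → ZMod b, Summable fun i : ℕ =>
      Real.exp (1 - i) * ∏ r ∈ rowSupport k,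
        (i * Real.exp 1 * β r.1 ^ p * (τ ^ p) ^ rowTop (fun a => k (r, a))) := fun k =>
    Summable.of_nonneg_of_le (fun i => hnonneg i k) (fun i =>
      (Finset.single_le_sum (fun k _ => hnonneg i k) (Finset.mem_univ k)).trans (hterm i)) hS
  calc ∑ k : (Fin s × Fin α) × Fin m → ZMod b, dualWeight (fun r => β r.1) τ k ^ p
      ≤ ∑ k : (Fin s × Fin α) × Fin m → ZMod b, ∑' i : ℕ, Real.exp (1 - i) * ∏ r ∈ rowSupport k,
        (i * Real.exp 1 * β r.1 ^ p * (τ ^ p) ^ rowTop (fun a => k (r, a))) := by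
        refine Finset.sum_le_sum fun k _ => ?_
        refine (dualWeight_rpow_le (fun r => hβ0 r.1) hτ0 hp1 k).trans ?_
        -- With n = |supp|, the single term i = n + 1 already equals the bound: exp(1 - i) (i e)^n =
        -- (n + 1)^n. Introducing the sum over `i` frees the weight from its dependence on |supp|,
        -- and for fixed `i` the sum over `k` factorises.
        refine le_trans (le_of_eq ?_)
          ((hsummable k).le_tsum ((rowSupport k).card + 1) fun i _ => hnonneg i k)
        have e : ∀ r : Fin s × Fin α, (((rowSupport k).card + 1 : ℕ) : ℝ) * Real.exp 1 * β r.1 ^ p *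
            (τ ^ p) ^ rowTop (fun a => k (r, a)) =
            ((((rowSupport k).card + 1 : ℕ) : ℝ) * Real.exp 1) *
              (β r.1 ^ p * (τ ^ p) ^ rowTop (fun a => k (r, a))) := fun r => by ring
        simp only [e]
        rw [Finset.prod_mul_distrib (f := fun _ => (((rowSupport k).card + 1 : ℕ) : ℝ) * Real.exp 1),
          Finset.prod_const, mul_pow, ← Real.exp_nat_mul, ← mul_assoc,
          mul_comm (_ ^ _) (Real.exp _), ← mul_assoc, ← Real.exp_add]
        push_cast
        rw [show (1 : ℝ) - ((rowSupport k).card + 1) + (rowSupport k).card * 1 = 0 by ring,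
          Real.exp_zero, one_mul]
    _ = ∑' i : ℕ, ∑ k : (Fin s × Fin α) × Fin m → ZMod b, Real.exp (1 - i) *
        ∏ r ∈ rowSupport k,
          (i * Real.exp 1 * β r.1 ^ p * (τ ^ p) ^ rowTop (fun a => k (r, a))) :=
        (Summable.tsum_finsetSum fun k _ => hsummable k).symm
    _ ≤ _ := (Summable.tsum_le_tsum hterm (summable_sum fun k _ => hsummable k) hS).trans hle

/-- Averaging over all generating vectors: some dual space has small total weight. -/
theorem exists_sum_dual_le {R : Type*} [Fintype R] [DecidableEq R] {m : ℕ} (hm : 1 ≤ m)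
    {P : (ZMod b)[X]} (hP : Irreducible P) (hdeg : P.natDegree = m)
    {w : (R × Fin m → ZMod b) → ℝ} (hw : ∀ k, 0 ≤ w k) {p : ℝ} (hp0 : 0 < p) (hp1 : p ≤ 1) {C : ℝ}
    (hC : ∑ k, w k ^ p ≤ C) :
    ∃ κ : R → GenRow b m, ∑ k ∈ Finset.univ.erase (0 : R × Fin m → ZMod b),
      w k * ‖((Finset.range (b ^ m)).card : ℂ)⁻¹ * ∑ n ∈ Finset.range (b ^ m),
        digitChar k (latticeDigits m P (fun r => rowPoly (κ r).1) n)‖ ≤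
      (2 * C) ^ (1 / p) * ((b : ℝ) ^ m) ^ (-(1 / p)) := by
  classical
  have hb2 : 2 ≤ b := (Fact.out : b.Prime).two_le
  have hbm : 2 ≤ b ^ m := hb2.trans (Nat.le_self_pow (by omega) b)
  have hbmR : (2 : ℝ) ≤ (b : ℝ) ^ m := by exact_mod_cast hbm
  have hwp : ∀ k, 0 ≤ w k ^ p := fun k => Real.rpow_nonneg (hw k) p
  have hC0 : 0 ≤ C := (Finset.sum_nonneg fun k _ => hwp k).trans hC
  let good : (R → GenRow b m) → (R × Fin m → ZMod b) → Prop := fun κ k =>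
    P ∣ ∑ r, rowPoly (fun a => k (r, a)) * rowPoly (κ r).1
  -- The proportion 1 / (b^m - 1) is at most 2 / b^m, as b^m ≥ 2.
  have hcount : ∀ k ∈ Finset.univ.erase (0 : R × Fin m → ZMod b),
      ((Finset.univ.filter fun κ => good κ k).card : ℝ) ≤
        Fintype.card (R → GenRow b m) * (2 / (b : ℝ) ^ m) := fun k hk => by
    have h := card_dvd_mul_le hm hP hdeg (Finset.ne_of_mem_erase hk)
      (Finset.univ.filter fun κ => good κ k) fun κ hκ => (Finset.mem_filter.1 hκ).2
    have h' : ((Finset.univ.filter fun κ => good κ k).card : ℝ) * ((b : ℝ) ^ m - 1) ≤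
        Fintype.card (R → GenRow b m) := by
      have := (Nat.cast_le (α := ℝ)).2 h
      rwa [Nat.cast_mul, Nat.cast_sub (by omega), Nat.cast_pow, Nat.cast_one] at this
    rw [mul_div_assoc', le_div_iff₀ (by positivity)]
    have := Nat.cast_nonneg (α := ℝ) (Finset.univ.filter fun κ => good κ k).card
    nlinarith
  have hne : (Finset.univ : Finset (R → GenRow b m)).Nonempty := by
    rw [Finset.univ_nonempty_iff]
    have : Nonempty (GenRow b m) := by
      rw [← Fintype.card_pos_iff, card_genRow]
      omega
    infer_instance
  -- Some vector is no worse than the average of the p-th power sums over the dual.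
  obtain ⟨κ, -, hκ⟩ : ∃ κ ∈ (Finset.univ : Finset (R → GenRow b m)),
      ∑ k ∈ Finset.univ.erase (0 : R × Fin m → ZMod b), (if good κ k then w k ^ p else 0) ≤
        C * (2 / (b : ℝ) ^ m) := by
    refine Finset.exists_le_of_sum_le hne ?_
    rw [Finset.sum_comm, Finset.sum_const, nsmul_eq_mul, Finset.card_univ]
    calc _ = ∑ k ∈ Finset.univ.erase (0 : R × Fin m → ZMod b),
          ((Finset.univ.filter fun κ => good κ k).card : ℝ) * w k ^ p := by
          refine Finset.sum_congr rfl fun k _ => ?_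
          rw [← Finset.sum_filter, Finset.sum_const, nsmul_eq_mul]
      _ ≤ ∑ k ∈ Finset.univ.erase (0 : R × Fin m → ZMod b),
          Fintype.card (R → GenRow b m) * (2 / (b : ℝ) ^ m) * w k ^ p :=
          Finset.sum_le_sum fun k hk => mul_le_mul_of_nonneg_right (hcount k hk) (hwp k)
      _ ≤ Fintype.card (R → GenRow b m) * (2 / (b : ℝ) ^ m) * C := by
          rw [← Finset.mul_sum]
          gcongr
          exact (Finset.sum_le_sum_of_subset_of_nonneg (Finset.erase_subset _ _)
            fun k _ _ => hwp k).trans hC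
      _ = _ := by ring
  refine ⟨κ, ?_⟩
  have hstep : ∑ k ∈ Finset.univ.erase (0 : R × Fin m → ZMod b),
      w k * ‖((Finset.range (b ^ m)).card : ℂ)⁻¹ * ∑ n ∈ Finset.range (b ^ m),
        digitChar k (latticeDigits m P (fun r => rowPoly (κ r).1) n)‖ ≤
      ∑ k ∈ Finset.univ.erase (0 : R × Fin m → ZMod b), (if good κ k then w k else 0) := by
    refine Finset.sum_le_sum fun k _ => ?_
    split_ifs with hg
    · refine mul_le_of_le_one_right (hw k) ?_
      rw [norm_mul, norm_inv, Complex.norm_natCast, Finset.card_range, inv_mul_le_iff₀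
        (by positivity), mul_one]
      refine (norm_sum_le _ _).trans (le_of_eq ?_)
      simp [norm_digitChar]
    · have h0 : ∑ n ∈ Finset.range (b ^ m),
          digitChar k (latticeDigits m P (fun r => rowPoly (κ r).1) n) = 0 := by
        by_contra hne
        exact hg (dvd_of_sum_digitChar_ne_zero hP.ne_zero hdeg _ k hne)
      rw [h0, mul_zero, norm_zero, mul_zero]
  refine hstep.trans ?_
  have hnn : ∀ k, 0 ≤ if good κ k then w k else 0 := fun k => by
    split_ifs
    · exact hw k
    · exact le_rfl
  have hsum0 : 0 ≤ ∑ k ∈ Finset.univ.erase (0 : R × Fin m → ZMod b),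
      (if good κ k then w k else 0) := Finset.sum_nonneg fun k _ => hnn k
  have hpow : (∑ k ∈ Finset.univ.erase (0 : R × Fin m → ZMod b),
      (if good κ k then w k else 0)) ^ p ≤ C * (2 / (b : ℝ) ^ m) := by
    refine (rpow_sum_le _ hnn hp0 hp1).trans (le_trans (le_of_eq ?_) hκ)
    refine Finset.sum_congr rfl fun k _ => ?_
    split_ifs
    · rfl
    · exact Real.zero_rpow hp0.ne'
  calc _ = ((∑ k ∈ Finset.univ.erase (0 : R × Fin m → ZMod b),
      (if good κ k then w k else 0)) ^ p) ^ (1 / p) := by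
        rw [← Real.rpow_mul hsum0, mul_one_div_cancel hp0.ne', Real.rpow_one]
    _ ≤ (C * (2 / (b : ℝ) ^ m)) ^ (1 / p) :=
        Real.rpow_le_rpow (Real.rpow_nonneg hsum0 p) hpow (by positivity)
    _ = _ := by
        rw [show C * (2 / (b : ℝ) ^ m) = 2 * C * ((b : ℝ) ^ m)⁻¹ by ring,
          Real.mul_rpow (by positivity) (by positivity), Real.inv_rpow (by positivity),
          Real.rpow_neg (by positivity)]

end Existence

/-! ### The midpoint rule on a uniform grid. -/

section Grid

/-- The index of the cell of the uniform grid with `M` cells that contains `x ∈ [-1/2, 1/2)`. -/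
noncomputable def cellIndex (M : ℕ) [NeZero M] (x : ℝ) : Fin M := Fin.ofNat M ⌊(x + 1 / 2) * M⌋₊

/-- The midpoint of a cell of the uniform grid. -/
noncomputable def cellMid (M : ℕ) (k : ℕ) : ℝ := (k + 1 / 2) / M - 1 / 2

variable {M : ℕ} [NeZero M]

theorem measurable_cellIndex : Measurable (cellIndex M) :=
  (measurable_of_countable (Fin.ofNat M)).comp
    (Nat.measurable_floor.comp ((measurable_id.add_const _).mul_const _))

theorem cellIndex_eq_iff {x : ℝ} (hx : x ∈ Ico (-1 / 2 : ℝ) (1 / 2)) (k : Fin M) :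
    cellIndex M x = k ↔ x ∈ Ico ((k : ℝ) / M - 1 / 2) (((k : ℝ) + 1) / M - 1 / 2) := by
  have hM : (0 : ℝ) < M := Nat.cast_pos.2 (NeZero.pos M)
  have h0 : 0 ≤ (x + 1 / 2) * M := mul_nonneg (by linarith [hx.1]) hM.le
  have hlt : ⌊(x + 1 / 2) * M⌋₊ < M := by
    rw [Nat.floor_lt h0]
    nlinarith [hx.2]
  rw [Fin.ext_iff, cellIndex, Fin.val_ofNat, Nat.mod_eq_of_lt hlt, Nat.floor_eq_iff h0, mem_Ico,
    sub_le_iff_le_add, div_le_iff₀ hM, lt_sub_iff_add_lt, lt_div_iff₀ hM]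

theorem uniformMeasure_eq_restrict_Ico :
    uniformMeasure = volume.restrict (Ico (-1 / 2 : ℝ) (1 / 2)) :=
  (Measure.restrict_congr_set Ico_ae_eq_Icc).symm

theorem uniformMeasure_cell (k : Fin M) :
    uniformMeasure (cellIndex M ⁻¹' {k}) = ENNReal.ofReal ((M : ℝ)⁻¹) := by
  have hM : (0 : ℝ) < M := Nat.cast_pos.2 (NeZero.pos M)
  rw [uniformMeasure_eq_restrict_Ico,
    Measure.restrict_apply (measurable_cellIndex (measurableSet_singleton k))]
  have h : cellIndex M ⁻¹' {k} ∩ Ico (-1 / 2 : ℝ) (1 / 2) =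
      Ico ((k : ℝ) / M - 1 / 2) (((k : ℝ) + 1) / M - 1 / 2) := by
    ext x
    simp only [mem_inter_iff, mem_preimage, mem_singleton_iff]
    constructor
    · rintro ⟨h1, h2⟩
      exact (cellIndex_eq_iff h2 k).1 h1
    · intro h1
      have hk : ((k : ℝ) + 1) / M ≤ 1 := by
        rw [div_le_one hM]
        exact_mod_cast k.2
      have hk0 : 0 ≤ (k : ℝ) / M := by positivity
      have h2 : x ∈ Ico (-1 / 2 : ℝ) (1 / 2) := ⟨by linarith [h1.1], by linarith [h1.2]⟩
      exact ⟨(cellIndex_eq_iff h2 k).2 h1, h2⟩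
  rw [h, Real.volume_Ico]
  congr 1
  field_simp
  ring

/-- The right endpoint 1/2 would wrap around to cell 0 in `cellIndex`; it is discarded as a null
set. -/
theorem ae_mem_Ico : ∀ᵐ y ∂paramMeasure, ∀ j, y j ∈ Ico (-1 / 2 : ℝ) (1 / 2) := by
  refine ae_all_iff.2 fun j => ?_
  have h := (measurePreserving_eval_infinitePi (fun _ : ℕ => uniformMeasure) j).quasiMeasurePreserving
  refine h.ae ?_
  rw [uniformMeasure_eq_restrict_Ico]
  exact ae_restrict_mem measurableSet_Ico

theorem paramMeasure_cells (s : ℕ) (k : Fin s → Fin M) :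
    paramMeasure ((fun (y : ℕ → ℝ) (j : Fin s) => cellIndex M (y j)) ⁻¹' {k}) =
      ENNReal.ofReal ((M : ℝ)⁻¹) ^ s := by
  have h : (fun (y : ℕ → ℝ) (j : Fin s) => cellIndex M (y j)) ⁻¹' {k} =
      (↑(Finset.range s) : Set ℕ).pi fun j =>
        if h : j < s then cellIndex M ⁻¹' {k ⟨j, h⟩} else univ := by
    ext y
    simp only [mem_preimage, mem_singleton_iff, Set.mem_pi, Finset.coe_range, mem_Iio]
    constructor
    · intro hy j hj
      rw [dif_pos hj]
      exact congrFun hy ⟨j, hj⟩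
    · intro hy
      ext1 j
      have := hy j j.2
      rw [dif_pos j.2] at this
      exact this
  rw [h, paramMeasure, Measure.infinitePi_pi]
  · rw [Finset.prod_congr rfl (g := fun _ => ENNReal.ofReal ((M : ℝ)⁻¹))]
    · simp
    · intro j hj
      rw [dif_pos (Finset.mem_range.1 hj), uniformMeasure_cell]
  · intro j hj
    rw [dif_pos (Finset.mem_range.1 hj)]
    exact measurable_cellIndex (measurableSet_singleton _)

theorem integral_cells (s : ℕ) (H : (Fin s → Fin M) → ℝ) :
    ∫ y, H (fun j => cellIndex M (y j)) ∂paramMeasure =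
      ((M : ℝ) ^ s)⁻¹ * ∑ k, H k := by
  have hmeas : Measurable fun (y : ℕ → ℝ) (j : Fin s) => cellIndex M (y j) :=
    measurable_pi_lambda _ fun j => measurable_cellIndex.comp (measurable_pi_apply _)
  have : IsProbabilityMeasure
      (paramMeasure.map fun (y : ℕ → ℝ) (j : Fin s) => cellIndex M (y j)) :=
    Measure.isProbabilityMeasure_map hmeas.aemeasurable
  rw [← integral_map (φ := fun (y : ℕ → ℝ) (j : Fin s) => cellIndex M (y j)) (f := H)
    hmeas.aemeasurable (measurable_of_countable H).aestronglyMeasurable,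
    integral_fintype (Integrable.of_finite), Finset.mul_sum]
  refine Finset.sum_congr rfl fun k _ => ?_
  rw [measureReal_def, Measure.map_apply hmeas (measurableSet_singleton k), paramMeasure_cells,
    ENNReal.toReal_pow, ENNReal.toReal_ofReal (by positivity), inv_pow, smul_eq_mul]

theorem cellMid_mem (k : Fin M) : cellMid M k ∈ Icc (-1 / 2 : ℝ) (1 / 2) := by
  have hM : (0 : ℝ) < M := Nat.cast_pos.2 (NeZero.pos M)
  have h : ((k : ℝ) + 1 / 2) / M ≤ 1 := by
    rw [div_le_one hM]
    have : ((k : ℕ) : ℝ) + 1 ≤ M := by exact_mod_cast k.2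
    linarith
  have h0 : 0 ≤ ((k : ℝ) + 1 / 2) / M := by positivity
  exact ⟨by rw [cellMid]; linarith, by rw [cellMid]; linarith⟩

theorem abs_sub_cellMid_le {x : ℝ} (hx : x ∈ Ico (-1 / 2 : ℝ) (1 / 2)) :
    |x - cellMid M (cellIndex M x)| ≤ (M : ℝ)⁻¹ := by
  have hM : (0 : ℝ) < M := Nat.cast_pos.2 (NeZero.pos M)
  have h := (cellIndex_eq_iff hx (cellIndex M x)).1 rfl
  have h1 := h.1
  have h2 := h.2
  rw [add_div] at h2
  have h3 : (0 : ℝ) < (M : ℝ)⁻¹ := by positivity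
  rw [one_div] at h2
  rw [cellMid, add_div, show (1 / 2 : ℝ) / M = (M : ℝ)⁻¹ / 2 by ring, abs_le]
  constructor <;> linarith

theorem extendZero_mem {s : ℕ} {y : Fin s → ℝ} (hy : ∀ j, y j ∈ Icc (-1 / 2 : ℝ) (1 / 2)) :
    extendZero y ∈ paramDomain := by
  intro j
  unfold extendZero
  split_ifs
  · exact hy _
  · norm_num

theorem abs_extendZero_sub_le {s : ℕ} {y z : Fin s → ℝ} {ε : ℝ} (hε : 0 ≤ ε)
    (h : ∀ j, |y j - z j| ≤ ε) (j : ℕ) : |extendZero y j - extendZero z j| ≤ ε := by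
  unfold extendZero
  split_ifs
  · exact h _
  · simpa using hε

theorem truncParam_eq_extendZero (s : ℕ) (y : ℕ → ℝ) :
    truncParam s y = extendZero fun j : Fin s => y j := by
  ext j
  simp [truncParam, extendZero]

variable {X : Type*} [NormedAddCommGroup X] [NormedSpace ℝ X] [CompleteSpace X]
  {B : ℕ → X →L[ℝ] X} {ρ : ℝ}

/-- The composite midpoint rule. -/
theorem abs_integral_truncParam_sub_grid_le (hB : Summable fun j => ‖B j‖)
    (hρ : (∑' j, ‖B j‖) / 2 ≤ ρ) (hρ1 : ρ < 1) (G : StrongDual ℝ X) (v : X) (s : ℕ) :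
    |∫ y, G (resolvent B (truncParam s y) v) ∂paramMeasure -
      ((M : ℝ) ^ s)⁻¹ * ∑ k : Fin s → Fin M,
        G (resolvent B (extendZero fun j => cellMid M (k j)) v)| ≤
      ‖G‖ * ‖v‖ * (((1 - ρ)⁻¹) ^ 2 * (2 * ρ * (M : ℝ)⁻¹)) := by
  set H : (Fin s → Fin M) → ℝ := fun k => G (resolvent B (extendZero fun j => cellMid M (k j)) v)
  have hmeas : Measurable fun (y : ℕ → ℝ) (j : Fin s) => cellIndex M (y j) :=
    measurable_pi_lambda _ fun j => measurable_cellIndex.comp (measurable_pi_apply _)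
  have hint := integrable_functional_resolvent_truncParam hB hρ hρ1 G v s
  have hbound : ∀ᵐ y ∂paramMeasure, ‖G (resolvent B (truncParam s y) v) -
      H (fun j => cellIndex M (y j))‖ ≤ ‖G‖ * ‖v‖ * (((1 - ρ)⁻¹) ^ 2 * (2 * ρ * (M : ℝ)⁻¹)) := by
    filter_upwards [ae_mem_Ico] with y hy
    rw [truncParam_eq_extendZero, Real.norm_eq_abs]
    refine abs_functional_sub_le hB hρ hρ1 G v (extendZero_mem fun j => Ico_subset_Icc_self (hy j))
      (extendZero_mem fun j => cellMid_mem _)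
      (abs_extendZero_sub_le (by positivity) fun j => abs_sub_cellMid_le (hy j))
  have hintH : Integrable (fun y => H (fun j : Fin s => cellIndex M (y j))) paramMeasure := by
    obtain ⟨K, hK⟩ := (Set.finite_range fun k => ‖H k‖).bddAbove
    exact Integrable.of_bound ((measurable_of_countable H).comp hmeas).aestronglyMeasurable K
      (ae_of_all _ fun y => hK ⟨_, rfl⟩)
  rw [← integral_cells s H, ← integral_sub hint hintH]
  have h := norm_integral_le_of_norm_le_const hbound
  rwa [probReal_univ, mul_one] at h

end Grid

/-! ### Digit vectors as grid cells. -/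

section Digits

variable {b : ℕ} [Fact b.Prime]

theorem sum_digit_positions {E : Type*} [AddCommMonoid E] (α m : ℕ) (f : ℕ → E) :
    ∑ c : Fin α, ∑ a : Fin m, f ((c : ℕ) + α * a) = ∑ i ∈ Finset.range (m * α), f i := by
  rw [Finset.sum_range, ← finProdFinEquiv.sum_comp, Fintype.sum_prod_type, Finset.sum_comm]
  rfl

theorem sum_sub_one_div_pow (n : ℕ) :
    ∑ i ∈ Finset.range n, ((b : ℝ) - 1) / (b : ℝ) ^ (i + 1) = 1 - ((b : ℝ) ^ n)⁻¹ := by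
  have hb : (b : ℝ) ≠ 0 := by exact_mod_cast (Fact.out : b.Prime).ne_zero
  induction n with
  | zero => simp
  | succ n ih =>
    rw [Finset.sum_range_succ, ih, pow_succ]
    field_simp
    ring

/-- The numbers with given interlaced digits. -/
noncomputable def digitValue {α m s : ℕ} (ξ : (Fin s × Fin α) × Fin m → ZMod b) (j : Fin s) : ℝ :=
  ∑ c : Fin α, ∑ a : Fin m, ((ξ ((j, c), a)).val : ℝ) / (b : ℝ) ^ ((c : ℕ) + 1 + a * α)

/-- Digit vectors of the `s` coordinates enumerate the cells of the grid with `b ^ (m α)` cells in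
each direction. -/
theorem exists_digitEquiv (α m s : ℕ) :
    ∃ e : ((Fin s × Fin α) × Fin m → ZMod b) ≃ (Fin s → Fin (b ^ (m * α))),
      ∀ ξ j, ((e ξ j : ℕ) : ℝ) = digitValue ξ j * (b : ℝ) ^ (m * α) := by
  have hb : (b : ℝ) ≠ 0 := by exact_mod_cast (Fact.out : b.Prime).ne_zero
  let ez : ZMod b ≃ Fin b := (Equiv.ofBijective _ natCast_fin_bijective).symm
  have hez : ∀ x, ((ez x : Fin b) : ℕ) = x.val := fun x => by
    obtain ⟨d, rfl⟩ := ez.symm.surjective x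
    rw [Equiv.apply_symm_apply]
    exact (ZMod.val_cast_of_lt d.2).symm
  -- The order is reversed because `finFunctionFinEquiv` puts the least significant digit first,
  -- whereas interlaced digits start with the most significant one.
  let pos : Fin α × Fin m ≃ Fin (m * α) :=
    ((Equiv.prodComm _ _).trans finProdFinEquiv).trans Fin.revPerm
  let e : ((Fin s × Fin α) × Fin m → ZMod b) ≃ (Fin s → Fin (b ^ (m * α))) :=
    ((Equiv.arrowCongr ((Equiv.prodAssoc _ _ _).trans
      ((Equiv.refl (Fin s)).prodCongr pos)) ez).trans (Equiv.curry _ _ _)).trans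
      (Equiv.piCongrRight fun _ => finFunctionFinEquiv)
  refine ⟨e, fun ξ j => ?_⟩
  have h1 : (e ξ j : ℕ) = ∑ i : Fin (m * α),
      (ξ ((j, (pos.symm i).1), (pos.symm i).2)).val * b ^ (i : ℕ) := by
    change ((finFunctionFinEquiv fun i : Fin (m * α) =>
      ez (ξ ((j, (pos.symm i).1), (pos.symm i).2)) : Fin (b ^ (m * α))) : ℕ) = _
    rw [finFunctionFinEquiv_apply]
    simp only [hez]
  rw [h1, ← pos.sum_comp, Fintype.sum_prod_type, digitValue, Finset.sum_mul]
  push_cast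
  refine Finset.sum_congr rfl fun c _ => ?_
  rw [Finset.sum_mul]
  refine Finset.sum_congr rfl fun a _ => ?_
  rw [Equiv.symm_apply_apply]
  have h2 : ((pos (c, a) : Fin (m * α)) : ℕ) + (c + 1 + a * α) = m * α := by
    change ((Fin.rev (finProdFinEquiv (a, c)) : Fin (m * α)) : ℕ) + _ = _
    have := (finProdFinEquiv (a, c)).2
    rw [Fin.val_rev, finProdFinEquiv_apply_val] at *
    simp only at *
    rw [mul_comm (a : ℕ) α]
    omega
  have h3 : (b : ℝ) ^ (m * α) = (b : ℝ) ^ (pos (c, a) : ℕ) * (b : ℝ) ^ ((c : ℕ) + 1 + a * α) := by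
    rw [← pow_add, h2]
  rw [h3]
  field_simp

end Digits

/-! ### The quadrature error of interlaced rules. -/

section QMC

variable {b : ℕ} [Fact b.Prime]

/-- The centred and normalised digit. -/
noncomputable def centredDigit (d : ZMod b) : ℝ := (d.val - ((b : ℝ) - 1) / 2) / (((b : ℝ) - 1) / 2)

theorem two_le_cast : (2 : ℝ) ≤ b := by exact_mod_cast (Fact.out : b.Prime).two_le

theorem abs_centredDigit_le (d : ZMod b) : |centredDigit d| ≤ 1 := by
  have hb := two_le_cast (b := b)
  have hd : ((d.val : ℕ) : ℝ) + 1 ≤ b := by exact_mod_cast ZMod.val_lt d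
  have h0 : (0 : ℝ) ≤ d.val := Nat.cast_nonneg _
  rw [centredDigit, abs_div, abs_of_pos (show (0 : ℝ) < ((b : ℝ) - 1) / 2 by linarith),
    div_le_one (by linarith), abs_le]
  constructor <;> linarith

variable {α m s : ℕ}

/-- The size of the contribution of a digit. -/
noncomputable def letterSize (b : ℕ) (l : (Fin s × Fin α) × Fin m) : ℝ :=
  (((b : ℝ) - 1) / 2) / (b : ℝ) ^ ((l.1.2 : ℕ) + 1 + l.2 * α)

theorem letterSize_nonneg (l : (Fin s × Fin α) × Fin m) : 0 ≤ letterSize b l := by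
  have hb := two_le_cast (b := b)
  exact div_nonneg (by linarith) (by positivity)

/-- Only the depth in the row is kept: each step down a row passes α interlaced digits and gains
b^(-α). -/
theorem letterSize_le (l : (Fin s × Fin α) × Fin m) :
    letterSize b l ≤ (((b : ℝ) ^ α)⁻¹) ^ (l.2 : ℕ) := by
  have hb := two_le_cast (b := b)
  have hb0 : (0 : ℝ) < b := by linarith
  rw [letterSize, inv_pow, ← pow_mul, pow_add, pow_add, pow_one, mul_comm (l.2 : ℕ) α, div_le_iff₀
    (by positivity), mul_comm _ ((b : ℝ) ^ (α * (l.2 : ℕ))), inv_mul_cancel_left₀ (by positivity)]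
  have h1 : (1 : ℝ) ≤ (b : ℝ) ^ (l.1.2 : ℕ) := one_le_pow₀ (by linarith)
  nlinarith

/-- Interlacing enumerates all positions once, so this is a geometric sum. Its value is exactly the
shift that takes the lower corners of cells to centred midpoints. -/
theorem sum_letterSize (j : Fin s) :
    ∑ c : Fin α, ∑ a : Fin m, letterSize b ((j, c), a) = (1 - ((b : ℝ) ^ (m * α))⁻¹) / 2 := by
  rw [← sum_sub_one_div_pow, ← sum_digit_positions α m fun i => ((b : ℝ) - 1) / (b : ℝ) ^ (i + 1),
    Finset.sum_div]
  refine Finset.sum_congr rfl fun c _ => ?_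
  rw [Finset.sum_div]
  refine Finset.sum_congr rfl fun a _ => ?_
  rw [letterSize, mul_comm α (a : ℕ), add_right_comm, div_right_comm]

theorem cellMid_digitValue {e : ((Fin s × Fin α) × Fin m → ZMod b) ≃ (Fin s → Fin (b ^ (m * α)))}
    (he : ∀ ξ j, ((e ξ j : ℕ) : ℝ) = digitValue ξ j * (b : ℝ) ^ (m * α))
    (ξ : (Fin s × Fin α) × Fin m → ZMod b) (j : Fin s) :
    cellMid (b ^ (m * α)) (e ξ j) =
      digitValue ξ j - 1 / 2 + ((b : ℝ) ^ (m * α))⁻¹ / 2 := by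
  have hb := two_le_cast (b := b)
  have hM : (0 : ℝ) < (b : ℝ) ^ (m * α) := by positivity
  rw [cellMid, he]
  push_cast
  field_simp
  ring

variable {X : Type*} [NormedAddCommGroup X] [NormedSpace ℝ X]

/-- The operator coefficient of a digit. -/
noncomputable def letterOp (b : ℕ) (B : ℕ → X →L[ℝ] X) (l : (Fin s × Fin α) × Fin m) : X →L[ℝ] X :=
  letterSize b l • B l.1.1

theorem norm_letterOp (B : ℕ → X →L[ℝ] X) (l : (Fin s × Fin α) × Fin m) :
    ‖letterOp b B l‖ = letterSize b l * ‖B l.1.1‖ := by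
  rw [letterOp, norm_smul, Real.norm_eq_abs, abs_of_nonneg (letterSize_nonneg l)]

/-- Centring the digits keeps the total letter size within the bound for ‖T(y)‖ on U, so κ < 2 still
makes the digitwise Neumann series converge. -/
theorem sum_norm_letterOp_le {B : ℕ → X →L[ℝ] X} (hB : Summable fun j => ‖B j‖) :
    ∑ l : (Fin s × Fin α) × Fin m, ‖letterOp b B l‖ ≤ (∑' j, ‖B j‖) / 2 := by
  have hb := two_le_cast (b := b)
  calc ∑ l : (Fin s × Fin α) × Fin m, ‖letterOp b B l‖
      = ∑ j : Fin s, (∑ c : Fin α, ∑ a : Fin m, letterSize b ((j, c), a)) * ‖B j‖ := by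
        simp only [norm_letterOp, Fintype.sum_prod_type, Finset.sum_mul]
    _ ≤ ∑ j : Fin s, 1 / 2 * ‖B j‖ := by
        refine Finset.sum_le_sum fun j _ => ?_
        gcongr
        rw [sum_letterSize]
        have : 0 < ((b : ℝ) ^ (m * α))⁻¹ := by positivity
        linarith
    _ = (∑ j ∈ Finset.range s, ‖B j‖) / 2 := by
        rw [← Finset.mul_sum, Finset.sum_range]; ring
    _ ≤ _ := by
        gcongr
        exact hB.sum_le_tsum _ fun _ _ => norm_nonneg _

theorem fluctuation_extendZero (B : ℕ → X →L[ℝ] X) (y : Fin s → ℝ) :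
    fluctuation B (extendZero y) = ∑ j : Fin s, y j • B j := by
  rw [fluctuation, tsum_eq_sum (s := Finset.range s), Finset.sum_range]
  · refine Finset.sum_congr rfl fun j _ => ?_
    simp [extendZero]
  · intro j hj
    rw [extendZero, dif_neg (by simpa using hj), zero_smul]

theorem digitSum_letterOp (B : ℕ → X →L[ℝ] X) (ξ : (Fin s × Fin α) × Fin m → ZMod b) :
    digitSum (fun _ => centredDigit) (letterOp b B) ξ = fluctuation B (extendZero fun j =>
      digitValue ξ j - 1 / 2 + ((b : ℝ) ^ (m * α))⁻¹ / 2) := by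
  have hb := two_le_cast (b := b)
  rw [fluctuation_extendZero, digitSum, Fintype.sum_prod_type, Fintype.sum_prod_type]
  refine Finset.sum_congr rfl fun j _ => ?_
  have e : digitValue ξ j - 1 / 2 + ((b : ℝ) ^ (m * α))⁻¹ / 2 =
      ∑ c : Fin α, ∑ a : Fin m, centredDigit (ξ ((j, c), a)) * letterSize b ((j, c), a) := by
    have h1 := sum_letterSize (b := b) (α := α) (m := m) j
    have h2 : digitValue ξ j - 1 / 2 + ((b : ℝ) ^ (m * α))⁻¹ / 2 =
        digitValue ξ j - ∑ c : Fin α, ∑ a : Fin m, letterSize b ((j, c), a) := by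
      rw [h1]; ring
    rw [h2, digitValue]
    simp only [← Finset.sum_sub_distrib]
    refine Finset.sum_congr rfl fun c _ => Finset.sum_congr rfl fun a _ => ?_
    have hb1 : (b : ℝ) - 1 ≠ 0 := by linarith
    rw [centredDigit, letterSize]
    field_simp
  rw [e, Finset.sum_smul]
  refine Finset.sum_congr rfl fun c _ => ?_
  rw [Finset.sum_smul]
  refine Finset.sum_congr rfl fun a _ => ?_
  rw [letterOp, smul_smul]

variable [CompleteSpace X]

/-- From each nonzero row of `k` the last nonzero digit is selected, since its letter has the best
size bound. -/
theorem norm_digitCoeff_le_dualWeight (hm : 1 ≤ m) {B : ℕ → X →L[ℝ] X} (hB : Summable fun j => ‖B j‖) {ρ : ℝ}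
    (hρ : (∑' j, ‖B j‖) / 2 ≤ ρ) {δ : ℝ} (hδ : 0 < δ) (hρδ : ρ + δ < 1) (G : StrongDual ℝ X) (v : X)
    (k : (Fin s × Fin α) × Fin m → ZMod b) :
    ‖digitCoeff (fun ξ => ((G (Ring.inverse (1 + digitSum (fun _ => centredDigit)
      (letterOp b B) ξ) v) : ℝ) : ℂ)) k‖ ≤
      ‖G‖ * ‖v‖ * (1 - (ρ + δ))⁻¹ *
        dualWeight (fun r => ‖B r.1‖ / δ) (((b : ℝ) ^ α)⁻¹) k := by
  have hb := two_le_cast (b := b)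
  have htop : ∀ r : Fin s × Fin α, ∃ a : Fin m, r ∈ rowSupport k →
      k (r, a) ≠ 0 ∧ (a : ℕ) = rowTop (fun a => k (r, a)) := fun r => by
    by_cases hr : r ∈ rowSupport k
    · obtain ⟨a, ha⟩ := exists_rowTop (Finset.mem_filter.1 hr).2
      exact ⟨a, fun _ => ha⟩
    -- A dummy position for rows outside the support; this is where m ≥ 1 enters.
    · exact ⟨⟨0, hm⟩, fun h => absurd h hr⟩
  choose t ht using htop
  have hinj : Function.Injective fun r : Fin s × Fin α => (r, t r) := fun r r' h =>
    congrArg Prod.fst h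
  have h := norm_digitCoeff_inverse_le (θ := fun _ => centredDigit) (fun _ => abs_centredDigit_le)
    (B := letterOp b B) (a := fun l => ‖letterOp b B l‖) (fun l => le_rfl) hδ
    (x := ρ + δ) (by gcongr; exact (sum_norm_letterOp_le hB).trans hρ) hρδ G v k
    ((rowSupport k).map ⟨_, hinj⟩) (fun l hl => by
      obtain ⟨r, hr, rfl⟩ := Finset.mem_map.1 hl
      exact (ht r hr).1)
  refine h.trans ?_
  have h1 : 0 < 1 - (ρ + δ) := by linarith
  rw [Finset.prod_map, Finset.card_map, dualWeight]
  refine mul_le_mul_of_nonneg_left (Finset.prod_le_prod (fun r _ => by positivity) fun r hr => ?_)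
    (by positivity)
  rw [Function.Embedding.coeFn_mk, norm_letterOp, ← (ht r hr).2]
  calc letterSize b (r, t r) * ‖B r.1‖ * (((rowSupport k).card + 1) / δ)
      ≤ (((b : ℝ) ^ α)⁻¹) ^ (t r : ℕ) * ‖B r.1‖ * (((rowSupport k).card + 1) / δ) :=
        mul_le_mul_of_nonneg_right (mul_le_mul_of_nonneg_right (letterSize_le (b := b) (r, t r))
          (norm_nonneg _)) (by positivity)
    _ = _ := by ring

/-- Existence of good interlaced polynomial lattice rules for affine-parametric resolvents. -/
theorem exists_interlaced_rule {B : ℕ → X →L[ℝ] X} (hB : Summable fun j => ‖B j‖) {ρ : ℝ}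
    (hρ : (∑' j, ‖B j‖) / 2 ≤ ρ) (hρ1 : ρ < 1) {p : ℝ} (hp0 : 0 < p) (hp1 : p ≤ 1)
    (hs : Summable fun j => ‖B j‖ ^ p) {α : ℕ} (hα : 1 / p < α) :
    ∃ C : ℝ, 0 < C ∧ ∀ s m : ℕ, 1 ≤ m → ∀ P : (ZMod b)[X], Irreducible P → P.natDegree = m →
      ∃ q : Fin s → Fin α → (ZMod b)[X], (∀ j k, q j k ∈ genPolys b m) ∧
        (∀ n, extendZero (fun j => interlacedPoint b α m s P q n j - 1 / 2) ∈ paramDomain) ∧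
        ∀ (G : StrongDual ℝ X) (v : X),
          |∫ y, G (resolvent B (truncParam s y) v) ∂paramMeasure -
            qmcRule b α m s P q (fun y => G (resolvent B y v))| ≤
          C * ‖G‖ * ‖v‖ * ((b : ℝ) ^ m) ^ (-(1 / p)) := by
  have hb := two_le_cast (b := b)
  have hb0 : (0 : ℝ) < b := by linarith
  have hρ0 : 0 ≤ ρ := le_trans (by positivity) hρ
  -- Half of the gap is spent on the Cauchy radii; the other half keeps the geometric series
  -- convergent.
  set δ := (1 - ρ) / 2 with hδ
  have hδ0 : 0 < δ := by rw [hδ]; linarith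
  set τ : ℝ := ((b : ℝ) ^ α)⁻¹ with hτ
  have hτ0 : 0 ≤ τ := by positivity
  -- This is α p > 1, the reason for the interlacing order ⌊1/p⌋ + 1.
  have hτ1 : b * τ ^ p < 1 := by
    rw [hτ, Real.inv_rpow (by positivity), ← Real.rpow_natCast_mul hb0.le, mul_inv_lt_iff₀
      (by positivity), one_mul]
    have h1 : 1 < (α : ℝ) * p := by rwa [div_lt_iff₀ hp0] at hα
    calc (b : ℝ) = (b : ℝ) ^ (1 : ℝ) := (Real.rpow_one _).symm
      _ < _ := Real.rpow_lt_rpow_of_exponent_lt (by linarith) h1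
  have hsδ : Summable fun j => (‖B j‖ / δ) ^ p := by
    have : (fun j => (‖B j‖ / δ) ^ p) = fun j => ‖B j‖ ^ p / δ ^ p := by
      ext j
      rw [Real.div_rpow (norm_nonneg _) hδ0.le]
    rw [this]
    exact hs.div_const _
  obtain ⟨C₁, hC₁, hsum⟩ := exists_sum_dualWeight_rpow_le (b := b) (β := fun j => ‖B j‖ / δ)
    (fun j => by positivity) hp1 hsδ hτ0 hτ1 α
  set L : ℝ := ((1 - ρ)⁻¹) ^ 2 * (2 * ρ) with hL
  have hL0 : 0 ≤ L := by positivity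
  have h1δ : 0 < 1 - (ρ + δ) := by rw [hδ]; linarith
  refine ⟨2 * L + (1 - (ρ + δ))⁻¹ * (2 * C₁) ^ (1 / p), by positivity, fun s m hm P hP hdeg => ?_⟩
  -- The weights involve only the norms ‖B_j‖, so the vector is chosen before `G` and `v`, which
  -- enter the coefficient bound as a common factor.
  obtain ⟨κ, hκ⟩ := exists_sum_dual_le (R := Fin s × Fin α) hm hP hdeg
    (w := dualWeight (fun r => ‖B r.1‖ / δ) τ) (fun k => dualWeight_nonneg (fun r => by positivity)
      hτ0 k) hp0 hp1 (hsum s m)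
  have : NeZero (b ^ (m * α)) := ⟨pow_ne_zero _ (Fact.out : b.Prime).ne_zero⟩
  obtain ⟨e, he⟩ := exists_digitEquiv (b := b) α m s
  set M : ℝ := (b : ℝ) ^ (m * α) with hM
  have hM0 : 0 < M := by positivity
  have hMN : M⁻¹ ≤ ((b : ℝ) ^ m) ^ (-(1 / p)) := by
    rw [Real.rpow_neg (by positivity), hM, pow_mul]
    gcongr
    rw [← Real.rpow_natCast _ α]
    exact Real.rpow_le_rpow_of_exponent_le (one_le_pow₀ (by linarith)) hα.le
  set ξ : ℕ → (Fin s × Fin α) × Fin m → ZMod b :=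
    fun n => latticeDigits m P (fun r => rowPoly (κ r).1) n with hξ
  set q : Fin s → Fin α → (ZMod b)[X] := fun j c => rowPoly (κ (j, c)).1 with hq
  have hpt : ∀ n j, interlacedPoint b α m s P q n j = digitValue (ξ n) j := fun n j =>
    interlacedPoint_eq P q n j
  have hmid : ∀ ξ : (Fin s × Fin α) × Fin m → ZMod b, (extendZero fun j =>
      cellMid (b ^ (m * α)) (e ξ j)) = extendZero fun j => digitValue ξ j - 1 / 2 + M⁻¹ / 2 :=
    fun ξ => by simp only [cellMid_digitValue he]; rfl
  have hdv : ∀ ξ j, digitValue ξ j = (e ξ j : ℕ) / M := fun ξ j => by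
    rw [he, mul_div_cancel_right₀ _ hM0.ne']
  have hdvmem : ∀ (ξ : (Fin s × Fin α) × Fin m → ZMod b) (j : Fin s),
      digitValue ξ j - 1 / 2 ∈ Icc (-1 / 2 : ℝ) (1 / 2) := fun ξ j => by
    have h1 : ((e ξ j : ℕ) : ℝ) / M ≤ 1 := by
      rw [div_le_one hM0, hM]
      exact_mod_cast (e ξ j).2.le
    have h0 : 0 ≤ ((e ξ j : ℕ) : ℝ) / M := by positivity
    rw [hdv]
    constructor <;> linarith
  have hmem : ∀ n, extendZero (fun j => interlacedPoint b α m s P q n j - 1 / 2) ∈ paramDomain :=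
    fun n => extendZero_mem fun j => by rw [hpt]; exact hdvmem _ j
  refine ⟨q, fun j c => rowPoly_mem_genPolys hm (κ (j, c)).2, hmem, fun G v => ?_⟩
  set F : ((Fin s × Fin α) × Fin m → ZMod b) → ℝ := fun ξ =>
    G (Ring.inverse (1 + digitSum (fun _ => centredDigit) (letterOp b B) ξ) v) with hF
  have hFmid : ∀ ξ, F ξ = G (resolvent B (extendZero fun j =>
      cellMid (b ^ (m * α)) (e ξ j)) v) := fun ξ => by
    rw [hmid, resolvent, hF]
    simp only [digitSum_letterOp]
    rfl
  have step1 := abs_integral_truncParam_sub_grid_le (M := b ^ (m * α)) hB hρ hρ1 G v s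
  have hgrid : (((b ^ (m * α) : ℕ) : ℝ) ^ s)⁻¹ * ∑ k : Fin s → Fin (b ^ (m * α)),
      G (resolvent B (extendZero fun j => cellMid (b ^ (m * α)) (k j)) v) =
      (Fintype.card ((Fin s × Fin α) × Fin m → ZMod b) : ℝ)⁻¹ * ∑ ξ, F ξ := by
    rw [Fintype.card_congr e, ← e.sum_comp]
    simp only [hFmid]
    congr 2
    simp
  rw [hgrid] at step1
  have step2 : |((b : ℝ) ^ m)⁻¹ * ∑ n ∈ Finset.range (b ^ m), F (ξ n) -
      (Fintype.card ((Fin s × Fin α) × Fin m → ZMod b) : ℝ)⁻¹ * ∑ ξ, F ξ| ≤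
      ‖G‖ * ‖v‖ * (1 - (ρ + δ))⁻¹ * ((2 * C₁) ^ (1 / p) * ((b : ℝ) ^ m) ^ (-(1 / p))) := by
    have h := norm_average_sub_average_le (Finset.range (b ^ m))
      (Finset.nonempty_range_iff.2 (pow_ne_zero _ (Fact.out : b.Prime).ne_zero)) ξ
      fun ξ => ((F ξ : ℝ) : ℂ)
    have hcast : ((Finset.range (b ^ m)).card : ℂ)⁻¹ * ∑ n ∈ Finset.range (b ^ m), ((F (ξ n) : ℝ) : ℂ)
        - (Fintype.card ((Fin s × Fin α) × Fin m → ZMod b) : ℂ)⁻¹ * ∑ ξ, ((F ξ : ℝ) : ℂ) =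
        ((((b : ℝ) ^ m)⁻¹ * ∑ n ∈ Finset.range (b ^ m), F (ξ n) -
          (Fintype.card ((Fin s × Fin α) × Fin m → ZMod b) : ℝ)⁻¹ * ∑ ξ, F ξ : ℝ) : ℂ) := by
      rw [Finset.card_range]
      push_cast
      rfl
    rw [hcast, Complex.norm_real, Real.norm_eq_abs] at h
    refine h.trans ?_
    calc _ ≤ ∑ k ∈ Finset.univ.erase (0 : (Fin s × Fin α) × Fin m → ZMod b),
          ‖G‖ * ‖v‖ * (1 - (ρ + δ))⁻¹ * (dualWeight (fun r => ‖B r.1‖ / δ) τ k *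
            ‖((Finset.range (b ^ m)).card : ℂ)⁻¹ *
              ∑ n ∈ Finset.range (b ^ m), digitChar k (ξ n)‖) := by
          refine Finset.sum_le_sum fun k _ => ?_
          rw [← mul_assoc]
          gcongr
          exact norm_digitCoeff_le_dualWeight hm hB hρ hδ0 (by linarith) G v k
      _ ≤ _ := by
          rw [← Finset.mul_sum]
          gcongr
  -- The lattice nodes are lower corners of grid cells, while the Fourier bound lives at midpoints;
  -- the shift 1/(2M) in each coordinate is absorbed by the Lipschitz estimate.
  have step3 : |((b : ℝ) ^ m)⁻¹ * ∑ n ∈ Finset.range (b ^ m), F (ξ n) -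
      qmcRule b α m s P q (fun y => G (resolvent B y v))| ≤ ‖G‖ * ‖v‖ * (L * M⁻¹) := by
    rw [qmcRule, one_div, ← mul_sub, ← Finset.sum_sub_distrib, abs_mul,
      abs_of_nonneg (by positivity), inv_mul_le_iff₀ (by positivity)]
    refine (Finset.abs_sum_le_sum_abs _ _).trans ?_
    calc _ ≤ ∑ n ∈ Finset.range (b ^ m), ‖G‖ * ‖v‖ * (L * M⁻¹) := by
          refine Finset.sum_le_sum fun n _ => ?_
          rw [hFmid]
          refine (abs_functional_sub_le hB hρ hρ1 G v (extendZero_mem fun j => cellMid_mem _)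
            (hmem n) (ε := M⁻¹) fun j => ?_).trans (le_of_eq ?_)
          · rw [hmid]
            refine abs_extendZero_sub_le (by positivity) (fun j => ?_) j
            rw [hpt, add_sub_cancel_left, abs_of_nonneg (by positivity)]
            exact half_le_self (by positivity)
          · rw [hL]; ring
      _ = _ := by simp
  have hM' : ((b ^ (m * α) : ℕ) : ℝ) = M := by push_cast; rfl
  rw [hM'] at step1
  calc _ ≤ ‖G‖ * ‖v‖ * (L * M⁻¹) +
      ‖G‖ * ‖v‖ * (1 - (ρ + δ))⁻¹ * ((2 * C₁) ^ (1 / p) * ((b : ℝ) ^ m) ^ (-(1 / p))) +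
      ‖G‖ * ‖v‖ * (L * M⁻¹) := by
        have e1 : ‖G‖ * ‖v‖ * (((1 - ρ)⁻¹) ^ 2 * (2 * ρ * M⁻¹)) = ‖G‖ * ‖v‖ * (L * M⁻¹) := by
          rw [hL]; ring
        rw [e1] at step1
        rw [abs_sub_comm] at step2
        exact (abs_sub_le _ _ _).trans (add_le_add ((abs_sub_le _ _ _).trans
          (add_le_add step1 step2)) step3)
    _ ≤ ‖G‖ * ‖v‖ * (L * ((b : ℝ) ^ m) ^ (-(1 / p))) +
      ‖G‖ * ‖v‖ * (1 - (ρ + δ))⁻¹ * ((2 * C₁) ^ (1 / p) * ((b : ℝ) ^ m) ^ (-(1 / p))) +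
      ‖G‖ * ‖v‖ * (L * ((b : ℝ) ^ m) ^ (-(1 / p))) := by gcongr
    _ = _ := by ring

end QMC

/-! ### The affine-parametric operator and its Galerkin error. -/

section Affine

variable {X Y : Type*} [NormedAddCommGroup X] [NormedSpace ℝ X] [CompleteSpace X]
  [NormedAddCommGroup Y] [NormedSpace ℝ Y]
  {A₀ : X →L[ℝ] StrongDual ℝ Y} {A : ℕ → X →L[ℝ] StrongDual ℝ Y} {ρ : ℝ}

/-- The fluctuation operators preconditioned by the nominal operator. -/
noncomputable def precond (A₀ : X →L[ℝ] StrongDual ℝ Y) (A : ℕ → X →L[ℝ] StrongDual ℝ Y) (j : ℕ) :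
    X →L[ℝ] X := A₀.inverse.comp (A j)

theorem affineOp_eq (hA₀ : A₀.IsInvertible) (hB : Summable fun j => ‖precond A₀ A j‖) {y : ℕ → ℝ}
    (hy : y ∈ paramDomain) :
    affineOp A₀ A y = A₀.comp (1 + fluctuation (precond A₀ A) y) := by
  have hs := summable_smul hB (abs_le_half hy)
  have h1 : A₀.comp (fluctuation (precond A₀ A) y) = ∑' j, y j • A j := by
    have h2 := (ContinuousLinearMap.compL ℝ X X (StrongDual ℝ Y) A₀).map_tsum hs
    refine h2.trans (tsum_congr fun j => ?_)
    rw [map_smul]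
    congr 1
    ext x : 1
    exact hA₀.self_apply_inverse (A j x)
  rw [ContinuousLinearMap.comp_add, h1]
  rfl

theorem affineOp_isInvertible (hA₀ : A₀.IsInvertible)
    (hB : Summable fun j => ‖precond A₀ A j‖) (hρ : (∑' j, ‖precond A₀ A j‖) / 2 ≤ ρ) (hρ1 : ρ < 1)
    {y : ℕ → ℝ} (hy : y ∈ paramDomain) :
    (affineOp A₀ A y).IsInvertible := by
  have hu := isUnit_one_add (((norm_fluctuation_le_half hB hy).trans hρ).trans_lt hρ1)
  rw [affineOp_eq hA₀ hB hy]
  exact hA₀.comp (ContinuousLinearMap.IsInvertible.of_inverse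
    (Ring.mul_inverse_cancel _ hu) (Ring.inverse_mul_cancel _ hu))

theorem solution_eq (hA₀ : A₀.IsInvertible)
    (hB : Summable fun j => ‖precond A₀ A j‖) (hρ : (∑' j, ‖precond A₀ A j‖) / 2 ≤ ρ) (hρ1 : ρ < 1)
    (f : StrongDual ℝ Y) {y : ℕ → ℝ} (hy : y ∈ paramDomain) :
    solution A₀ A f y = resolvent (precond A₀ A) y (A₀.inverse f) := by
  have hu := isUnit_one_add (((norm_fluctuation_le_half hB hy).trans hρ).trans_lt hρ1)
  rw [solution, (affineOp_isInvertible hA₀ hB hρ hρ1 hy).inverse_apply_eq, affineOp_eq hA₀ hB hy]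
  have h1 := congrArg (fun S : X →L[ℝ] X => S (A₀.inverse f)) (Ring.mul_inverse_cancel _ hu)
  exact ((congrArg A₀ h1).trans (hA₀.self_apply_inverse f)).symm

theorem norm_affineOp_le (hA₀ : A₀.IsInvertible)
    (hB : Summable fun j => ‖precond A₀ A j‖) (hρ : (∑' j, ‖precond A₀ A j‖) / 2 ≤ ρ)
    {y : ℕ → ℝ} (hy : y ∈ paramDomain) :
    ‖affineOp A₀ A y‖ ≤ ‖A₀‖ * (1 + ρ) := by
  rw [affineOp_eq hA₀ hB hy]
  refine (ContinuousLinearMap.opNorm_comp_le _ _).trans ?_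
  gcongr
  exact (norm_add_le _ _).trans (add_le_add ContinuousLinearMap.norm_id_le
    ((norm_fluctuation_le_half hB hy).trans hρ))

/-- The Petrov-Galerkin error in a functional, uniformly in the parameter. -/
theorem exists_galerkin_bound (hY : IsReflexive Y) (hA₀ : A₀.IsInvertible)
    (hB : Summable fun j => ‖precond A₀ A j‖) (hρ : (∑' j, ‖precond A₀ A j‖) / 2 ≤ ρ) (hρ1 : ρ < 1)
    {SX : SmoothnessScale X}
    {SY : SmoothnessScale Y} {SXd : SmoothnessScale (StrongDual ℝ X)}
    {SYd : SmoothnessScale (StrongDual ℝ Y)} {Xh : ℝ → Submodule ℝ X} {Yh : ℝ → Submodule ℝ Y}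
    (hXfin : ∀ h : ℝ, 0 < h → FiniteDimensional ℝ (Xh h))
    (hYfin : ∀ h : ℝ, 0 < h → FiniteDimensional ℝ (Yh h)) {h₀ : ℝ} {μ : ℝ} (hμ : 0 < μ)
    (hstab : ∀ h : ℝ, 0 < h → h ≤ h₀ → ∀ y ∈ paramDomain,
      InfSup (affineOp A₀ A y) (Xh h) (Yh h) μ)
    {tmax tmax' : ℝ≥0} (hXapp : ApproximationProperty SX Xh h₀ tmax)
    (hYapp : ApproximationProperty SY Yh h₀ tmax') (hreg : SolutionRegularity A₀ A SX SYd tmax)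
    {t t' : ℝ≥0} (ht0 : 0 < t) (ht : t ≤ tmax) (ht0' : 0 < t') (ht' : t' ≤ tmax') (K : ℝ) :
    ∃ C : ℝ, 0 ≤ C ∧ ∀ h : ℝ, 0 < h → h ≤ h₀ → ∀ (f : SYd.space t) (G : SXd.space t'),
      AdjointRegularity A₀ A SY SXd t' K G → ∀ y ∈ paramDomain,
        |(G : StrongDual ℝ X) (solution A₀ A f y) -
          (G : StrongDual ℝ X) (pgSolution A₀ A (Xh h) (Yh h) f y)| ≤
        C * (h ^ ((t : ℝ) + (t' : ℝ)) * SYd.nrm t f * SXd.nrm t' G) := by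
  obtain ⟨C₁, hC₁⟩ := hXapp t ht0 ht
  obtain ⟨C₂, hC₂⟩ := hYapp t' ht0' ht'
  obtain ⟨M, hM⟩ := hreg t ht
  have hρ0 : 0 ≤ ρ := le_trans (by positivity) hρ
  set a := ‖A₀‖ * (1 + ρ) with ha
  have ha0 : 0 ≤ a := by positivity
  -- The assumed constants carry no sign, hence the absolute values; `a` bounds ‖A(y)‖ uniformly, so
  -- the Aubin-Nitsche constant does not depend on y.
  refine ⟨a * (1 + a / μ) * (|C₁| * |M|) * (|C₂| * |K|), by positivity,
    fun h hh hh0 f G hG y hy => ?_⟩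
  have := hXfin h hh
  have := hYfin h hh
  have hinv := affineOp_isInvertible hA₀ hB hρ hρ1 hy
  have hIS := hstab h hh hh0 y hy
  have hpg : IsPGSolution (affineOp A₀ A y) (Xh h) (Yh h) f
      (pgSolution A₀ A (Xh h) (Yh h) f y) :=
    Classical.epsilon_spec (hIS.existsUnique hμ f).exists
  -- Adjoint regularity speaks only about given solutions of the adjoint problem, so one has to be
  -- produced first.
  obtain ⟨w, hw⟩ := exists_adjoint_solution hY hinv (G : StrongDual ℝ X)
  obtain ⟨hwmem, hwn⟩ := hG y hy w hw
  obtain ⟨humem, hun⟩ := hM y hy f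
  have hf0 : 0 ≤ SYd.nrm t f := apply_nonneg _ _
  have hG0 : 0 ≤ SXd.nrm t' G := apply_nonneg _ _
  have hht : 0 ≤ h ^ (t : ℝ) := Real.rpow_nonneg hh.le _
  have hht' : 0 ≤ h ^ (t' : ℝ) := Real.rpow_nonneg hh.le _
  have e1 : ⨅ vh : Xh h, ‖solution A₀ A f y - (vh : X)‖ ≤
      |C₁| * h ^ (t : ℝ) * (|M| * SYd.nrm t f) := by
    refine (hC₁ h hh hh0 ⟨_, humem⟩).trans ?_
    have hu0 : 0 ≤ SX.nrm t ⟨solution A₀ A f y, humem⟩ := apply_nonneg _ _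
    gcongr
    · exact le_abs_self _
    · exact hun.trans (by gcongr; exact le_abs_self _)
  have e2 : ⨅ wh : Yh h, ‖w - (wh : Y)‖ ≤ |C₂| * h ^ (t' : ℝ) * (|K| * SXd.nrm t' G) := by
    refine (hC₂ h hh hh0 ⟨_, hwmem⟩).trans ?_
    have hw0 : 0 ≤ SY.nrm t' ⟨w, hwmem⟩ := apply_nonneg _ _
    gcongr
    · exact le_abs_self _
    · exact hwn.trans (by gcongr; exact le_abs_self _)
  have hnorm := norm_affineOp_le hA₀ hB hρ hy
  have hAu : affineOp A₀ A y (solution A₀ A f y) = f := hinv.self_apply_inverse f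
  have key := exists_mul_mul_le_of_iInf_le (c := a * (1 + a / μ)) (fun vh : Xh h => norm_nonneg _)
    (fun wh : Yh h => norm_nonneg _) (by positivity) (fun vh wh =>
      (hIS.abs_functional_sub_le hμ hAu hpg hw vh.2 wh.2).trans
        (by gcongr)) e1 e2
  refine key.trans (le_of_eq ?_)
  rw [Real.rpow_add hh]
  ring

end Affine

/-! ### The rate and the assembly of the error bound. -/

theorem one_div_lt_order (p : ℝ) : 1 / p < order p := by
  rw [order]
  push_cast
  exact Nat.lt_floor_add_one _

theorem rate_nonneg {p : ℝ} {β : ℕ → ℝ} {s : ℕ} {N : ℝ} (hN : 0 ≤ N) : 0 ≤ rate p β s N := by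
  rw [rate]
  split_ifs <;> positivity

/-- The dimension truncation and quadrature errors are of the order of the rate. -/
theorem exists_le_rate {β : ℕ → ℝ} (hβ0 : ∀ j, 0 ≤ β j) (hβ : Antitone β) {p : ℝ}
    (hp0 : 0 < p) (hp1 : p ≤ 1) (hsum : Summable fun j => β j ^ p) :
    ∃ C : ℝ, 0 ≤ C ∧ ∀ (s : ℕ) (N : ℝ), 1 ≤ s → 0 ≤ N →
      (∑' j, β (s + j)) ^ 2 ≤ C * rate p β s N ∧ N ^ (-(1 / p)) ≤ C * rate p β s N := by
  set σ := (∑' j, β j ^ p) ^ (1 / p) with hσ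
  have hσ0 : 0 ≤ σ := Real.rpow_nonneg (tsum_nonneg fun j => Real.rpow_nonneg (hβ0 j) p) _
  refine ⟨1 + σ ^ 2, by positivity, fun s N hs hN => ?_⟩
  have h1 : N ^ (-(1 / p)) ≤ rate p β s N := by
    rw [rate]
    split_ifs with h
    · exact le_add_of_nonneg_left (by positivity)
    · have : p = 1 := le_antisymm hp1 (not_lt.1 h)
      rw [this, div_one, Real.rpow_neg_one]
      exact le_add_of_nonneg_left (by positivity)
  -- For p < 1 this is Stechkin's estimate squared; for p = 1 the squared tail is itself part of the
  -- rate.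
  have h2 : (∑' j, β (s + j)) ^ 2 ≤ (1 + σ ^ 2) * rate p β s N := by
    rw [rate]
    split_ifs with h
    · have h3 := tsum_tail_le_of_antitone hβ0 hβ hp0 hp1 hsum hs
      have h4 : ((s : ℝ) ^ (-(1 / p - 1))) ^ 2 = (s : ℝ) ^ (-2 * (1 / p - 1)) := by
        rw [← Real.rpow_mul_natCast (Nat.cast_nonneg s)]
        congr 1
        push_cast
        ring
      have h5 : 0 ≤ (s : ℝ) ^ (-2 * (1 / p - 1)) := by positivity
      have h6 : 0 ≤ N ^ (-(1 / p)) := by positivity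
      calc _ ≤ (σ * (s : ℝ) ^ (-(1 / p - 1))) ^ 2 := by
            gcongr
            exact tsum_nonneg fun j => hβ0 _
        _ = σ ^ 2 * (s : ℝ) ^ (-2 * (1 / p - 1)) := by rw [mul_pow, h4]
        _ ≤ (1 + σ ^ 2) * ((s : ℝ) ^ (-2 * (1 / p - 1)) + N ^ (-(1 / p))) := by
            gcongr
            · linarith
            · linarith
    · have h5 : 0 ≤ N⁻¹ := by positivity
      have h6 : 0 ≤ (∑' j, β (s + j)) ^ 2 := sq_nonneg _
      have h7 : 0 ≤ σ ^ 2 := by positivity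
      nlinarith [mul_nonneg h7 (add_nonneg h6 h5)]
  refine ⟨h2, h1.trans ?_⟩
  have h0 := rate_nonneg (p := p) (β := β) (s := s) hN
  nlinarith [mul_nonneg (sq_nonneg σ) h0]

theorem abs_qmcRule_sub_le (b : ℕ) [Fact b.Prime] {α m s : ℕ} {P : (ZMod b)[X]}
    {q : Fin s → Fin α → (ZMod b)[X]} {F F' : (ℕ → ℝ) → ℝ} {ε : ℝ}
    (h : ∀ n, |F (extendZero fun j => interlacedPoint b α m s P q n j - 1 / 2) -
      F' (extendZero fun j => interlacedPoint b α m s P q n j - 1 / 2)| ≤ ε) :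
    |qmcRule b α m s P q F - qmcRule b α m s P q F'| ≤ ε := by
  have hb : (0 : ℝ) < b := by exact_mod_cast (Fact.out : b.Prime).pos
  rw [qmcRule, qmcRule, ← mul_sub, ← Finset.sum_sub_distrib, abs_mul,
    abs_of_nonneg (by positivity), one_div, inv_mul_le_iff₀ (by positivity)]
  refine (Finset.abs_sum_le_sum_abs _ _).trans ((Finset.sum_le_sum fun n _ => h n).trans ?_)
  simp

end QMCPetrovGalerkin

theorem mainTheorem6
    {X Y : Type*}
    [NormedAddCommGroup X] [NormedSpace ℝ X] [CompleteSpace X] [TopologicalSpace.SeparableSpace X]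
    [NormedAddCommGroup Y] [NormedSpace ℝ Y] [CompleteSpace Y] [TopologicalSpace.SeparableSpace Y]
    (hXrefl : QMCPetrovGalerkin.IsReflexive X) (hYrefl : QMCPetrovGalerkin.IsReflexive Y)
    (A₀ : X →L[ℝ] StrongDual ℝ Y) (A : ℕ → X →L[ℝ] StrongDual ℝ Y)
    -- the nominal operator is boundedly invertible, the fluctuations are small and ordered
    (hA₀ : ∃ μ₀ : ℝ, 0 < μ₀ ∧ QMCPetrovGalerkin.InfSup A₀ ⊤ ⊤ μ₀)
    (hβsum : Summable (QMCPetrovGalerkin.beta A₀ A))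
    (hβsmall : ∃ κ : ℝ, 0 < κ ∧ κ < 2 ∧ ∑' j, QMCPetrovGalerkin.beta A₀ A j ≤ κ)
    (hβanti : Antitone (QMCPetrovGalerkin.beta A₀ A))
    -- p-summability
    (p : ℝ) (hp0 : 0 < p) (hp1 : p ≤ 1) (hpsum : Summable fun j => ‖A j‖ ^ p)
    -- smoothness scales of X, Y and of the duals X', Y'
    (SX : QMCPetrovGalerkin.SmoothnessScale X) (SY : QMCPetrovGalerkin.SmoothnessScale Y)
    (SXd : QMCPetrovGalerkin.SmoothnessScale (StrongDual ℝ X))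
    (SYd : QMCPetrovGalerkin.SmoothnessScale (StrongDual ℝ Y))
    -- the trial and test spaces: finite dimensional, uniformly stable, approximating
    (Xh : ℝ → Submodule ℝ X) (Yh : ℝ → Submodule ℝ Y)
    (hXfin : ∀ h : ℝ, 0 < h → FiniteDimensional ℝ (Xh h))
    (hYfin : ∀ h : ℝ, 0 < h → FiniteDimensional ℝ (Yh h))
    (h₀ : ℝ) (hh₀ : 0 < h₀)
    (hstab : ∃ μ : ℝ, 0 < μ ∧ ∀ h : ℝ, 0 < h → h ≤ h₀ → ∀ y ∈ QMCPetrovGalerkin.paramDomain,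
      QMCPetrovGalerkin.InfSup (QMCPetrovGalerkin.affineOp A₀ A y) (Xh h) (Yh h) μ)
    (tmax tmax' : ℝ≥0)
    (hXapp : QMCPetrovGalerkin.ApproximationProperty SX Xh h₀ tmax)
    (hYapp : QMCPetrovGalerkin.ApproximationProperty SY Yh h₀ tmax')
    (hreg : QMCPetrovGalerkin.SolutionRegularity A₀ A SX SYd tmax)
    (t t' : ℝ≥0) (ht0 : 0 < t) (ht : t ≤ tmax) (ht0' : 0 < t') (ht' : t' ≤ tmax')
    -- the constant of the adjoint regularity, and the prime base of the quadrature rule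
    (K : ℝ) (b : ℕ) [Fact b.Prime] :
    -- all quantities in the error bound are well defined
    (∀ y ∈ QMCPetrovGalerkin.paramDomain,
      (QMCPetrovGalerkin.affineOp A₀ A y).IsInvertible) ∧
    (∀ h : ℝ, 0 < h → h ≤ h₀ → ∀ y ∈ QMCPetrovGalerkin.paramDomain, ∀ f : StrongDual ℝ Y,
      ∃! uh : X, QMCPetrovGalerkin.IsPGSolution
        (QMCPetrovGalerkin.affineOp A₀ A y) (Xh h) (Yh h) f uh) ∧
    (∀ (f : StrongDual ℝ Y) (G : StrongDual ℝ X),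
      Integrable (fun y => G (QMCPetrovGalerkin.solution A₀ A f y))
        QMCPetrovGalerkin.paramMeasure) ∧
    -- the error bound
    ∃ C : ℝ, 0 < C ∧ ∀ s m : ℕ, 1 ≤ s → 1 ≤ m →
      ∀ P : (ZMod b)[X], Irreducible P → P.natDegree = m →
      ∃ q : Fin s → Fin (QMCPetrovGalerkin.order p) → (ZMod b)[X],
        (∀ j k, q j k ∈ QMCPetrovGalerkin.genPolys b m) ∧
        ∀ h : ℝ, 0 < h → h ≤ h₀ → ∀ (f : SYd.space t) (G : SXd.space t'),
          QMCPetrovGalerkin.AdjointRegularity A₀ A SY SXd t' K G →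
          |(∫ y, (G : StrongDual ℝ X) (QMCPetrovGalerkin.solution A₀ A f y)
                ∂QMCPetrovGalerkin.paramMeasure) -
            QMCPetrovGalerkin.qmcRule b (QMCPetrovGalerkin.order p) m s P q (fun y =>
              (G : StrongDual ℝ X) (QMCPetrovGalerkin.pgSolution A₀ A (Xh h) (Yh h) f y))| ≤
          C * (QMCPetrovGalerkin.rate p (QMCPetrovGalerkin.beta A₀ A) s ((b : ℝ) ^ m) *
                ‖(f : StrongDual ℝ Y)‖ * ‖(G : StrongDual ℝ X)‖ +
              h ^ ((t : ℝ) + (t' : ℝ)) * SYd.nrm t f * SXd.nrm t' G) := by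
  obtain ⟨μ₀, hμ₀, hIS₀⟩ := hA₀
  obtain ⟨κ, -, hκ2, hκ⟩ := hβsmall
  obtain ⟨μ, hμ, hstab⟩ := hstab
  have hinv₀ := hIS₀.isInvertible hYrefl hμ₀
  have hB : Summable fun j => ‖QMCPetrovGalerkin.precond A₀ A j‖ := hβsum
  have hρ : (∑' j, ‖QMCPetrovGalerkin.precond A₀ A j‖) / 2 ≤ κ / 2 := by
    gcongr
    exact hκ
  have hρ1 : κ / 2 < 1 := by linarith
  -- The p-summability passes to the β_j through β_j ≤ ‖A₀⁻¹‖ ‖A_j‖.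
  have hBp : Summable fun j => ‖QMCPetrovGalerkin.precond A₀ A j‖ ^ p := by
    refine Summable.of_nonneg_of_le (fun j => by positivity) (fun j => ?_)
      (hpsum.mul_left (‖A₀.inverse‖ ^ p))
    rw [← Real.mul_rpow (norm_nonneg A₀.inverse) (norm_nonneg (A j))]
    exact Real.rpow_le_rpow (norm_nonneg _) (ContinuousLinearMap.opNorm_comp_le _ _) hp0.le
  have hsol := fun (f : StrongDual ℝ Y) (y : ℕ → ℝ) (hy : y ∈ QMCPetrovGalerkin.paramDomain) =>
    QMCPetrovGalerkin.solution_eq hinv₀ hB hρ hρ1 f hy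
  refine ⟨fun y hy => QMCPetrovGalerkin.affineOp_isInvertible hinv₀ hB hρ hρ1 hy,
    fun h hh hh0 y hy f => ?_, fun f G => ?_, ?_⟩
  · have := hXfin h hh
    have := hYfin h hh
    exact (hstab h hh hh0 y hy).existsUnique hμ f
  · refine (QMCPetrovGalerkin.integrable_functional_resolvent hB hρ hρ1 G (A₀.inverse f)).congr ?_
    filter_upwards [QMCPetrovGalerkin.ae_mem_paramDomain] with y hy
    rw [hsol f y hy]
  obtain ⟨Cg, hCg0, hCg⟩ := QMCPetrovGalerkin.exists_galerkin_bound hYrefl hinv₀ hB hρ hρ1 hXfin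
    hYfin hμ hstab hXapp hYapp hreg ht0 ht ht0' ht' K
  obtain ⟨Cq, hCq0, hCq⟩ := QMCPetrovGalerkin.exists_interlaced_rule (b := b) hB hρ hρ1 hp0 hp1 hBp
    (QMCPetrovGalerkin.one_div_lt_order p)
  obtain ⟨Cr, hCr0, hCr⟩ := QMCPetrovGalerkin.exists_le_rate (fun j => norm_nonneg _) hβanti hp0 hp1
    hBp
  have hκ0 : 0 < 1 - κ / 2 := by linarith
  -- The truncation constant is the cubed resolvent bound; ‖A₀⁻¹‖ comes from replacing A₀⁻¹f by f,
  -- and `Cr` from passing to the rate.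
  set D : ℝ := ‖A₀.inverse‖ * (((1 - κ / 2)⁻¹) ^ 3 + Cq) * Cr with hD
  have hD0 : 0 ≤ D := by positivity
  refine ⟨D + Cg + 1, by positivity, fun s m hs hm P hP hdeg => ?_⟩
  obtain ⟨q, hq, hmem, hrule⟩ := hCq s m hm P hP hdeg
  refine ⟨q, hq, fun h hh hh0 f G hG => ?_⟩
  set N : ℝ := (b : ℝ) ^ m with hN
  have hN0 : 0 ≤ N := by positivity
  obtain ⟨hr1, hr2⟩ := hCr s N hs hN0
  set v := A₀.inverse (f : StrongDual ℝ Y) with hv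
  set r := QMCPetrovGalerkin.rate p (QMCPetrovGalerkin.beta A₀ A) s N with hr
  have hr0 : 0 ≤ r := QMCPetrovGalerkin.rate_nonneg hN0
  have hvn : ‖v‖ ≤ ‖A₀.inverse‖ * ‖(f : StrongDual ℝ Y)‖ := A₀.inverse.le_opNorm _
  have hint : ∫ y, (G : StrongDual ℝ X) (QMCPetrovGalerkin.solution A₀ A f y)
      ∂QMCPetrovGalerkin.paramMeasure = ∫ y, (G : StrongDual ℝ X)
        (QMCPetrovGalerkin.resolvent (QMCPetrovGalerkin.precond A₀ A) y v)
      ∂QMCPetrovGalerkin.paramMeasure := by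
    refine integral_congr_ae ?_
    filter_upwards [QMCPetrovGalerkin.ae_mem_paramDomain] with y hy
    rw [hsol f y hy]
  have h1 := QMCPetrovGalerkin.abs_integral_sub_integral_truncParam_le hB hρ hρ1
    (G : StrongDual ℝ X) v s
  have h2 := hrule (G : StrongDual ℝ X) v
  have h3 := QMCPetrovGalerkin.abs_qmcRule_sub_le b (α := QMCPetrovGalerkin.order p) (m := m)
    (P := P) (q := q)
    (F := fun y => (G : StrongDual ℝ X)
      (QMCPetrovGalerkin.resolvent (QMCPetrovGalerkin.precond A₀ A) y v))
    (F' := fun y => (G : StrongDual ℝ X)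
      -- The Galerkin bound is needed only at the nodes, which lie in U.
      (QMCPetrovGalerkin.pgSolution A₀ A (Xh h) (Yh h) f y)) (fun n => by
        have := hCg h hh hh0 f G hG _ (hmem n)
        rwa [hsol f _ (hmem n)] at this)
  have hrate : ‖(G : StrongDual ℝ X)‖ * ‖v‖ * (((1 - κ / 2)⁻¹) ^ 3 *
      (∑' j, ‖QMCPetrovGalerkin.precond A₀ A (s + j)‖) ^ 2) +
      Cq * ‖(G : StrongDual ℝ X)‖ * ‖v‖ * N ^ (-(1 / p)) ≤
      D * (r * ‖(f : StrongDual ℝ Y)‖ * ‖(G : StrongDual ℝ X)‖) := by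
    calc _ ≤ ‖(G : StrongDual ℝ X)‖ * (‖A₀.inverse‖ * ‖(f : StrongDual ℝ Y)‖) *
          (((1 - κ / 2)⁻¹) ^ 3 * (Cr * r)) +
          Cq * ‖(G : StrongDual ℝ X)‖ * (‖A₀.inverse‖ * ‖(f : StrongDual ℝ Y)‖) * (Cr * r) := by
          gcongr
          · exact hr1
          · exact hr2
      _ = _ := by rw [hD]; ring
  set E : ℝ := h ^ ((t : ℝ) + (t' : ℝ)) * SYd.nrm t f * SXd.nrm t' G with hE
  have hE0 : 0 ≤ E := mul_nonneg (mul_nonneg (Real.rpow_nonneg hh.le _) (apply_nonneg _ _))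
    (apply_nonneg _ _)
  have hR0 : 0 ≤ r * ‖(f : StrongDual ℝ Y)‖ * ‖(G : StrongDual ℝ X)‖ := by positivity
  rw [hint]
  -- Two triangle inequalities, through the integral of the truncated exact solution and the rule
  -- applied to the exact solution.
  refine ((abs_sub_le _ _ _).trans (add_le_add ((abs_sub_le _ _ _).trans (add_le_add h1 h2))
    h3)).trans ?_
  nlinarith [mul_nonneg hD0 hE0, mul_nonneg hCg0 hR0]
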